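/- **Setting.** Let $A\subset\mathbb R^2$ be a simply connected orthogonal polygon and $P=A\times[0,H]$, $H>0$ (a single-layer Manhattan Tower). Take a rectangular grid of coordinate lines containing all edges of $A$. The planes orthogonal to $y$ through the grid lines cut $P$ into rectangular boxes, whose adjacency graph is a tree. Fix as root a box $r_0$ whose front face (the side facing $-y$) has minimum $y$-coordinate; this gives the recursion tree. Divide each grid interval in $x$ into 4 and each grid interval in $y$ into 5 equal parts; the corresponding planes cut the surface of $P$ into *gridfaces* and *gridedges*. The *support faces* of a box are its top, right, bottom and left faces; its gridfaces there form 5 rows $0,\dots,4$ from front to back, and columns in cyclic order around the box. **The algorithm** UNFOLD$(r,y_s,y_t)$ is run in a frame for the box $r$, obtained from the coordinate system by half-turns about the $y$- and $z$-axes, in which the parent of $r$ (if any) is at the front and $t$ is on the top front edge; $s$ is a gridpoint adjacent to $t$ on that edge, or the point of the bottom front edge below $t$; $y_s,y_t$ are the $y$-gridedges of row $0$ incident to $s,t$. The frame of the root is the given one. Clockwise means left to right on the top. The algorithm cuts out a strip $\xi_{3d}$ of gridfaces, each attached along an edge to an earlier one, as follows. 1. *Front spiral*: clockwise from $y_s$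 to $y_t$ in rows $0,1$. When a front child (a box other than the parent adjoining the front face) is first met, on the top or the bottom, a strip $I$ one gridface wide across the front face, next to the child, and then a bite $J$ of three gridfaces in row $0$ of the opposite (bottom or top) face, one at the place of $I$ and two alongside the child, lead to the child. The child is unfolded recursively, with $s'$ on the edge where $J$ runs, one gridface beyond the end of the child that was met, and $t'$ on the opposite edge with the same $x$-coordinate (same-direction suture). Then the front spiral resumes where it left off. 2. *Second cycle*: at $y_t$ the strip turns left, through rows $2,3$ of the last column before $t$, and continues clockwise from $t$ in row $3$. If $r$ has no back children, it does so to the right face, on which it takes rows $3,4$, and to the rightmost column of the bottom, where it also takes rows $3,4$; then it crosses the back face in a strip one gridface wide, reaching row $4$ of the rightmost column of the top. If $r$ has back children, let $u$ be the rightmost gridpoint that the back face shares with one. If $t$ is not to the right of $u$, the cycle stops in the last column of the top left of $u$; otherwise it stops in the second column of the bottom left of $u$. There row $4$ is added as a strip leading to the rightmost back child, which is unfolded recursively, with $s'$ at the corner of this strip that comes first in walking direction and $t'$ the gridpoint just before $s'$ (reverse-direction suture). 3. *Backward spiral*: the strip then runs counterclockwise back to $y_t$ over everything left of the support faces: first in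 row $4$ up to and including the column through which it turned at $t$, then in rows $2,3,4$ up to the column where the second cycle ended, then in row $2$; in the columns not covered by the front spiral it also takes rows $0,1$. Each further back child, when first met, is unfolded recursively by a same-direction suture, with the strip $I$ on the back face and the bite $J$ in row $4$. In recursive calls on front children the forward direction is reversed; in every call, if $t$ lies on the bottom, the frame is turned upside down by a half-turn about the $y$-axis. **Theorem.** Let $s,t$ be any two adjacent gridpoints of the top front edge of $r_0$, and let UNFOLD$(r,y_s,y_t)$ be the call at $r_0$ with these points or any of the recursive calls that it makes. Then its strip $\xi_{3d}$ is one connected piece of the surface of $P$, made of distinct gridfaces of boxes of the recursion subtree rooted at $r$, and it contains all gridfaces of the support faces of all boxes of that subtree. It unfolds isometrically into the plane, without overlap, to a strip $\xi_{2d}$ that is monotone in the horizontal direction (every vertical line meets it in a connected set), and that lies between two vertical lines, the left one containing the start gridedge $y_s$ and the right one containing the end gridedge $y_t$. -/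

import Mathlib

/-! Single-layer Manhattan Towers, their refined surface grid, the recursive spiral
unfolding of their boxes, and planar developments of surface pieces. -/

namespace ManhattanTower

/-! ### Boxes and gridfaces -/

/-- A box of the partition: the cells `lo, ..., hi - 1` of the slab number `slab`, where the slabs
are the regions between consecutive grid planes orthogonal to the `y`-axis. -/
structure Box where
  slab : ℕ
  lo : ℕ
  hi : ℕ
deriving DecidableEq

/-- A face of the `4 × 5 × 1` refined surface grid. The indices count refined grid planes, four per
grid interval in `x` and five per grid interval in `y`.
`horizontal top k l` is the face `[X k, X (k+1)] × [Y l, Y (l+1)]` at the top or bottom;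
`lateral right k l` is the face `{X k} × [Y l, Y (l+1)] × [0, H]` with normal `+x` or `-x`;
`vertical back k l` is the face `[X k, X (k+1)] × {Y l} × [0, H]` with normal `+y` or `-y`. -/
inductive GridFace where
  | horizontal (top : Bool) (k l : ℕ)
  | lateral (right : Bool) (k l : ℕ)
  | vertical (back : Bool) (k l : ℕ)
deriving DecidableEq

/-- A maximal run of cells in one slab. -/
def IsBox (cells : Finset (ℕ × ℕ)) (b : Box) : Prop :=
  b.lo < b.hi ∧ (∀ i, b.lo ≤ i → i < b.hi → (i, b.slab) ∈ cells) ∧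
    (b.hi, b.slab) ∉ cells ∧ (∀ i, i + 1 = b.lo → (i, b.slab) ∉ cells)

/-- Two boxes are adjacent if they lie in consecutive slabs and share a part of a face. -/
def BoxAdj (a b : Box) : Prop :=
  (a.slab + 1 = b.slab ∨ b.slab + 1 = a.slab) ∧ max a.lo b.lo < min a.hi b.hi

/-- The dual graph of the partition into boxes. -/
def dualGraph (cells : Finset (ℕ × ℕ)) : SimpleGraph Box where
  Adj a b := IsBox cells a ∧ IsBox cells b ∧ BoxAdj a b
  symm := ⟨fun a b h => ⟨h.2.1, h.1, h.2.2.1.symm, by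
    have h2 := h.2.2.2
    rwa [max_comm, min_comm] at h2⟩⟩
  loopless := ⟨fun a h => by
    have h1 := h.2.2.1
    omega⟩

/-- The boxes of the subtree at `a` of the recursion tree with root `r`: those that can be reached
from `r` only through `a`. -/
def subtree (cells : Finset (ℕ × ℕ)) (r a : Box) : Set Box :=
  {b | IsBox cells b ∧ ∀ w : (dualGraph cells).Walk r b, a ∈ w.support}

/-- The gridfaces of the support faces (top, bottom, right, left) of a box. -/
def supportFaces (b : Box) : Set GridFace :=
  {f | (∃ top k l, f = .horizontal top k l ∧ 4 * b.lo ≤ k ∧ k < 4 * b.hi ∧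
          5 * b.slab ≤ l ∧ l < 5 * b.slab + 5) ∨
       (∃ l, (f = .lateral true (4 * b.hi) l ∨ f = .lateral false (4 * b.lo) l) ∧
          5 * b.slab ≤ l ∧ l < 5 * b.slab + 5)}

theorem runEnd_exists (cells : Finset (ℕ × ℕ)) (i j : ℕ) :
    ∃ k, i ≤ k ∧ (k, j) ∉ cells := by
  refine ⟨i + (cells.sup Prod.fst + 1), Nat.le_add_right _ _, fun h => ?_⟩
  have := Finset.le_sup (f := Prod.fst) h
  simp only at this
  omega

theorem runStart_exists (cells : Finset (ℕ × ℕ)) (i j : ℕ) :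
    ∃ k, ∀ q ∈ Finset.Icc k i, (q, j) ∈ cells :=
  ⟨i + 1, fun q hq => by
    have := Finset.mem_Icc.1 hq
    omega⟩

/-- The box containing the cell `(i, j)`, if this is a cell. -/
def boxAt (cells : Finset (ℕ × ℕ)) (i j : ℕ) : Option Box :=
  if (i, j) ∈ cells then
    some ⟨j, Nat.find (runStart_exists cells i j), Nat.find (runEnd_exists cells i j)⟩
  else none

/-! ### Calls of the algorithm

A call consists of a box, its parent, a frame of reference and the gridpoints `s` and `t`.
In the frame, `+y` is the forward direction of the spiral and `t` lies on the top front edge.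
The frame arises from the coordinate system by half-turns: about the `z`-axis if `reversed`
(exchanging front with back and left with right), and about the `y`-axis if `inverted` (exchanging
top with bottom and left with right). Both preserve orientation, so that the forward spiral of
every call is clockwise in its frame. All positions of a call are read in its frame. -/

structure Call where
  box : Box
  parent : Option Box
  reversed : Bool
  inverted : Bool
  /-- Position of `s` along the front edge that it lies on, counted in gridfaces from the left. -/
  s : ℕ
  /-- Whether `s` lies on the top front edge (and not on the bottom front edge). -/
  sTop : Bool
  /-- Position of `t` along the top front edge, counted in gridfaces from the left. -/
  t : ℕ
deriving DecidableEq

namespace Call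

/-- Number of gridfaces along the width of the box. -/
def width (c : Call) : ℕ := 4 * (c.box.hi - c.box.lo)

/-- Number of columns of gridfaces around the support faces. -/
def girth (c : Call) : ℕ := 2 * c.width + 2

/-- Whether left and right are exchanged in the frame of the call. -/
def mirrored (c : Call) : Bool := xor c.reversed c.inverted

/-- The refined `x`-plane at position `p`, counted from the left. -/
def plane (c : Call) (p : ℕ) : ℕ :=
  if c.mirrored then 4 * c.box.hi - p else 4 * c.box.lo + p

/-- The position of a refined `x`-plane. -/
def position (c : Call) (g : ℕ) : ℕ :=
  if c.mirrored then 4 * c.box.hi - g else g - 4 * c.box.lo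

/-- The refined `x`-interval between the positions `j` and `j + 1`. -/
def interval (c : Call) (j : ℕ) : ℕ :=
  if c.mirrored then 4 * c.box.hi - 1 - j else 4 * c.box.lo + j

/-- The refined `y`-interval of row `q`; the rows `0, ..., 4` go from front to back. -/
def row (c : Call) (q : ℕ) : ℕ :=
  5 * c.box.slab + (if c.reversed then 4 - q else q)

/-- The gridface of the support faces in column `i` and row `q`. The columns are numbered
clockwise and modulo the girth: first the top from left to right, then the right face, then the
bottom from right to left, then the left face. The `y`-gridedges between column `i - 1` and
column `i` are called boundary `i`. So position `p` is boundary `p` on the top and boundary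
`2 * width + 1 - p` on the bottom. -/
def support (c : Call) (i q : ℕ) : GridFace :=
  if i % c.girth < c.width then
    .horizontal (!c.inverted) (c.interval (i % c.girth)) (c.row q)
  else if i % c.girth = c.width then
    .lateral (!c.mirrored) (c.plane c.width) (c.row q)
  else if i % c.girth ≤ 2 * c.width then
    .horizontal c.inverted (c.interval (2 * c.width - i % c.girth)) (c.row q)
  else
    .lateral c.mirrored (c.plane 0) (c.row q)

/-- For a column of the top or the bottom, its place `j` along the width. -/
def place (c : Call) (i : ℕ) : Option ℕ :=
  if i % c.girth < c.width then some (i % c.girth)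
  else if i % c.girth = c.width then none
  else if i % c.girth ≤ 2 * c.width then some (2 * c.width - i % c.girth)
  else none

/-- Whether a column of the top or the bottom is a column of the bottom. -/
def onBottom (c : Call) (i : ℕ) : Bool := decide (c.width < i % c.girth)

/-- The column of the bottom or top vertically opposite to a column of the top or bottom. -/
def opposite (c : Call) (i : ℕ) : ℕ := 2 * c.width - i % c.girth

/-- The gridface of the front face at the place of column `i`. -/
def front (c : Call) (i : ℕ) : GridFace :=
  .vertical c.reversed (c.interval ((c.place i).getD 0))
    (5 * c.box.slab + if c.reversed then 5 else 0)

/-- The gridface of the back face at the place of column `i`. -/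
def back (c : Call) (i : ℕ) : GridFace :=
  .vertical (!c.reversed) (c.interval ((c.place i).getD 0))
    (5 * c.box.slab + if c.reversed then 0 else 5)

/-- The boundary of `s`, as a number `S` such that the front spiral, which runs clockwise
from `s` to `t`, consists of the columns `S, ..., girth + t - 1`. -/
def start (c : Call) : ℕ :=
  if c.sTop then (if c.t < c.s then c.s else c.girth + c.s) else 2 * c.width + 1 - c.s

/-- The last gridface of the strip along the front face; the gridedge `y_t` is its last edge. -/
def endFace (c : Call) : GridFace := c.support c.t 0

/-- The box that adjoins the box of the call on its front face along column `i`. -/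
def frontNeighbor (cells : Finset (ℕ × ℕ)) (c : Call) (i : ℕ) : Option Box :=
  (c.place i).bind fun j =>
    if c.reversed then boxAt cells (c.interval j / 4) (c.box.slab + 1)
    else if c.box.slab = 0 then none
    else boxAt cells (c.interval j / 4) (c.box.slab - 1)

/-- The box that adjoins the box of the call on its back face along column `i`. -/
def backNeighbor (cells : Finset (ℕ × ℕ)) (c : Call) (i : ℕ) : Option Box :=
  (c.place i).bind fun j =>
    if c.reversed then
      if c.box.slab = 0 then none else boxAt cells (c.interval j / 4) (c.box.slab - 1)
    else boxAt cells (c.interval j / 4) (c.box.slab + 1)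

/-- The front child along column `i`: a front neighbor other than the parent. -/
def frontChild (cells : Finset (ℕ × ℕ)) (c : Call) (i : ℕ) : Option Box :=
  (c.frontNeighbor cells i).filter fun b => decide (some b ≠ c.parent)

/-- The back child along column `i`. -/
def backChild (cells : Finset (ℕ × ℕ)) (c : Call) (i : ℕ) : Option Box :=
  (c.backNeighbor cells i).filter fun b => decide (some b ≠ c.parent)

/-! ### The two kinds of sutures -/

/-- The call made for a child `b` sutured in the same direction. The points of the child lie
on opposite edges, at the same `x`-coordinate, one gridface away from the end of the child that the
spiral of the parent meets. If the child is met on the top (bottom), then its start point is on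
the bottom (top) and its end point on the top (bottom). In the frame of the child, the end that
is met is always the right end. -/
def sameDirectionCall (c : Call) (b : Box) (front met_on_bottom : Bool) : Call where
  box := b
  parent := some c.box
  reversed := xor c.reversed front
  inverted := xor c.inverted met_on_bottom
  s := 4 * (b.hi - b.lo) - 1
  sTop := false
  t := 4 * (b.hi - b.lo) - 1

/-- The call for the front child that the front spiral first encounters at boundary `i`. -/
def frontSuture (cells : Finset (ℕ × ℕ)) (c : Call) (i : ℕ) : Option Call :=
  (c.frontChild cells i).bind fun b =>
    if ∃ q ∈ Finset.Ico c.start i, c.frontChild cells q = some b then none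
    else some (c.sameDirectionCall b true (c.onBottom i))

/-- The three gridfaces of the bite `J` for the front child encountered at boundary `i`. -/
def frontBite (c : Call) (i : ℕ) : List GridFace :=
  [c.support (c.opposite (i - 1)) 0, c.support (c.opposite (i - 1) - 1) 0,
    c.support (c.opposite (i - 1) - 2) 0]

/-- The position of the rightmost gridpoint shared with a back child; `0` if there is none. -/
def rightmost (cells : Finset (ℕ × ℕ)) (c : Call) : ℕ :=
  Nat.findGreatest (fun u => 0 < u ∧ (c.backChild cells (u - 1)).isSome) c.width

/-- The last column of the second cycle of the forward spiral. Without back children it is the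
column after the right face. Otherwise the cycle stops where it reaches the rightmost shared
gridpoint: on the top, in the last column before it, or, if this point was left of `t` and so is
reached on the bottom, in the second column after it. In both cases this column (which will hold
the strip that leads to the child) and the preceding one adjoin the rightmost back child. -/
def turn (cells : Finset (ℕ × ℕ)) (c : Call) : ℕ :=
  if c.rightmost cells = 0 then c.width + 1
  else if c.t ≤ c.rightmost cells then c.rightmost cells - 1
  else 2 * c.width - (c.rightmost cells - 2)

/-- The call for the rightmost back child. It starts at the left corner (in the walking direction)
of the strip in column `turn`, and ends at the adjacent gridpoint to the left of it. -/
def reverseSuture (cells : Finset (ℕ × ℕ)) (c : Call) : Option Call :=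
  (c.backChild cells (c.rightmost cells - 1)).bind fun b =>
    if c.rightmost cells = 0 then none
    else
      let onTop : Bool := decide (c.t ≤ c.rightmost cells)
      let g : ℕ := if onTop then c.plane (c.rightmost cells - 2) else c.plane (c.rightmost cells)
      let frame : Call := ⟨b, some c.box, c.reversed, xor c.inverted (!onTop), 0, true, 0⟩
      some { frame with s := frame.position g + 1, t := frame.position g }

/-- The column in which the backward spiral starts (or continues after the back face strip); it
then runs through the columns down to `t`, counterclockwise. -/
def backStart (cells : Finset (ℕ × ℕ)) (c : Call) : ℕ :=
  if c.rightmost cells = 0 then c.girth + c.width - 2 else c.girth + c.turn cells - 1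

/-- The call for the back child, other than the rightmost, that the back spiral first encounters
in column `i`. -/
def backSuture (cells : Finset (ℕ × ℕ)) (c : Call) (i : ℕ) : Option Call :=
  (c.backChild cells i).bind fun b =>
    if c.backChild cells (c.rightmost cells - 1) = some b ∨
        ∃ q ∈ Finset.Ioc i (c.backStart cells), c.backChild cells q = some b then none
    else some (c.sameDirectionCall b false (c.onBottom i))

/-- The three gridfaces of the bite `J` for the back child encountered in column `i`. -/
def backBite (c : Call) (i : ℕ) : List GridFace :=
  [c.support (c.opposite (i + 1)) 4, c.support (c.opposite (i + 1) + 1) 4,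
    c.support (c.opposite (i + 1) + 2) 4]

end Call

/-! ### The surface strip -/

/-- A gridface appended to a strip, and the earlier gridface to which it stays attached along their
common edge (`none` for the first gridface of all). All other gridedges are cut. -/
structure Step where
  hinge : Option GridFace
  face : GridFace

/-- A strip on the surface, as the list of its gridfaces in the order of unfolding. -/
abbrev Strip := List Step

/-- A chain of gridfaces, each attached to the one before. -/
def chain : GridFace → List GridFace → Strip
  | _, [] => []
  | g, f :: l => ⟨some g, f⟩ :: chain f l

namespace Call

/-- The front spiral: clockwise from `s` to `t` in the rows `0` and `1`, except for bites.
When it encounters a front child, a strip across the front face and a bite off the opposite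
face lead to the child; after the child is unfolded, the spiral resumes where it left off. -/
def frontSpiral (cells : Finset (ℕ × ℕ)) (recurse : Call → Option GridFace → Strip)
    (c : Call) (h : Option GridFace) : Strip :=
  (List.range (c.girth + c.t - c.start)).flatMap fun q =>
    let i := c.start + q
    match c.frontSuture cells i with
    | some d =>
        chain (c.support (i - 1) 0) (c.front (i - 1) :: c.frontBite i) ++
        recurse d (some (c.support (c.opposite (i - 1) - 2) 0)) ++
        chain d.endFace [c.support i 0, c.support i 1]
    | none =>
        if q = 0 then
          ⟨h, c.support i 0⟩ :: chain (c.support i 0) [c.support i 1]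
        else
          chain (c.support (i - 1) 1) [c.support i 1] ++
          (if ∃ a ∈ Finset.Ico c.start (c.girth + c.t),
              (c.frontSuture cells a).isSome ∧ c.support i 0 ∈ c.frontBite a then []
            else chain (c.support i 1) [c.support i 0])

/-- The rest of the forward spiral: a left turn at `t`, the second cycle in row `3`, and then
either the strip across the back face, or the strip leading to the rightmost back child. -/
def secondCycle (cells : Finset (ℕ × ℕ)) (c : Call) : Strip :=
  let n := c.girth
  let m := c.width
  chain (c.support (n + c.t - 1) 1) [c.support (n + c.t - 1) 2, c.support (n + c.t - 1) 3] ++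
  ((List.range (c.turn cells + 1 - c.t)).flatMap fun q =>
    chain (c.support (n + c.t + q - 1) 3) [c.support (c.t + q) 3]) ++
  (if c.rightmost cells = 0 then
    chain (c.support m 3) [c.support m 4] ++
    chain (c.support (m + 1) 3)
      [c.support (m + 1) 4, c.back (m + 1), c.support (m - 1) 4]
  else
    chain (c.support (c.turn cells) 3) [c.support (c.turn cells) 4])

/-- The backward spiral, counterclockwise down to boundary `t`, over everything that is left of
the support faces: first along row `4` to the column before `t`, then along rows `2, 3, 4` to the
column after `turn`, then along row `2`; in the columns not covered by the front spiral it also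
takes rows `0` and `1`. When it encounters a back child, a strip across the back face and a bite off
the opposite face lead to the child; after the child, the spiral resumes where it left off. -/
def backwardSpiral (cells : Finset (ℕ × ℕ)) (recurse : Call → Option GridFace → Strip)
    (c : Call) : Strip :=
  (List.range (c.backStart cells + 1 - c.t)).flatMap fun q =>
    let i := c.backStart cells - q
    let gap : Strip :=
      if i < c.start then chain (c.support i 2) [c.support i 1, c.support i 0] else []
    let middle : Bool := decide (i + 1 < c.girth + c.t ∧ c.turn cells < i)
    let down : Strip :=
      (if middle then chain (c.support i 4) [c.support i 3, c.support i 2] else []) ++ gap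
    match c.backSuture cells i with
    | some d =>
        chain (c.support (i + 1) 4) (c.back (i + 1) :: c.backBite i) ++
        recurse d (some (c.support (c.opposite (i + 1) + 2) 4)) ++
        chain d.endFace [c.support i 4] ++ down
    | none =>
        if c.girth + c.t ≤ i + 2 then
          (match c.reverseSuture cells, q with
            | some d, 0 => chain d.endFace [c.support i 4]
            | _, _ => chain (c.support (i + 1) 4) [c.support i 4]) ++ down
        else if middle then
          chain (c.support (i + 1) 2) [c.support i 2, c.support i 3] ++
          (if ∃ a ∈ Finset.Icc c.t (c.backStart cells),
              (c.backSuture cells a).isSome ∧ c.support i 4 ∈ c.backBite a then []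
            else chain (c.support i 3) [c.support i 4]) ++ gap
        else
          chain (c.support (i + 1) 2) [c.support i 2] ++ gap

end Call

/-- The recursive unfolding, with recursion depth at most `depth`. The first gridface is attached
to the given gridface of the parent. -/
def unfoldDepth (cells : Finset (ℕ × ℕ)) : ℕ → Call → Option GridFace → Strip
  | 0, _, _ => []
  | depth + 1, c, h =>
    c.frontSpiral cells (unfoldDepth cells depth) h ++
    c.secondCycle cells ++
    (match c.reverseSuture cells with
      | some d => unfoldDepth cells depth d (some (c.support (c.turn cells) 4))
      | none => []) ++
    c.backwardSpiral cells (unfoldDepth cells depth)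

/-- The strip on the surface produced by the algorithm. There are at most as many boxes as
cells, so that this number bounds the depth of the recursion. -/
def UNFOLD (cells : Finset (ℕ × ℕ)) (c : Call) : Strip :=
  unfoldDepth cells cells.card c none

/-- The call of the algorithm for a root box and two gridpoints `s`, `t` of its top front edge. -/
def rootCall (r : Box) (s t : ℕ) : Call := ⟨r, none, false, false, s, true, t⟩

/-- `d` is one of the recursive calls made directly by the call `c`. -/
def IsSubcall (cells : Finset (ℕ × ℕ)) (c d : Call) : Prop :=
  (∃ i ∈ Finset.Ico c.start (c.girth + c.t), c.frontSuture cells i = some d) ∨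
  c.reverseSuture cells = some d ∨
  (∃ i ∈ Finset.Icc c.t (c.backStart cells), c.backSuture cells i = some d)

/-- `d` is the call `c` or one of the recursive calls made, directly or not, by it. -/
def IsCallFrom (cells : Finset (ℕ × ℕ)) (c d : Call) : Prop :=
  Relation.ReflTransGen (IsSubcall cells) c d

/-! ### Manhattan Towers in space -/

/-- The union of the grid cells `[xs i, xs (i+1)] × [ys j, ys (j+1)]`, for `(i, j)` in `cells`. -/
def region (xs ys : ℕ → ℝ) (cells : Finset (ℕ × ℕ)) : Set (ℝ × ℝ) :=
  ⋃ c ∈ cells, Set.Icc (xs c.1) (xs (c.1 + 1)) ×ˢ Set.Icc (ys c.2) (ys (c.2 + 1))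

/-- A single-layer Manhattan Tower: the extrusion of a simply connected orthogonal polygon,
given with a grid of coordinate lines which contains its edges (and so the lines through all
of its vertices). -/
structure SingleLayerMT where
  xs : ℕ → ℝ
  ys : ℕ → ℝ
  height : ℝ
  cells : Finset (ℕ × ℕ)
  xs_strictMono : StrictMono xs
  ys_strictMono : StrictMono ys
  height_pos : 0 < height
  isConnected_interior : IsConnected (interior (region xs ys cells))
  simplyConnected : SimplyConnectedSpace (region xs ys cells)

/-- The planes of the refined grid: each grid interval is divided into `n` equal parts. -/
noncomputable def refine (n : ℕ) (f : ℕ → ℝ) (k : ℕ) : ℝ :=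
  f (k / n) + ((k % n : ℕ) : ℝ) / n * (f (k / n + 1) - f (k / n))

/-- The outward normal. -/
def GridFace.normal : GridFace → Fin 3 → ℝ
  | .horizontal top _ _ => ![0, 0, if top then 1 else -1]
  | .lateral right _ _ => ![if right then 1 else -1, 0, 0]
  | .vertical back _ _ => ![0, if back then 1 else -1, 0]

namespace SingleLayerMT

/-- The polyhedron. -/
def solid (P : SingleLayerMT) : Set (Fin 3 → ℝ) :=
  {p | (p 0, p 1) ∈ region P.xs P.ys P.cells ∧ 0 ≤ p 2 ∧ p 2 ≤ P.height}

/-- The refined grid planes orthogonal to the `x`-axis. -/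
noncomputable def X (P : SingleLayerMT) : ℕ → ℝ := refine 4 P.xs

/-- The refined grid planes orthogonal to the `y`-axis. -/
noncomputable def Y (P : SingleLayerMT) : ℕ → ℝ := refine 5 P.ys

/-- The rectangular box in space. -/
def boxSolid (P : SingleLayerMT) (b : Box) : Set (Fin 3 → ℝ) :=
  Set.Icc ![P.xs b.lo, P.ys b.slab, 0] ![P.xs b.hi, P.ys (b.slab + 1), P.height]

/-- The rectangle of a gridface in space. -/
noncomputable def carrier (P : SingleLayerMT) : GridFace → Set (Fin 3 → ℝ)
  | .horizontal top k l =>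
      Set.Icc ![P.X k, P.Y l, if top then P.height else 0]
        ![P.X (k + 1), P.Y (l + 1), if top then P.height else 0]
  | .lateral _ k l => Set.Icc ![P.X k, P.Y l, 0] ![P.X k, P.Y (l + 1), P.height]
  | .vertical _ k l => Set.Icc ![P.X k, P.Y l, 0] ![P.X (k + 1), P.Y l, P.height]

/-- A root box: a box whose front face has minimum `y`-coordinate. -/
def IsRootBox (P : SingleLayerMT) (r : Box) : Prop :=
  IsBox P.cells r ∧ ∀ b, IsBox P.cells b → P.ys r.slab ≤ P.ys b.slab

/-- The `y`-gridedge incident to the gridpoint of the front face at position `p` of the top or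
bottom front edge, in the frame of the call. -/
noncomputable def gridedge (P : SingleLayerMT) (c : Call) (p : ℕ) (top : Bool) :
    Set (Fin 3 → ℝ) :=
  Set.Icc ![P.X (c.plane p), P.Y (c.row 0), if xor top c.inverted then P.height else 0]
    ![P.X (c.plane p), P.Y (c.row 0 + 1), if xor top c.inverted then P.height else 0]

/-- The start gridedge `y_s` of a call. -/
noncomputable def startEdge (P : SingleLayerMT) (c : Call) : Set (Fin 3 → ℝ) :=
  P.gridedge c c.s c.sTop

/-- The end gridedge `y_t` of a call. -/
noncomputable def endEdge (P : SingleLayerMT) (c : Call) : Set (Fin 3 → ℝ) :=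
  P.gridedge c c.t true

end SingleLayerMT

/-! ### Planar developments -/

/-- A map from space to the plane, given by the directions in space that go to the right and
upwards in the plane. -/
structure Placement where
  right : Fin 3 → ℝ
  up : Fin 3 → ℝ
  offset : ℝ × ℝ

/-- The point of the plane at which a point of space is placed. -/
def Placement.apply (Φ : Placement) (p : Fin 3 → ℝ) : ℝ × ℝ :=
  (p ⬝ᵥ Φ.right + Φ.offset.1, p ⬝ᵥ Φ.up + Φ.offset.2)

/-- The placement lays the face flat in the plane, isometrically and with its outer side up. -/
def Placement.LaysFlat (Φ : Placement) (f : GridFace) : Prop :=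
  Φ.right ⬝ᵥ Φ.right = 1 ∧ Φ.up ⬝ᵥ Φ.up = 1 ∧ Φ.right ⬝ᵥ Φ.up = 0 ∧
    crossProduct Φ.right Φ.up = f.normal

namespace SingleLayerMT

/-- The strip is a single piece of surface: its gridfaces are distinct, and each except the
first shares an edge with the earlier gridface to which it is attached. -/
def IsPiece (P : SingleLayerMT) (ξ : Strip) : Prop :=
  ξ ≠ [] ∧ (ξ.map Step.face).Nodup ∧
  ∀ before step after, ξ = before ++ step :: after →
    (before = [] ∧ step.hinge = none) ∨
    ∃ g ∈ before.map Step.face, step.hinge = some g ∧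
      ∃ a b : Fin 3 → ℝ, a ≠ b ∧ P.carrier g ∩ P.carrier step.face = segment ℝ a b

/-- `Φ` unfolds the strip into the plane: each gridface is laid flat, and gridfaces that are
attached to each other stay together along their common edge. -/
def IsDevelopment (P : SingleLayerMT) (ξ : Strip) (Φ : GridFace → Placement) : Prop :=
  ∀ step ∈ ξ, (Φ step.face).LaysFlat step.face ∧
    ∀ g, step.hinge = some g →
      ∀ p ∈ P.carrier g ∩ P.carrier step.face, (Φ g).apply p = (Φ step.face).apply p

/-- The planar image of a gridface. -/
def planarFace (P : SingleLayerMT) (Φ : GridFace → Placement) (f : GridFace) : Set (ℝ × ℝ) :=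
  (Φ f).apply '' P.carrier f

/-- The planar strip. -/
def planarStrip (P : SingleLayerMT) (ξ : Strip) (Φ : GridFace → Placement) : Set (ℝ × ℝ) :=
  ⋃ f ∈ ξ.map Step.face, P.planarFace Φ f

end SingleLayerMT

end ManhattanTower

namespace ManhattanTower

open Set Topology

/-! ### Boxes as maximal runs of cells -/

section boxes

variable {cells : Finset (ℕ × ℕ)}

/-! Three facts carry the theorem.

The boxes form a tree. Connectedness of the interior makes the adjacency graph connected
(`reachable`). Simple connectedness makes every adjacency a bridge: otherwise the region would carry
a circle-valued function that winds once around a closed path through this adjacency, whereas every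
such function lifts to the line (`exists_labelling`). Hence removing a box separates its neighbours
(`not_avoids_of_adj`), the subtree of a box consists of the box and the disjoint subtrees of its
children, and the size of the subtree decreases in the recursion.

The unfolding goes by columns. `Unrolls` describes strips in which each gridface is placed above or
below the last planar column, or begins a new column on the right of one of its panels. Such a strip
does not overlap itself, meets vertical lines in connected sets, and lies between the left edge of
its first panel and the right edge of its last (`exists_development`). So the geometry reduces to
the question which panels share which corners. Gridfaces of the forward spiral are placed with the
front below; those of the backward spiral are turned by a half-turn, so that a counterclockwise walk
goes to the right as well. A call leads from its first panel, on top of an arbitrary column, to its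
last panel on top of some column (`Climbs`, `UnrollsCall`). Therefore the strip of a child can be
inserted into that of its parent as soon as the panels at the two ends of the suture fit together
(`Joined`).

Every gridface is taken once. Columns are numbered over two turns around the box, so that the
positions of start, turn, children and bites obey linear arithmetic. Two boxes of one slab are
separated by a missing cell, four gridfaces wide; this leaves room for the strip beside a child and
shows that the strip lies on the surface. The spirals and the second cycle take disjoint sets of
gridfaces (`nodup_ownFaces`) that contain all support faces (`support_mem_ownFaces`). A surface
gridface determines its box (`BoundaryFace.box_eq`), so calls for disjoint subtrees share none.
Induction on the depth of the recursion combines the three (`IsParent.unfolds`). -/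

theorem boxAt_eq_some_iff {i j : ℕ} {b : Box} :
    boxAt cells i j = some b ↔ IsBox cells b ∧ b.slab = j ∧ b.lo ≤ i ∧ i < b.hi := by
  have key : ∀ (h : (i, j) ∈ cells),
      IsBox cells ⟨j, Nat.find (runStart_exists cells i j), Nat.find (runEnd_exists cells i j)⟩ ∧
      Nat.find (runStart_exists cells i j) ≤ i ∧ i < Nat.find (runEnd_exists cells i j) := by
    intro h
    have hlo := Nat.find_spec (runStart_exists cells i j)
    have hlo' : ∀ k, k < Nat.find (runStart_exists cells i j) →
        ¬ ∀ q ∈ Finset.Icc k i, (q, j) ∈ cells := fun k => Nat.find_min _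
    have hhi := Nat.find_spec (runEnd_exists cells i j)
    have hhi' : ∀ k, k < Nat.find (runEnd_exists cells i j) → ¬ (i ≤ k ∧ (k, j) ∉ cells) :=
      fun k => Nat.find_min _
    have hle : Nat.find (runStart_exists cells i j) ≤ i :=
      Nat.find_min' _ fun q hq => by
        have := Finset.mem_Icc.1 hq
        obtain rfl : q = i := by omega
        exact h
    generalize Nat.find (runStart_exists cells i j) = lo at *
    generalize Nat.find (runEnd_exists cells i j) = hi at *
    have hlt : i < hi := by
      rcases Nat.lt_or_ge i hi with h1 | h1
      · exact h1
      · obtain rfl : i = hi := by omega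
        exact absurd h hhi.2
    refine ⟨⟨by simp only; omega, fun q h1 h2 => ?_, hhi.2, fun q hq hc => ?_⟩, hle, hlt⟩
    · rcases le_total q i with h3 | h3
      · exact hlo q (Finset.mem_Icc.2 ⟨h1, h3⟩)
      · by_contra hc
        exact hhi' q h2 ⟨h3, hc⟩
    · simp only at hq hc
      -- A cell just before `lo` would lengthen the run, against the minimality of `lo`.
      refine hlo' q (by omega) fun q' hq' => ?_
      rw [Finset.mem_Icc] at hq'
      rcases Nat.eq_or_lt_of_le hq'.1 with h3 | h3
      · rwa [← h3]
      · exact hlo q' (Finset.mem_Icc.2 ⟨by omega, hq'.2⟩)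
  constructor
  · intro h
    unfold boxAt at h
    split_ifs at h with hc
    obtain rfl := Option.some.inj h
    exact ⟨(key hc).1, rfl, (key hc).2⟩
  · rintro ⟨hb, rfl, h1, h2⟩
    have hc := hb.2.1 i h1 h2
    unfold boxAt
    rw [if_pos hc]
    obtain ⟨hk, h3, h4⟩ := key hc
    generalize Nat.find (runStart_exists cells i b.slab) = lo at *
    generalize Nat.find (runEnd_exists cells i b.slab) = hi at *
    -- Two maximal runs through one cell have the same ends: where the shorter one stops there is a
    -- missing cell, which the longer one would contain.
    have e1 : hi = b.hi := by
      rcases Nat.lt_trichotomy hi b.hi with h | h | h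
      · exact absurd (hb.2.1 hi (by omega) h) hk.2.2.1
      · exact h
      · exact absurd (hk.2.1 b.hi (by simp only; omega) h) hb.2.2.1
    have e2 : lo = b.lo := by
      rcases Nat.lt_trichotomy lo b.lo with h | h | h
      · exact absurd (hk.2.1 (b.lo - 1) (by simp only; omega) (by simp only; omega))
          (hb.2.2.2 (b.lo - 1) (by omega))
      · exact h
      · exact absurd (hb.2.1 (lo - 1) (by omega) (by omega))
          (hk.2.2.2 (lo - 1) (by simp only; omega))
    subst e1 e2
    rfl

theorem exists_box_of_mem {i j : ℕ} (h : (i, j) ∈ cells) : ∃ b, boxAt cells i j = some b := by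
  unfold boxAt
  rw [if_pos h]
  exact ⟨_, rfl⟩

theorem IsBox.eq_of_mem {a b : Box} (ha : IsBox cells a) (hb : IsBox cells b)
    (h : a.slab = b.slab) {i : ℕ} (h1 : a.lo ≤ i) (h2 : i < a.hi) (h3 : b.lo ≤ i)
    (h4 : i < b.hi) : a = b :=
  Option.some.inj ((boxAt_eq_some_iff.2 ⟨ha, h, h1, h2⟩).symm.trans
    (boxAt_eq_some_iff.2 ⟨hb, rfl, h3, h4⟩))

/-- Distinct boxes of the same slab are separated by a missing cell. -/
theorem IsBox.separated {a b : Box} (ha : IsBox cells a) (hb : IsBox cells b)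
    (h : a.slab = b.slab) : a = b ∨ a.hi < b.lo ∨ b.hi < a.lo := by
  by_contra hne
  push Not at hne
  have := ha.1
  have := hb.1
  have hj : ¬ max a.lo b.lo < min a.hi b.hi := fun hlt =>
    hne.1 (ha.eq_of_mem hb h (le_max_left _ _) (by omega) (le_max_right a.lo b.lo) (by omega))
  rcases Nat.lt_or_ge a.lo b.lo with h1 | h1
  · have e : a.hi = b.lo := by omega
    exact ha.2.2.1 (by rw [h, e]; exact hb.2.1 _ le_rfl hb.1)
  · have e : b.hi = a.lo := by omega
    exact hb.2.2.1 (by rw [← h, e]; exact ha.2.1 _ le_rfl ha.1)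

end boxes

/-! ### Simple connectedness: every adjacency is a bridge -/

/-- A small ball around `x` meets only those pieces that contain `x`, and within each of these
convex pieces a segment leads to `x`. -/
theorem locallyPathConnectedSpace_iUnion {E : Type*} [NormedAddCommGroup E] [NormedSpace ℝ E]
    {ι : Type*} [Finite ι] (K : ι → Set E) (hK : ∀ i, IsClosed (K i))
    (hc : ∀ i, Convex ℝ (K i)) : LocallyPathConnectedSpace (⋃ i, K i) := by
  refine LocallyPathConnectedSpace.of_bases
    (p := fun x ε => 0 < ε ∧ ∀ i, (x : E) ∉ K i → Disjoint (Metric.ball (x : E) ε) (K i))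
    (s := fun x ε => Metric.ball x ε) ?_ ?_
  · intro x
    refine Metric.nhds_basis_ball.to_hasBasis (fun ε hε => ?_) (fun ε hε => ⟨ε, hε.1, le_rfl⟩)
    have h1 : ∀ᶠ y in 𝓝 (x : E), ∀ i, (x : E) ∉ K i → y ∈ (K i)ᶜ := by
      refine Filter.eventually_all.2 fun i => ?_
      by_cases h : (x : E) ∈ K i
      · simp [h]
      · filter_upwards [(hK i).isOpen_compl.mem_nhds h] with y hy _ using hy
    obtain ⟨δ, hδ, hδ'⟩ := Metric.eventually_nhds_iff_ball.1 h1
    refine ⟨min ε δ, ⟨lt_min hε hδ, fun i hi => ?_⟩, Metric.ball_subset_ball (min_le_left _ _)⟩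
    refine Set.disjoint_left.2 fun y hy => hδ' y (Metric.ball_subset_ball (min_le_right _ _) hy) i hi
  · rintro x ε ⟨hε, hd⟩
    rw [Topology.IsInducing.subtypeVal.isPathConnected_iff]
    refine ⟨x, ⟨x, Metric.mem_ball_self hε, rfl⟩, ?_⟩
    rintro _ ⟨⟨y, hy⟩, hyε, rfl⟩
    obtain ⟨i, hi⟩ := mem_iUnion.1 hy
    have hyb : y ∈ Metric.ball (x : E) ε := hyε
    have hx : (x : E) ∈ K i := by
      by_contra h
      exact Set.disjoint_left.1 (hd i h) hyb hi
    refine JoinedIn.of_segment_subset fun z hz => ?_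
    exact ⟨⟨z, mem_iUnion.2 ⟨i, (hc i).segment_subset hx hi hz⟩⟩,
      (convex_ball (x : E) ε).segment_subset (Metric.mem_ball_self hε) hyb hz, rfl⟩

namespace SingleLayerMT

variable (P : SingleLayerMT)

/-- The closed rectangle of a grid cell. -/
def cellRect (c : ℕ × ℕ) : Set (ℝ × ℝ) :=
  Icc (P.xs c.1) (P.xs (c.1 + 1)) ×ˢ Icc (P.ys c.2) (P.ys (c.2 + 1))

/-- The closed rectangle that is the base of a box. -/
def boxRect (b : Box) : Set (ℝ × ℝ) :=
  Icc (P.xs b.lo) (P.xs b.hi) ×ˢ Icc (P.ys b.slab) (P.ys (b.slab + 1))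

theorem region_eq : region P.xs P.ys P.cells = ⋃ c ∈ P.cells, P.cellRect c := rfl

theorem isClosed_cellRect (c : ℕ × ℕ) : IsClosed (P.cellRect c) := isClosed_Icc.prod isClosed_Icc

theorem isClosed_boxRect (b : Box) : IsClosed (P.boxRect b) := isClosed_Icc.prod isClosed_Icc

theorem cellRect_subset_boxRect {b : Box} {i : ℕ} (h1 : b.lo ≤ i) (h2 : i < b.hi) :
    P.cellRect (i, b.slab) ⊆ P.boxRect b :=
  prod_mono (Icc_subset_Icc (P.xs_strictMono.monotone h1) (P.xs_strictMono.monotone h2)) le_rfl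

theorem exists_between {f : ℕ → ℝ} {lo hi : ℕ} (h : lo < hi) {x : ℝ} (hx : x ∈ Icc (f lo) (f hi)) :
    ∃ i, lo ≤ i ∧ i < hi ∧ x ∈ Icc (f i) (f (i + 1)) := by
  induction hi, h using Nat.le_induction with
  | base => exact ⟨lo, le_rfl, Nat.lt_succ_self _, hx⟩
  | succ n hn ih =>
    rcases le_total x (f n) with h | h
    · obtain ⟨i, h1, h2, h3⟩ := ih ⟨hx.1, h⟩
      exact ⟨i, h1, by omega, h3⟩
    · exact ⟨n, by omega, Nat.lt_succ_self _, h, hx.2⟩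

theorem exists_cell_of_mem_boxRect {b : Box} (hb : b.lo < b.hi) {p : ℝ × ℝ}
    (hp : p ∈ P.boxRect b) : ∃ i, b.lo ≤ i ∧ i < b.hi ∧ p ∈ P.cellRect (i, b.slab) := by
  obtain ⟨i, h1, h2, h3⟩ := exists_between hb hp.1
  exact ⟨i, h1, h2, h3, hp.2⟩

theorem boxRect_subset_region {b : Box} (hb : IsBox P.cells b) :
    P.boxRect b ⊆ region P.xs P.ys P.cells := fun p hp => by
  obtain ⟨i, h1, h2, h3⟩ := P.exists_cell_of_mem_boxRect hb.1 hp
  exact mem_biUnion (hb.2.1 i h1 h2) h3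

theorem exists_box_of_mem_region {p : ℝ × ℝ} (hp : p ∈ region P.xs P.ys P.cells) :
    ∃ b, IsBox P.cells b ∧ p ∈ P.boxRect b := by
  obtain ⟨c, hc, hpc⟩ := mem_iUnion₂.1 hp
  obtain ⟨b, hb⟩ := exists_box_of_mem (i := c.1) (j := c.2) hc
  obtain ⟨h1, h2, h3, h4⟩ := boxAt_eq_some_iff.1 hb
  refine ⟨b, h1, P.cellRect_subset_boxRect h3 h4 ?_⟩
  rw [h2]
  exact hpc

theorem slab_near {a b : Box} {p : ℝ × ℝ} (hpa : p ∈ P.boxRect a) (hpb : p ∈ P.boxRect b) :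
    a.slab ≤ b.slab + 1 := by
  have h1 := hpa.2.1
  have h2 := hpb.2.2
  exact P.ys_strictMono.le_iff_le.1 (h1.trans h2)

theorem hi_near {a b : Box} {p : ℝ × ℝ} (hpa : p ∈ P.boxRect a) (hpb : p ∈ P.boxRect b) :
    a.lo ≤ b.hi :=
  P.xs_strictMono.le_iff_le.1 (hpa.1.1.trans hpb.1.2)

/-- The missing cell between distinct boxes of a slab keeps even the closed rectangles apart. -/
theorem eq_of_mem_of_slab_eq {a b : Box} (ha : IsBox P.cells a) (hb : IsBox P.cells b)
    {p : ℝ × ℝ} (hpa : p ∈ P.boxRect a) (hpb : p ∈ P.boxRect b) (h : a.slab = b.slab) :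
    a = b := by
  rcases ha.separated hb h with h1 | h1 | h1
  · exact h1
  · have := P.hi_near hpb hpa
    omega
  · have := P.hi_near hpa hpb
    omega

/-- No three boxes have a point in common. -/
theorem not_three {a b c : Box} (ha : IsBox P.cells a) (hb : IsBox P.cells b)
    (hc : IsBox P.cells c) (hab : a ≠ b) (hac : a ≠ c) (hbc : b ≠ c) {p : ℝ × ℝ}
    (hpa : p ∈ P.boxRect a) (hpb : p ∈ P.boxRect b) (hpc : p ∈ P.boxRect c) : False := by
  -- Boxes with a common point have slab numbers that differ by at most one, and three distinct
  -- numbers cannot do so pairwise.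
  have h1 : a.slab ≠ b.slab := fun h => hab (P.eq_of_mem_of_slab_eq ha hb hpa hpb h)
  have h2 : a.slab ≠ c.slab := fun h => hac (P.eq_of_mem_of_slab_eq ha hc hpa hpc h)
  have h3 : b.slab ≠ c.slab := fun h => hbc (P.eq_of_mem_of_slab_eq hb hc hpb hpc h)
  have := P.slab_near hpa hpb
  have := P.slab_near hpb hpa
  have := P.slab_near hpa hpc
  have := P.slab_near hpc hpa
  have := P.slab_near hpb hpc
  have := P.slab_near hpc hpb
  omega

/-- Required for lifting along the covering of the circle by the line in `exists_labelling`. -/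
instance : LocallyPathConnectedSpace (region P.xs P.ys P.cells) := by
  have h := locallyPathConnectedSpace_iUnion (fun c : P.cells => P.cellRect c)
    (fun c => P.isClosed_cellRect c) (fun c => (convex_Icc _ _).prod (convex_Icc _ _))
  have e : (⋃ c : P.cells, P.cellRect c) = region P.xs P.ys P.cells := by
    rw [region_eq, iUnion_subtype]
  rw [e] at h
  exact h

theorem exists_common_point {a b : Box} (h : BoxAdj a b) :
    ∃ p, p ∈ P.boxRect a ∧ p ∈ P.boxRect b := by
  have hm := h.2
  -- The left end of the shared part of the face, on the line where the later of the two slabs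
  -- begins.
  refine ⟨(P.xs (max a.lo b.lo), P.ys (max a.slab b.slab)), ⟨⟨?_, ?_⟩, ?_, ?_⟩, ⟨?_, ?_⟩, ?_, ?_⟩ <;>
    first
    | exact P.xs_strictMono.monotone (by omega)
    | (have := h.1; exact P.ys_strictMono.monotone (by omega))

instance : Fact ((0 : ℝ) < 1) := ⟨one_pos⟩

/-- Cutting the region between two adjacent boxes disconnects it: there is a labelling of the
boxes that changes there but at no other adjacency. -/
theorem exists_labelling {a x : Box} (ha : IsBox P.cells a) (hx : IsBox P.cells x)
    (hax : BoxAdj a x) :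
    ∃ n : Box → ℝ, n a ≠ n x ∧ ∀ u v, (dualGraph P.cells).Adj u v →
      (u = a ∧ v = x ∨ u = x ∧ v = a) ∨ n u = n v := by
  classical
  have hne : a ≠ x := by
    rintro rfl
    have := hax.1
    omega
  -- `Z` is the part of `x` shared with boxes other than `a`. Since no three boxes have a common
  -- point, it is disjoint from the closed box `a`.
  set Z : Set (ℝ × ℝ) := P.boxRect x ∩ ⋃ c ∈ P.cells.filter
    (fun c => ¬ (c.2 = a.slab ∧ a.lo ≤ c.1 ∧ c.1 < a.hi) ∧ ¬ (c.2 = x.slab ∧ x.lo ≤ c.1 ∧ c.1 < x.hi)),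
      P.cellRect c with hZ
  have hZc : IsClosed Z := (P.isClosed_boxRect x).inter
    (Finset.finite_toSet _ |>.isClosed_biUnion fun c _ => P.isClosed_cellRect c)
  have hZb : ∀ b, IsBox P.cells b → b ≠ a → b ≠ x → P.boxRect x ∩ P.boxRect b ⊆ Z := by
    intro b hb hba hbx p hp
    obtain ⟨i, h1, h2, h3⟩ := P.exists_cell_of_mem_boxRect hb.1 hp.2
    refine ⟨hp.1, mem_biUnion (x := (i, b.slab)) ?_ h3⟩
    simp only [Finset.coe_filter, mem_ofPred_eq]
    exact ⟨hb.2.1 i h1 h2, fun h => hba (hb.eq_of_mem ha h.1 h1 h2 h.2.1 h.2.2),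
      fun h => hbx (hb.eq_of_mem hx h.1 h1 h2 h.2.1 h.2.2)⟩
  have hd : Disjoint Z (P.boxRect a) := by
    rw [Set.disjoint_left]
    rintro p ⟨hpx, hp⟩ hpa
    obtain ⟨c, hc, hpc⟩ := mem_iUnion₂.1 hp
    rw [Finset.mem_filter] at hc
    obtain ⟨b, hb⟩ := exists_box_of_mem (i := c.1) (j := c.2) hc.1
    obtain ⟨h1, h2, h3, h4⟩ := boxAt_eq_some_iff.1 hb
    have hpb : p ∈ P.boxRect b := P.cellRect_subset_boxRect h3 h4 (by rw [h2]; exact hpc)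
    refine P.not_three ha hx h1 hne ?_ ?_ hpa hpx hpb
    · rintro rfl
      exact hc.2.1 ⟨h2.symm, h3, h4⟩
    · rintro rfl
      exact hc.2.2 ⟨h2.symm, h3, h4⟩
  -- `u` is 0 on `Z` and 1 on `a`. The function that equals `u` on `x` and 0 elsewhere jumps only
  -- between `x` and `a`, and there by 1, so it is continuous modulo 1.
  obtain ⟨u, hu0, hu1, -⟩ := exists_continuous_zero_one_of_isClosed hZc (P.isClosed_boxRect a) hd
  let g : ℝ × ℝ → ℝ := fun p => if p ∈ P.boxRect x then u p else 0
  let f : region P.xs P.ys P.cells → AddCircle (1 : ℝ) := fun p => (g p : AddCircle (1 : ℝ))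
  -- A continuous real branch, on the box `b`, of the circle-valued function `f`.
  let gb : Box → ℝ × ℝ → ℝ := fun b p => if b = x then u p else 0
  have hgb : ∀ b, Continuous (gb b) := by
    intro b
    by_cases h : b = x
    · simp only [gb, if_pos h]
      exact u.continuous
    · simp only [gb, if_neg h]
      exact continuous_const
  have hfb : ∀ b, IsBox P.cells b → ∀ p ∈ P.boxRect b,
      ((g p : ℝ) : AddCircle (1 : ℝ)) = (gb b p : AddCircle (1 : ℝ)) := by
    intro b hb p hp
    by_cases hbx : b = x
    · subst hbx
      simp [g, gb, hp]
    · by_cases hpx : p ∈ P.boxRect x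
      · simp only [g, gb, if_pos hpx, if_neg hbx]
        by_cases hba : b = a
        · subst hba
          rw [hu1 hp]
          simp
        · rw [hu0 (hZb b hb hba hbx ⟨hpx, hp⟩)]
          simp
      · simp [g, gb, hpx, hbx]
  have hfc : Continuous f := by
    refine (locallyFinite_of_finite fun c : P.cells =>
      ((↑) : region P.xs P.ys P.cells → ℝ × ℝ) ⁻¹' P.cellRect c).continuous ?_
      (fun c => (P.isClosed_cellRect c).preimage continuous_subtype_val) ?_
    · refine eq_univ_of_forall fun p => ?_
      obtain ⟨c, hc, hpc⟩ := mem_iUnion₂.1 p.2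
      exact mem_iUnion.2 ⟨⟨c, hc⟩, hpc⟩
    · rintro ⟨c, hc⟩
      obtain ⟨b, hb⟩ := exists_box_of_mem (i := c.1) (j := c.2) hc
      obtain ⟨h1, h2, h3, h4⟩ := boxAt_eq_some_iff.1 hb
      have hcont : Continuous fun p : region P.xs P.ys P.cells =>
          ((gb b p : ℝ) : AddCircle (1 : ℝ)) :=
        (AddCircle.continuous_mk' 1).comp ((hgb b).comp continuous_subtype_val)
      refine hcont.continuousOn.congr fun p hp => hfb b h1 p ?_
      refine P.cellRect_subset_boxRect h3 h4 ?_
      rw [h2]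
      exact hp
  have := P.simplyConnected
  obtain ⟨p₀⟩ : Nonempty (region P.xs P.ys P.cells) := inferInstance
  -- Here simple connectedness is used: `f` lifts to a continuous real function `F`.
  obtain ⟨F, ⟨-, hF⟩, -⟩ := (AddCircle.isCoveringMap_coe (1 : ℝ)).existsUnique_continuousMap_lifts
    ⟨f, hfc⟩ p₀ (g p₀) rfl
  -- On a box, `F` differs from the branch by an integer, which is constant because the box is
  -- connected. These integers are the labels.
  have hconst : ∀ b, ∃ n : ℝ, ∀ (hb : IsBox P.cells b) p (hp : p ∈ P.boxRect b),
      F ⟨p, P.boxRect_subset_region hb hp⟩ - gb b p = n := by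
    intro b
    by_cases hb : IsBox P.cells b
    swap
    · exact ⟨0, fun h => absurd h hb⟩
    have hpc : IsPreconnected (P.boxRect b) :=
      ((convex_Icc _ _).prod (convex_Icc _ _)).isPreconnected
    have : PreconnectedSpace (P.boxRect b) := Subtype.preconnectedSpace hpc
    let k : P.boxRect b → ℝ := fun p => F ⟨p, P.boxRect_subset_region hb p.2⟩ - gb b p
    have hk : Continuous k :=
      (F.continuous.comp (by fun_prop)).sub ((hgb b).comp continuous_subtype_val)
    have hkz : ∀ p, k p ∈ Set.range ((↑) : ℤ → ℝ) := by
      intro p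
      have h1 : ((k p : ℝ) : AddCircle (1 : ℝ)) = 0 := by
        have h2 := congrFun hF ⟨p, P.boxRect_subset_region hb p.2⟩
        have h3 : ((F ⟨p, P.boxRect_subset_region hb p.2⟩ : ℝ) : AddCircle (1 : ℝ))
            = (gb b p : AddCircle (1 : ℝ)) := h2.trans (hfb b hb p p.2)
        simp only [k]
        rw [AddCircle.coe_sub, h3, sub_self]
      obtain ⟨m, hm⟩ := (AddCircle.coe_eq_zero_iff (1 : ℝ)).1 h1
      exact ⟨m, by rw [← hm]; simp⟩
    have hconst : ∀ p q, k p = k q := by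
      intro p q
      have h1 : (Set.range k).Subsingleton := by
        have h2 : IsPreconnected (Set.range k) := isPreconnected_range hk
        exact 
          (Set.countable_range ((↑) : ℤ → ℝ)).isTotallyDisconnected _ (by rintro _ ⟨p, rfl⟩; exact hkz p) h2
      exact h1 ⟨p, rfl⟩ ⟨q, rfl⟩
    obtain ⟨q⟩ : Nonempty (P.boxRect b) := ⟨⟨(P.xs b.lo, P.ys b.slab),
      ⟨le_rfl, P.xs_strictMono.monotone hb.1.le⟩, le_rfl, P.ys_strictMono.monotone (Nat.le_succ _)⟩⟩
    exact ⟨k q, fun _ p hp => hconst ⟨p, hp⟩ q⟩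
  choose n hn using hconst
  -- At a common point of `a` and `x`, the branches have the values 0 and 1.
  have hax0 : n a = n x + 1 := by
    obtain ⟨p, hpa, hpx⟩ := P.exists_common_point hax
    have h1 := hn a ha p hpa
    have h2 := hn x hx p hpx
    simp only [gb, if_neg hne, if_true] at h1 h2
    have h3 : u p = 1 := hu1 hpa
    linarith
  -- At any other adjacency the two branches agree at a common point, by the choice of `Z` if one of
  -- the boxes is `x`, and so do the labels.
  refine ⟨n, by rw [hax0]; simp, fun v w hvw => ?_⟩
  obtain ⟨hv, hw, hvw⟩ := hvw
  obtain ⟨p, hpv, hpw⟩ := P.exists_common_point hvw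
  have hvw' : v ≠ w := by
    rintro rfl
    have := hvw.1
    omega
  have h1 := hn v hv p hpv
  have h2 := hn w hw p hpw
  by_cases hvx : v = x
  · by_cases hwa : w = a
    · exact Or.inl (Or.inr ⟨hvx, hwa⟩)
    · right
      have h3 : u p = 0 := hu0 (hZb w hw hwa (fun h => hvw' (hvx.trans h.symm)) ⟨hvx ▸ hpv, hpw⟩)
      have hwx : w ≠ x := fun h => hvw' (hvx.trans h.symm)
      simp only [gb, if_pos hvx, if_neg hwx] at h1 h2
      linarith
  · by_cases hwx : w = x
    · by_cases hva : v = a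
      · exact Or.inl (Or.inl ⟨hva, hwx⟩)
      · right
        have h3 : u p = 0 := hu0 (hZb v hv hva hvx ⟨hwx ▸ hpw, hpv⟩)
        simp only [gb, if_pos hwx, if_neg hvx] at h1 h2
        linarith
    · right
      simp only [gb, if_neg hwx, if_neg hvx] at h1 h2
      linarith

end SingleLayerMT
end ManhattanTower

/-! ### The interior of the region; connectedness and subtrees of the dual graph -/

namespace ManhattanTower

open Set Topology

namespace SingleLayerMT

variable (P : SingleLayerMT)

/-- The interior is open, hence it avoids the closure of every set that the region avoids. This will
be applied to open missing cells and open half-planes. -/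
theorem notMem_interior_of_mem_closure {U : Set (ℝ × ℝ)}
    (h : Disjoint U (region P.xs P.ys P.cells)) {p : ℝ × ℝ} (hp : p ∈ closure U) :
    p ∉ interior (region P.xs P.ys P.cells) := fun hi =>
  Set.disjoint_left.1 ((h.mono_right interior_subset).closure_left isOpen_interior) hp hi

theorem index_eq {f : ℕ → ℝ} (hf : StrictMono f) {i j : ℕ} {x : ℝ} (h1 : x ∈ Ioo (f i) (f (i + 1)))
    (h2 : x ∈ Icc (f j) (f (j + 1))) : i = j := by
  have := hf.lt_iff_lt.1 (h1.1.trans_le h2.2)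
  have := hf.lt_iff_lt.1 (h2.1.trans_lt h1.2)
  omega

theorem notMem_interior_of_missing {i j : ℕ} (h : (i, j) ∉ P.cells) {p : ℝ × ℝ}
    (hp : p ∈ P.cellRect (i, j)) : p ∉ interior (region P.xs P.ys P.cells) := by
  refine P.notMem_interior_of_mem_closure
    (U := Ioo (P.xs i) (P.xs (i + 1)) ×ˢ Ioo (P.ys j) (P.ys (j + 1))) ?_ ?_
  · rw [Set.disjoint_left]
    rintro q hq hr
    obtain ⟨c, hc, hqc⟩ := mem_iUnion₂.1 hr
    have h1 := index_eq P.xs_strictMono hq.1 hqc.1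
    have h2 := index_eq P.ys_strictMono hq.2 hqc.2
    subst h1 h2
    exact h hc
  · rw [closure_prod_eq, closure_Ioo (P.xs_strictMono (Nat.lt_succ_self i)).ne,
      closure_Ioo (P.ys_strictMono (Nat.lt_succ_self j)).ne]
    exact hp

/-- Indices are natural numbers, so a box that begins at index 0 has no missing cell on its left;
the half-plane left of the grid takes its place. -/
theorem notMem_interior_of_fst_le {p : ℝ × ℝ} (hp : p.1 ≤ P.xs 0) :
    p ∉ interior (region P.xs P.ys P.cells) := by
  refine P.notMem_interior_of_mem_closure (U := Iio (P.xs 0) ×ˢ univ) ?_ ?_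
  · rw [Set.disjoint_left]
    rintro q hq hr
    obtain ⟨c, hc, hqc⟩ := mem_iUnion₂.1 hr
    exact absurd (hqc.1.1.trans_lt hq.1) (P.xs_strictMono.monotone (Nat.zero_le _)).not_gt
  · rw [closure_prod_eq, closure_Iio]
    exact ⟨hp, by simp⟩

theorem notMem_interior_of_snd_le {p : ℝ × ℝ} (hp : p.2 ≤ P.ys 0) :
    p ∉ interior (region P.xs P.ys P.cells) := by
  refine P.notMem_interior_of_mem_closure (U := univ ×ˢ Iio (P.ys 0)) ?_ ?_
  · rw [Set.disjoint_left]
    rintro q hq hr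
    obtain ⟨c, hc, hqc⟩ := mem_iUnion₂.1 hr
    exact absurd (hqc.2.1.trans_lt hq.2) (P.ys_strictMono.monotone (Nat.zero_le _)).not_gt
  · rw [closure_prod_eq, closure_Iio]
    exact ⟨by simp, hp⟩

/-- The interior contains no point that two boxes share unless they are adjacent. -/
theorem adj_of_mem_interior {a b : Box} (ha : IsBox P.cells a) (hb : IsBox P.cells b) (hab : a ≠ b)
    {p : ℝ × ℝ} (hpa : p ∈ P.boxRect a) (hpb : p ∈ P.boxRect b)
    (hp : p ∈ interior (region P.xs P.ys P.cells)) : BoxAdj a b := by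
  have hs : a.slab ≠ b.slab := fun h => hab (P.eq_of_mem_of_slab_eq ha hb hpa hpb h)
  have h1 := P.slab_near hpa hpb
  have h2 := P.slab_near hpb hpa
  refine ⟨by omega, ?_⟩
  by_contra hlt
  have h3 := P.hi_near hpa hpb
  have h4 := P.hi_near hpb hpa
  have hla := ha.1
  have hlb := hb.1
  have hcases : a.hi = b.lo ∨ b.hi = a.lo := by omega
  -- Boxes that touch only at a corner: the point also lies in the closed missing cell just after
  -- the right end of the left box.
  have corner : ∀ {a b : Box}, IsBox P.cells a → p ∈ P.boxRect a → p ∈ P.boxRect b →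
      a.hi = b.lo → False := by
    intro a b ha hpa hpb h
    refine P.notMem_interior_of_missing ha.2.2.1 (p := p) ⟨⟨?_, ?_⟩, hpa.2⟩ hp
    · exact h ▸ hpb.1.1
    · exact hpa.1.2.trans (P.xs_strictMono (Nat.lt_succ_self _)).le
  rcases hcases with h | h
  · exact corner ha hpa hpb h
  · exact corner hb hpb hpa h

/-- A box is determined by its first cell. -/
theorem finite_boxes : {b | IsBox P.cells b}.Finite := by
  refine Set.Finite.of_finite_image (f := fun b : Box => (b.lo, b.slab)) ?_ ?_
  · refine P.cells.finite_toSet.subset ?_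
    rintro _ ⟨b, hb, rfl⟩
    exact hb.2.1 _ le_rfl hb.1
  · intro a ha b hb h
    simp only [Prod.mk.injEq] at h
    exact ha.eq_of_mem hb h.2 le_rfl ha.1 h.1.ge (h.1 ▸ hb.1)

/-- The closed union of the boxes reachable from `a` and that of the others cover the connected
interior. If both meet it, then they have a common point in it, and the two boxes at this point are
adjacent. -/
theorem reachable {a b : Box} (ha : IsBox P.cells a) (hb : IsBox P.cells b) :
    (dualGraph P.cells).Reachable a b := by
  by_contra hab
  have hclosed : ∀ Q : Box → Prop, IsClosed (⋃ x ∈ {x | IsBox P.cells x ∧ Q x}, P.boxRect x) :=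
    fun Q => (P.finite_boxes.subset fun x hx => hx.1).isClosed_biUnion
      fun x _ => P.isClosed_boxRect x
  have hint : ∀ {x}, IsBox P.cells x →
      ∃ p ∈ interior (region P.xs P.ys P.cells), p ∈ P.boxRect x := by
    intro x hx
    obtain ⟨u, hu⟩ := _root_.exists_between (P.xs_strictMono hx.1)
    obtain ⟨v, hv⟩ := _root_.exists_between (P.ys_strictMono (Nat.lt_succ_self x.slab))
    have hm : (u, v) ∈ interior (P.boxRect x) := by
      unfold boxRect
      rw [interior_prod_eq, interior_Icc, interior_Icc]
      exact ⟨hu, hv⟩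
    exact ⟨(u, v), interior_mono (P.boxRect_subset_region hx) hm, interior_subset hm⟩
  obtain ⟨pa, hpa, hpa'⟩ := hint ha
  obtain ⟨pb, hpb, hpb'⟩ := hint hb
  obtain ⟨p, hp, hpU, hpV⟩ := isPreconnected_closed_iff.1 P.isConnected_interior.isPreconnected
    _ _ (hclosed fun x => (dualGraph P.cells).Reachable a x)
    (hclosed fun x => ¬ (dualGraph P.cells).Reachable a x) (fun p hp => by
      obtain ⟨x, hx, hpx⟩ := P.exists_box_of_mem_region (interior_subset hp)
      by_cases h : (dualGraph P.cells).Reachable a x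
      · exact Or.inl (mem_biUnion ⟨hx, h⟩ hpx)
      · exact Or.inr (mem_biUnion ⟨hx, h⟩ hpx))
    ⟨pa, hpa, mem_biUnion ⟨ha, SimpleGraph.Reachable.refl _⟩ hpa'⟩
    ⟨pb, hpb, mem_biUnion ⟨hb, hab⟩ hpb'⟩
  obtain ⟨x, ⟨hx, hrx⟩, hpx⟩ := mem_iUnion₂.1 hpU
  obtain ⟨y, ⟨hy, hry⟩, hpy⟩ := mem_iUnion₂.1 hpV
  have hxy : x ≠ y := by
    rintro rfl
    exact hry hrx
  exact hry (hrx.trans (SimpleGraph.Adj.reachable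
    ⟨hx, hy, P.adj_of_mem_interior hx hy hxy hpx hpy hp⟩))

end SingleLayerMT

/-! ### Subtrees of the recursion tree -/

/-- There is a walk from `u` to `v` that avoids `a`. -/
def Avoids (cells : Finset (ℕ × ℕ)) (a u v : Box) : Prop :=
  ∃ w : (dualGraph cells).Walk u v, a ∉ w.support

namespace Avoids

variable {cells : Finset (ℕ × ℕ)} {a u v w : Box}

theorem refl (h : a ≠ u) : Avoids cells a u u := ⟨.nil, by simpa using h⟩

theorem symm (h : Avoids cells a u v) : Avoids cells a v u := by
  obtain ⟨p, hp⟩ := h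
  exact ⟨p.reverse, by simpa using hp⟩

theorem trans (h : Avoids cells a u v) (h' : Avoids cells a v w) : Avoids cells a u w := by
  obtain ⟨p, hp⟩ := h
  obtain ⟨q, hq⟩ := h'
  exact ⟨p.append q, by rw [SimpleGraph.Walk.mem_support_append_iff]; tauto⟩

theorem of_adj (h : (dualGraph cells).Adj u v) (hu : a ≠ u) (hv : a ≠ v) : Avoids cells a u v :=
  ⟨.cons h .nil, by simp [hu, hv]⟩

theorem ne_right (h : Avoids cells a u v) : v ≠ a := by
  obtain ⟨p, hp⟩ := h
  rintro rfl
  exact hp p.end_mem_support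

end Avoids

namespace SingleLayerMT

variable (P : SingleLayerMT)

/-- The labelling for the adjacency of `a` and `x` is constant along walks off `a`, and `y` has the
label of `a`, which is not that of `x`. So removing `a` separates its neighbours: the only property
of trees that is used. -/
theorem not_avoids_of_adj {a x y : Box} (hx : (dualGraph P.cells).Adj a x)
    (hy : (dualGraph P.cells).Adj a y) (hxy : x ≠ y) : ¬ Avoids P.cells a x y := by
  rintro ⟨p, hp⟩
  obtain ⟨n, hn, hn'⟩ := P.exists_labelling hx.1 hx.2.1 hx.2.2
  have key : ∀ {u v} (p : (dualGraph P.cells).Walk u v), a ∉ p.support → n u = n v := by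
    intro u v p
    induction p with
    | nil => simp
    | @cons u v w h p ih =>
      intro hp
      rw [SimpleGraph.Walk.support_cons, List.mem_cons, not_or] at hp
      rw [← ih hp.2]
      rcases hn' u v h with (h1 | h1) | h1
      · exact absurd h1.1.symm hp.1
      · exact absurd (h1.2 ▸ p.start_mem_support) hp.2
      · exact h1
  have h1 := key p hp
  rcases hn' a y hy with (h2 | h2) | h2
  · exact hxy h2.2.symm
  · exact hx.ne h2.1
  · exact hn (h2.trans h1.symm)

/-- A path from `a` to `b` does not return to `a` after its first step. -/
theorem exists_adj_avoids {a b : Box} (ha : IsBox P.cells a) (hb : IsBox P.cells b) (hab : b ≠ a) :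
    ∃ z, (dualGraph P.cells).Adj a z ∧ Avoids P.cells a z b := by
  classical
  obtain ⟨p, hp⟩ := (P.reachable ha hb).exists_isPath
  cases p with
  | nil => exact absurd rfl hab
  | cons h p => exact ⟨_, h, p, ((SimpleGraph.Walk.cons_isPath_iff h p).1 hp).2⟩

theorem mem_subtree_iff {r a b : Box} :
    b ∈ subtree P.cells r a ↔ IsBox P.cells b ∧ ¬ Avoids P.cells a r b := by
  simp [subtree, Avoids]

/-- `p` is the parent of `a` in the recursion tree with root `r`, or `a` is the root. -/
def IsParent (r a : Box) : Option Box → Prop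
  | none => a = r
  | some p => (dualGraph P.cells).Adj a p ∧ Avoids P.cells a r p

variable {P} {r a x : Box} {q : Option Box}

/-- A walk from the root to the parent of `a` off `a` cannot pass through `x`, another neighbour of
`a`; one more step leads to `a`. -/
theorem IsParent.child (hq : P.IsParent r a q) (hx : (dualGraph P.cells).Adj a x)
    (hxq : some x ≠ q) : P.IsParent r x (some a) := by
  refine ⟨hx.symm, ?_⟩
  cases q with
  | none =>
    obtain rfl : a = r := hq
    exact .refl hx.ne'
  | some p =>
    have hxp : x ≠ p := fun h => hxq (by rw [h])
    obtain ⟨w, hw⟩ := hq.2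
    by_cases hxw : x ∈ w.support
    · exact absurd ⟨w.dropUntil x hxw, fun h => hw (w.support_dropUntil_subset_support hxw h)⟩
        (P.not_avoids_of_adj hx hq.1 hxp)
    · exact Avoids.trans ⟨w, hxw⟩ (.of_adj hq.1.symm hxp hx.ne')

/-- Because removing `a` separates its neighbours, the subtree of a child is a component of what
remains. In this form it no longer refers to the root, and disjointness of the subtrees of different
children is immediate. -/
theorem IsParent.mem_subtree_child (hq : P.IsParent r a q) (hx : (dualGraph P.cells).Adj a x)
    (hxq : some x ≠ q) {b : Box} :
    b ∈ subtree P.cells r x ↔ IsBox P.cells b ∧ Avoids P.cells a x b := by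
  rw [mem_subtree_iff]
  refine and_congr_right fun hb => ?_
  have hra : Avoids P.cells x r a := (hq.child hx hxq).2
  constructor
  · intro h
    by_cases hba : b = a
    · subst hba
      exact absurd hra h
    obtain ⟨z, hz, w, hw⟩ := P.exists_adj_avoids hx.1 hb hba
    by_cases hzx : z = x
    · subst hzx
      exact ⟨w, hw⟩
    by_cases hxw : x ∈ w.support
    · exact absurd ⟨w.takeUntil x hxw, fun h => hw (w.support_takeUntil_subset_support hxw h)⟩
        (P.not_avoids_of_adj hz hx hzx)
    · exact absurd ((hra.trans (.of_adj hz hx.ne' (Ne.symm hzx))).trans ⟨w, hxw⟩) h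
  · intro h hrb
    have hab := hra.symm.trans hrb
    obtain ⟨w, hw⟩ := hab
    -- Shortened to a path, the walk from `a` to `b` off `x` starts with another neighbour of `a`
    -- and does not return, so it would connect that neighbour to `x` off `a`.
    have hwp : x ∉ w.bypass.support := fun h => hw (w.support_bypass_subset_support h)
    have hpath := w.bypass_isPath
    generalize w.bypass = w' at hwp hpath
    cases w' with
    | nil => exact h.ne_right rfl
    | @cons _ z _ hz p =>
      have hap := ((SimpleGraph.Walk.cons_isPath_iff hz p).1 hpath).2
      rw [SimpleGraph.Walk.support_cons, List.mem_cons, not_or] at hwp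
      have hzx : z ≠ x := by
        rintro rfl
        exact hwp.2 p.start_mem_support
      exact P.not_avoids_of_adj hz hx hzx (Avoids.trans ⟨p, hap⟩ h.symm)

theorem IsParent.mem_subtree (hq : P.IsParent r a q) (ha : IsBox P.cells a) {b : Box} :
    b ∈ subtree P.cells r a ↔
      b = a ∨ ∃ z, (dualGraph P.cells).Adj a z ∧ some z ≠ q ∧ b ∈ subtree P.cells r z := by
  have hself : a ∈ subtree P.cells r a :=
    P.mem_subtree_iff.2 ⟨ha, fun h => h.ne_right rfl⟩
  constructor
  · intro h
    refine or_iff_not_imp_left.2 fun hba => ?_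
    obtain ⟨hb, h⟩ := P.mem_subtree_iff.1 h
    obtain ⟨z, hz, hzb⟩ := P.exists_adj_avoids ha hb hba
    have hzq : some z ≠ q := by
      rintro rfl
      exact h (hq.2.trans hzb)
    exact ⟨z, hz, hzq, (hq.mem_subtree_child hz hzq).2 ⟨hb, hzb⟩⟩
  · rintro (rfl | ⟨z, hz, hzq, h⟩)
    · exact hself
    · obtain ⟨hb, h⟩ := (hq.mem_subtree_child hz hzq).1 h
      refine P.mem_subtree_iff.2 ⟨hb, fun hr => ?_⟩
      cases q with
      | none =>
        obtain rfl : a = r := hq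
        obtain ⟨w, hw⟩ := hr
        exact hw w.start_mem_support
      | some p =>
        exact P.not_avoids_of_adj hz hq.1 (fun e => hzq (by rw [e]))
          ((h.trans hr.symm).trans hq.2)

theorem IsParent.self_notMem_child (hq : P.IsParent r a q) (hx : (dualGraph P.cells).Adj a x)
    (hxq : some x ≠ q) : a ∉ subtree P.cells r x := fun h =>
  ((hq.mem_subtree_child hx hxq).1 h).2.ne_right rfl

theorem IsParent.disjoint_children (hq : P.IsParent r a q) {y : Box}
    (hx : (dualGraph P.cells).Adj a x) (hxq : some x ≠ q) (hy : (dualGraph P.cells).Adj a y)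
    (hyq : some y ≠ q) (hxy : x ≠ y) : Disjoint (subtree P.cells r x) (subtree P.cells r y) := by
  rw [Set.disjoint_left]
  intro b h1 h2
  exact P.not_avoids_of_adj hx hy hxy (((hq.mem_subtree_child hx hxq).1 h1).2.trans
    ((hq.mem_subtree_child hy hyq).1 h2).2.symm)

/-- Distinct boxes have distinct first cells. This justifies the recursion depth in `UNFOLD`. -/
theorem ncard_boxes_le : {b | IsBox P.cells b}.ncard ≤ P.cells.card := by
  rw [← Set.ncard_coe_finset]
  refine Set.ncard_le_ncard_of_injOn (fun b : Box => (b.lo, b.slab)) ?_ ?_ P.cells.finite_toSet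
  · intro b hb
    exact hb.2.1 _ le_rfl hb.1
  · intro a ha b hb h
    simp only [Prod.mk.injEq] at h
    exact ha.eq_of_mem hb h.2 le_rfl ha.1 h.1.ge (h.1 ▸ hb.1)

theorem finite_subtree : (subtree P.cells r a).Finite :=
  P.finite_boxes.subset fun _ hb => hb.1

/-- The size of the subtree is the measure that bounds the recursion depth. -/
theorem IsParent.ncard_child_lt (hq : P.IsParent r a q) (hx : (dualGraph P.cells).Adj a x)
    (hxq : some x ≠ q) : (subtree P.cells r x).ncard < (subtree P.cells r a).ncard := by
  refine Set.ncard_lt_ncard ⟨fun b hb => ?_, fun h => ?_⟩ finite_subtree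
  · exact (hq.mem_subtree hx.1).2 (Or.inr ⟨x, hx, hxq, hb⟩)
  · exact hq.self_notMem_child hx hxq (h ((hq.mem_subtree hx.1).2 (Or.inl rfl)))

end SingleLayerMT
end ManhattanTower

namespace ManhattanTower

open Set Matrix

/-! ### Panels: gridfaces with a direction that is placed upwards -/

/-- A vertex of the refined grid: the indices of its planes orthogonal to `x` and `y`, and whether
it lies on the top. -/
abbrev Vertex := ℕ × ℕ × Bool

/-- A gridface together with the sign of the axis direction that is placed upwards in the plane:
this is the `y`-axis for horizontal and lateral gridfaces, and the `z`-axis for vertical ones. -/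
abbrev Panel := GridFace × Bool

/-- The number `1` or `-1`. -/
def sign (a : Bool) : ℝ := if a then 1 else -1

namespace GridFace

/-- The corner of a panel on the right (left) at its upper (lower) end. -/
def corner : GridFace → Bool → Bool → Bool → Vertex
  | .horizontal top k l, τ, a, b =>
      (if a == (top == τ) then k + 1 else k, if b == τ then l + 1 else l, top)
  | .lateral right k l, τ, a, b => (k, if b == τ then l + 1 else l, a == (τ != right))
  | .vertical back k l, τ, a, b => (if a == (τ != back) then k + 1 else k, l, b == τ)

theorem corner_not (f : GridFace) (τ a b : Bool) : f.corner (!τ) a b = f.corner τ (!a) (!b) := by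
  cases f with
  | horizontal top k l => cases τ <;> cases a <;> cases b <;> cases top <;> rfl
  | lateral r k l => cases τ <;> cases a <;> cases b <;> cases r <;> rfl
  | vertical r k l => cases τ <;> cases a <;> cases b <;> cases r <;> rfl

end GridFace

namespace Panel

/-- The direction placed upwards. -/
def up : Panel → Fin 3 → ℝ
  | (.horizontal _ _ _, τ) => ![0, sign τ, 0]
  | (.lateral _ _ _, τ) => ![0, sign τ, 0]
  | (.vertical _ _ _, τ) => ![0, 0, sign τ]

/-- The direction placed to the right. -/
def right : Panel → Fin 3 → ℝ
  | (.horizontal top _ _, τ) => ![sign (top == τ), 0, 0]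
  | (.lateral r _ _, τ) => ![0, 0, sign (τ != r)]
  | (.vertical b _ _, τ) => ![sign (τ != b), 0, 0]

/-- The corners of a panel. -/
def corner (g : Panel) (a b : Bool) : Vertex := g.1.corner g.2 a b

end Panel

/-- The panel `f` continues the panel `g` across its upper edge. -/
structure UpAdj (g f : Panel) : Prop where
  left : g.corner false true = f.corner false false
  right : g.corner true true = f.corner true false
  noFold : 0 ≤ g.up ⬝ᵥ f.up

/-- The panel `f` continues the panel `g` across its right edge. -/
structure RightAdj (g f : Panel) : Prop where
  lower : g.corner true false = f.corner false false
  upper : g.corner true true = f.corner false true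
  noFold : 0 ≤ g.right ⬝ᵥ f.right

namespace SingleLayerMT

variable (P : SingleLayerMT)

/-- The point of space at a vertex. -/
noncomputable def point (v : Vertex) : Fin 3 → ℝ :=
  ![P.X v.1, P.Y v.2.1, if v.2.2 then P.height else 0]

/-- The width of a gridface in the plane. -/
noncomputable def faceWidth : GridFace → ℝ
  | .horizontal _ k _ => P.X (k + 1) - P.X k
  | .lateral _ _ _ => P.height
  | .vertical _ k _ => P.X (k + 1) - P.X k

/-- The height of a gridface in the plane. -/
noncomputable def faceHeight : GridFace → ℝ
  | .horizontal _ _ l => P.Y (l + 1) - P.Y l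
  | .lateral _ _ l => P.Y (l + 1) - P.Y l
  | .vertical _ _ _ => P.height

/-- Including `r = n`, where the index already belongs to the next grid interval, makes one formula
valid at both ends of every refined interval. -/
theorem refine_mul_add {n : ℕ} (hn : 0 < n) (f : ℕ → ℝ) (q : ℕ) {r : ℕ} (hr : r ≤ n) :
    refine n f (n * q + r) = f q + (r : ℝ) / n * (f (q + 1) - f q) := by
  have hn' : (n : ℝ) ≠ 0 := by exact_mod_cast hn.ne'
  unfold refine
  rcases hr.lt_or_eq with h | rfl
  · rw [Nat.mul_add_div hn, Nat.div_eq_of_lt h, Nat.mul_add_mod, Nat.mod_eq_of_lt h, add_zero]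
  · rw [← Nat.mul_succ, Nat.mul_div_cancel_left _ hn, Nat.mul_mod_right, div_self hn']
    simp

theorem refine_lt {n : ℕ} (hn : 0 < n) {f : ℕ → ℝ} (hf : StrictMono f) (k : ℕ) :
    refine n f k < refine n f (k + 1) := by
  have hn' : (0 : ℝ) < n := by exact_mod_cast hn
  have hk := Nat.div_add_mod k n
  have hr := Nat.mod_lt k hn
  rw [← hk, add_assoc, refine_mul_add hn f _ hr.le, refine_mul_add hn f _ hr]
  have := hf (Nat.lt_succ_self (k / n))
  push_cast
  have h2 : ((k % n : ℕ) : ℝ) / n < ((k % n : ℕ) + 1 : ℝ) / n := by gcongr; linarith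
  have h3 := sub_pos.2 this
  simp only [Nat.succ_eq_add_one] at h3
  nlinarith

theorem refine_mul {n : ℕ} (hn : 0 < n) (f : ℕ → ℝ) (q : ℕ) : refine n f (n * q) = f q := by
  have := refine_mul_add hn f q (Nat.zero_le n)
  simpa using this

theorem X_mul (i : ℕ) : P.X (4 * i) = P.xs i := refine_mul (by norm_num) _ _

theorem Y_mul (i : ℕ) : P.Y (5 * i) = P.ys i := refine_mul (by norm_num) _ _

theorem X_lt (k : ℕ) : P.X k < P.X (k + 1) := refine_lt (by norm_num) P.xs_strictMono k

theorem Y_lt (k : ℕ) : P.Y k < P.Y (k + 1) := refine_lt (by norm_num) P.ys_strictMono k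

theorem faceWidth_pos (f : GridFace) : 0 < P.faceWidth f := by
  cases f with
  | horizontal top k l => exact sub_pos.2 (P.X_lt k)
  | lateral r k l => exact P.height_pos
  | vertical b k l => exact sub_pos.2 (P.X_lt k)

theorem faceHeight_pos (f : GridFace) : 0 < P.faceHeight f := by
  cases f with
  | horizontal top k l => exact sub_pos.2 (P.Y_lt l)
  | lateral r k l => exact sub_pos.2 (P.Y_lt l)
  | vertical b k l => exact P.height_pos

/-- The lower left corner of a panel in space. -/
noncomputable def base (g : Panel) : Fin 3 → ℝ := P.point (g.corner false false)

end SingleLayerMT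

namespace Panel

theorem right_dot_right (g : Panel) : g.right ⬝ᵥ g.right = 1 := by
  obtain ⟨f | f | f, τ⟩ := g <;> simp only [right, sign] <;> split_ifs <;> simp

theorem up_dot_up (g : Panel) : g.up ⬝ᵥ g.up = 1 := by
  obtain ⟨f | f | f, τ⟩ := g <;> simp only [up, sign] <;> split_ifs <;> simp

theorem right_dot_up (g : Panel) : g.right ⬝ᵥ g.up = 0 := by
  obtain ⟨f | f | f, τ⟩ := g <;> simp [right, up]

theorem cross_eq_normal (g : Panel) : crossProduct g.right g.up = g.1.normal := by
  obtain ⟨⟨f, k, l⟩ | ⟨f, k, l⟩ | ⟨f, k, l⟩, τ⟩ := g <;> cases f <;> cases τ <;>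
    simp [right, up, sign, cross_apply, GridFace.normal]

end Panel

namespace SingleLayerMT

variable (P : SingleLayerMT)

theorem point_corner (g : Panel) (a b : Bool) : P.point (g.corner a b) =
    P.base g + (if a then P.faceWidth g.1 else 0) • g.right +
      (if b then P.faceHeight g.1 else 0) • g.up := by
  obtain ⟨⟨f, k, l⟩ | ⟨f, k, l⟩ | ⟨f, k, l⟩, τ⟩ := g <;> cases f <;> cases τ <;> cases a <;>
    cases b <;> ext i <;> fin_cases i <;>
    simp [base, point, Panel.corner, GridFace.corner, faceWidth, faceHeight, Panel.right,
      Panel.up, sign]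

/-- Here and in `point_corner` the kinds and orientations of gridfaces are checked case by case;
afterwards every panel is just a rectangle spanned by `right` and `up` at its base. -/
theorem mem_carrier_iff (g : Panel) (p : Fin 3 → ℝ) : p ∈ P.carrier g.1 ↔
    ∃ α β : ℝ, 0 ≤ α ∧ α ≤ P.faceWidth g.1 ∧ 0 ≤ β ∧ β ≤ P.faceHeight g.1 ∧
      p = P.base g + α • g.right + β • g.up := by
  constructor
  · intro h
    refine ⟨(p - P.base g) ⬝ᵥ g.right, (p - P.base g) ⬝ᵥ g.up, ?_⟩
    obtain ⟨⟨f, k, l⟩ | ⟨f, k, l⟩ | ⟨f, k, l⟩, τ⟩ := g <;> cases f <;> cases τ <;>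
      simp [carrier, Pi.le_def, Fin.forall_fin_succ] at h <;>
      simp [base, point, Panel.corner, GridFace.corner, faceWidth, faceHeight, Panel.right,
        Panel.up, sign, dotProduct, Fin.sum_univ_succ, funext_iff, Fin.forall_fin_succ] <;>
      refine ⟨?_, ?_, ?_, ?_, ?_⟩ <;> linarith
  · rintro ⟨α, β, h1, h2, h3, h4, rfl⟩
    obtain ⟨⟨f, k, l⟩ | ⟨f, k, l⟩ | ⟨f, k, l⟩, τ⟩ := g <;> cases f <;> cases τ <;>
      simp [faceWidth, faceHeight] at h2 h4 <;>
      simp [carrier, Pi.le_def, Fin.forall_fin_succ, base, point, Panel.corner, GridFace.corner,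
        Panel.right, Panel.up, sign] <;>
      refine ⟨⟨?_, ?_⟩, ?_, ?_⟩ <;> linarith

end SingleLayerMT
end ManhattanTower

/-! ### Placing panels in the plane, and adjacent panels -/

namespace ManhattanTower

open Set Matrix

namespace SingleLayerMT

variable (P : SingleLayerMT)

/-- The placement of a panel with lower left corner at `(x, y)`. -/
noncomputable def place (g : Panel) (x y : ℝ) : Placement :=
  ⟨g.right, g.up, (x - P.base g ⬝ᵥ g.right, y - P.base g ⬝ᵥ g.up)⟩

theorem laysFlat_place (g : Panel) (x y : ℝ) : (P.place g x y).LaysFlat g.1 :=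
  ⟨g.right_dot_right, g.up_dot_up, g.right_dot_up, g.cross_eq_normal⟩

theorem place_apply (g : Panel) (x y α β : ℝ) :
    (P.place g x y).apply (P.base g + α • g.right + β • g.up) = (x + α, y + β) := by
  have h := g.right_dot_up
  have h' : g.up ⬝ᵥ g.right = 0 := by rw [dotProduct_comm, h]
  simp [Placement.apply, place, add_dotProduct, smul_dotProduct, h, h', g.right_dot_right,
    g.up_dot_up]
  constructor <;> ring

theorem image_place (g : Panel) (x y : ℝ) : (P.place g x y).apply '' P.carrier g.1 =
    Icc x (x + P.faceWidth g.1) ×ˢ Icc y (y + P.faceHeight g.1) := by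
  ext ⟨u, v⟩
  constructor
  · rintro ⟨p, hp, h⟩
    obtain ⟨α, β, h1, h2, h3, h4, rfl⟩ := (P.mem_carrier_iff g p).1 hp
    rw [place_apply, Prod.mk.injEq] at h
    obtain ⟨rfl, rfl⟩ := h
    refine ⟨⟨?_, ?_⟩, ?_, ?_⟩ <;> simp only <;> linarith
  · rintro ⟨⟨h1, h2⟩, h3, h4⟩
    simp only at h1 h2 h3 h4
    refine ⟨P.base g + (u - x) • g.right + (v - y) • g.up, (P.mem_carrier_iff g _).2
      ⟨u - x, v - y, by linarith, by linarith, by linarith, by linarith, rfl⟩, ?_⟩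
    rw [place_apply]
    simp

theorem point_corner_mem (g : Panel) (a b : Bool) : P.point (g.corner a b) ∈ P.carrier g.1 := by
  have hw := (P.faceWidth_pos g.1).le
  have hh := (P.faceHeight_pos g.1).le
  refine (P.mem_carrier_iff g _).2 ⟨_, _, ?_, ?_, ?_, ?_, P.point_corner g a b⟩ <;>
    split_ifs <;> first | exact le_rfl | assumption

theorem convex_carrier (f : GridFace) : Convex ℝ (P.carrier f) := by
  cases f <;> exact convex_Icc _ _

end SingleLayerMT

namespace Panel

theorem eq_of_smul_eq {u v : Fin 3 → ℝ} {a b : ℝ} (ha : 0 < a) (hb : 0 < b) (hu : u ⬝ᵥ u = 1)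
    (hv : v ⬝ᵥ v = 1) (h : a • u = b • v) : a = b ∧ u = v := by
  have h1 : (a • u) ⬝ᵥ (a • u) = (b • v) ⬝ᵥ (b • v) := by rw [h]
  simp only [smul_dotProduct, dotProduct_smul, hu, hv, smul_eq_mul, mul_one] at h1
  obtain rfl : a = b := by nlinarith
  exact ⟨rfl, smul_right_injective _ ha.ne' h⟩

end Panel

section adjacency

variable (P : SingleLayerMT) {g f : Panel}

open SingleLayerMT

/-- The vector of the common edge determines both the width and the direction to the right. The
upward directions may differ, since the surface may bend at the edge. -/
theorem UpAdj.geometry (h : UpAdj g f) : P.faceWidth f.1 = P.faceWidth g.1 ∧ f.right = g.right ∧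
    P.base f = P.base g + P.faceHeight g.1 • g.up := by
  have h1 := P.point_corner g false true
  have h2 := P.point_corner g true true
  have h3 := P.point_corner f true false
  have hb : P.base f = P.base g + P.faceHeight g.1 • g.up := by
    rw [base, ← h.left, h1]
    simp
  rw [h.right, h3, hb] at h2
  simp only [if_true, Bool.false_eq_true, if_false, zero_smul, add_zero] at h2
  have h4 : P.faceWidth f.1 • f.right = P.faceWidth g.1 • g.right := by
    have h5 : P.base g + P.faceHeight g.1 • g.up + P.faceWidth f.1 • f.right =
      P.base g + P.faceHeight g.1 • g.up + P.faceWidth g.1 • g.right := by rw [h2]; abel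
    exact add_left_cancel h5
  obtain ⟨e1, e2⟩ := Panel.eq_of_smul_eq (P.faceWidth_pos _) (P.faceWidth_pos _) f.right_dot_right
    g.right_dot_right h4
  exact ⟨e1, e2, hb⟩

theorem RightAdj.geometry (h : RightAdj g f) : P.faceHeight f.1 = P.faceHeight g.1 ∧
    f.up = g.up ∧ P.base f = P.base g + P.faceWidth g.1 • g.right := by
  have h1 := P.point_corner g true false
  have h2 := P.point_corner g true true
  have h3 := P.point_corner f false true
  have hb : P.base f = P.base g + P.faceWidth g.1 • g.right := by
    rw [base, ← h.lower, h1]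
    simp
  rw [h.upper, h3, hb] at h2
  simp only [if_true, Bool.false_eq_true, if_false, zero_smul, add_zero] at h2
  obtain ⟨e1, e2⟩ := Panel.eq_of_smul_eq (P.faceHeight_pos _) (P.faceHeight_pos _) f.up_dot_up
    g.up_dot_up (add_left_cancel h2)
  exact ⟨e1, e2, hb⟩

/-- In the direction `g.up`, no point of `g` is beyond the common edge and, by `noFold`, no point of
`f` is before it. So the panels have only this edge in common; without the sign condition they could
be folded onto each other. -/
theorem UpAdj.inter (h : UpAdj g f) {p : Fin 3 → ℝ} (hg : p ∈ P.carrier g.1)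
    (hf : p ∈ P.carrier f.1) : ∃ α, 0 ≤ α ∧ α ≤ P.faceWidth g.1 ∧
      p = P.base g + α • g.right + P.faceHeight g.1 • g.up ∧
      p = P.base f + α • f.right + (0 : ℝ) • f.up := by
  obtain ⟨e1, e2, e3⟩ := h.geometry P
  obtain ⟨α, β, h1, h2, h3, h4, hp⟩ := (P.mem_carrier_iff g p).1 hg
  obtain ⟨α', β', h1', h2', h3', h4', hp'⟩ := (P.mem_carrier_iff f p).1 hf
  have hd : (p - P.base g) ⬝ᵥ g.up = β := by
    rw [hp]
    simp [add_dotProduct, smul_dotProduct, g.right_dot_up, g.up_dot_up]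
  have hd' : (p - P.base g) ⬝ᵥ g.up = P.faceHeight g.1 + β' * (g.up ⬝ᵥ f.up) := by
    rw [hp', e3, e2]
    simp [add_dotProduct, sub_dotProduct, smul_dotProduct, g.right_dot_up, g.up_dot_up,
      dotProduct_comm f.up]
    ring
  have hβ : β = P.faceHeight g.1 := by
    have := mul_nonneg h3' h.noFold
    linarith
  subst hβ
  refine ⟨α, h1, h2, hp, ?_⟩
  rw [e2, e3, hp]
  simp only [zero_smul, add_zero]
  abel

theorem RightAdj.inter (h : RightAdj g f) {p : Fin 3 → ℝ} (hg : p ∈ P.carrier g.1)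
    (hf : p ∈ P.carrier f.1) : ∃ β, 0 ≤ β ∧ β ≤ P.faceHeight g.1 ∧
      p = P.base g + P.faceWidth g.1 • g.right + β • g.up ∧
      p = P.base f + (0 : ℝ) • f.right + β • f.up := by
  obtain ⟨e1, e2, e3⟩ := h.geometry P
  obtain ⟨α, β, h1, h2, h3, h4, hp⟩ := (P.mem_carrier_iff g p).1 hg
  obtain ⟨α', β', h1', h2', h3', h4', hp'⟩ := (P.mem_carrier_iff f p).1 hf
  have hur : g.up ⬝ᵥ g.right = 0 := by rw [dotProduct_comm, g.right_dot_up]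
  have hd : (p - P.base g) ⬝ᵥ g.right = α := by
    rw [hp]
    simp [add_dotProduct, smul_dotProduct, hur, g.right_dot_right]
  have hd' : (p - P.base g) ⬝ᵥ g.right = P.faceWidth g.1 + α' * (g.right ⬝ᵥ f.right) := by
    rw [hp', e3, e2]
    simp [add_dotProduct, sub_dotProduct, smul_dotProduct, hur, g.right_dot_right,
      dotProduct_comm f.right]
    ring
  have hα : α = P.faceWidth g.1 := by
    have := mul_nonneg h1' h.noFold
    linarith
  subst hα
  refine ⟨β, h3, h4, hp, ?_⟩
  rw [e2, e3, hp]
  simp only [zero_smul, add_zero]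

/-- Two gridfaces that meet in an edge. -/
def SingleLayerMT.MeetInEdge (f g : GridFace) : Prop :=
  ∃ a b : Fin 3 → ℝ, a ≠ b ∧ P.carrier f ∩ P.carrier g = segment ℝ a b

theorem SingleLayerMT.MeetInEdge.symm {P : SingleLayerMT} {f g : GridFace}
    (h : P.MeetInEdge f g) : P.MeetInEdge g f := by
  obtain ⟨a, b, hab, h⟩ := h
  exact ⟨a, b, hab, by rw [inter_comm, h]⟩

theorem mem_segment_of_eq {a v p : Fin 3 → ℝ} {w α : ℝ} (hw : 0 < w) (h0 : 0 ≤ α) (h1 : α ≤ w)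
    (hp : p = a + α • v) : p ∈ segment ℝ a (a + w • v) := by
  rw [segment_eq_image']
  refine ⟨α / w, ⟨by positivity, by rw [div_le_one hw]; exact h1⟩, ?_⟩
  simp only [add_sub_cancel_left, smul_smul, div_mul_cancel₀ _ hw.ne']
  exact hp.symm

theorem add_smul_ne {a v : Fin 3 → ℝ} {w : ℝ} (hw : 0 < w) (hv : v ⬝ᵥ v = 1) : a ≠ a + w • v := by
  intro h
  have h1 : w • v = 0 := by simpa using h
  have h2 := (smul_eq_zero.1 h1).resolve_left hw.ne'
  rw [h2] at hv
  simp at hv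

theorem UpAdj.meetInEdge (h : UpAdj g f) : P.MeetInEdge g.1 f.1 := by
  have e1 := P.point_corner g false true
  have e2 := P.point_corner g true true
  have e : P.point (g.corner true true) =
      P.point (g.corner false true) + P.faceWidth g.1 • g.right := by
    rw [e1, e2]
    simp only [if_true, Bool.false_eq_true, if_false, zero_smul, add_zero]
    abel
  refine ⟨P.point (g.corner false true), P.point (g.corner true true), ?_, ?_⟩
  · rw [e]
    exact add_smul_ne (P.faceWidth_pos _) g.right_dot_right
  · refine Subset.antisymm (fun p hp => ?_) (subset_inter ?_ ?_)
    · obtain ⟨α, h1, h2, h3, -⟩ := h.inter P hp.1 hp.2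
      rw [e]
      refine mem_segment_of_eq (P.faceWidth_pos _) h1 h2 ?_
      rw [h3, e1]
      simp only [if_true, Bool.false_eq_true, if_false, zero_smul, add_zero]
      abel
    · exact (P.convex_carrier _).segment_subset (P.point_corner_mem g _ _) (P.point_corner_mem g _ _)
    · rw [h.left, h.right]
      exact (P.convex_carrier _).segment_subset (P.point_corner_mem f _ _) (P.point_corner_mem f _ _)

theorem RightAdj.meetInEdge (h : RightAdj g f) : P.MeetInEdge g.1 f.1 := by
  have e1 := P.point_corner g true false
  have e2 := P.point_corner g true true
  have e : P.point (g.corner true true) =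
      P.point (g.corner true false) + P.faceHeight g.1 • g.up := by
    rw [e1, e2]
    simp
  refine ⟨P.point (g.corner true false), P.point (g.corner true true), ?_, ?_⟩
  · rw [e]
    exact add_smul_ne (P.faceHeight_pos _) g.up_dot_up
  · refine Subset.antisymm (fun p hp => ?_) (subset_inter ?_ ?_)
    · obtain ⟨β, h1, h2, h3, -⟩ := h.inter P hp.1 hp.2
      rw [e]
      refine mem_segment_of_eq (P.faceHeight_pos _) h1 h2 ?_
      rw [h3, e1]
      simp
    · exact (P.convex_carrier _).segment_subset (P.point_corner_mem g _ _) (P.point_corner_mem g _ _)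
    · rw [h.lower, h.upper]
      exact (P.convex_carrier _).segment_subset (P.point_corner_mem f _ _) (P.point_corner_mem f _ _)

/-- The common edge has the same coordinate along `right` in both panels and is placed at the top of
one rectangle and the bottom of the other. -/
theorem UpAdj.place_agree (h : UpAdj g f) (x y : ℝ) {p : Fin 3 → ℝ} (hg : p ∈ P.carrier g.1)
    (hf : p ∈ P.carrier f.1) :
    (P.place g x y).apply p = (P.place f x (y + P.faceHeight g.1)).apply p := by
  obtain ⟨α, -, -, h1, h2⟩ := h.inter P hg hf
  conv_rhs => rw [h2]
  rw [h1, place_apply, place_apply, add_zero]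

theorem RightAdj.place_agree (h : RightAdj g f) (x y : ℝ) {p : Fin 3 → ℝ}
    (hg : p ∈ P.carrier g.1) (hf : p ∈ P.carrier f.1) :
    (P.place g x y).apply p = (P.place f (x + P.faceWidth g.1) y).apply p := by
  obtain ⟨α, -, -, h1, h2⟩ := h.inter P hg hf
  conv_rhs => rw [h2]
  rw [h1, place_apply, place_apply, add_zero]

end adjacency

/-! ### Planar columns -/

/-- `Unrolls σ ξ σ'`: when the strip `ξ` is attached to a planar strip with last column `σ`
(a list of panels from bottom to top), each gridface is placed above or below the last column, or
begins a new column on the right of one of its panels, and the last column becomes `σ'`. The order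
of two steps is irrelevant if the latter does not depend on the former. -/
inductive Unrolls : List Panel → Strip → List Panel → Prop
  | nil (σ : List Panel) : Unrolls σ [] σ
  | up {σ : List Panel} {g f : Panel} {ξ : Strip} {τ : List Panel} (h : UpAdj g f) :
      Unrolls (σ ++ [g, f]) ξ τ → Unrolls (σ ++ [g]) (⟨some g.1, f.1⟩ :: ξ) τ
  | down {σ : List Panel} {g f : Panel} {ξ : Strip} {τ : List Panel} (h : UpAdj f g) :
      Unrolls (f :: g :: σ) ξ τ → Unrolls (g :: σ) (⟨some g.1, f.1⟩ :: ξ) τ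
  | right {σ : List Panel} {g f : Panel} {ξ : Strip} {τ : List Panel} (hg : g ∈ σ)
      (h : RightAdj g f) : Unrolls [f] ξ τ → Unrolls σ (⟨some g.1, f.1⟩ :: ξ) τ
  | swap {σ : List Panel} {a b : Step} {ξ : Strip} {τ : List Panel}
      (h : ∀ g, a.hinge = some g → g ≠ b.face) : Unrolls σ (b :: a :: ξ) τ →
      Unrolls σ (a :: b :: ξ) τ

theorem Unrolls.trans {σ τ ρ : List Panel} {ξ ζ : Strip} (h : Unrolls σ ξ τ)
    (h' : Unrolls τ ζ ρ) : Unrolls σ (ξ ++ ζ) ρ := by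
  induction h with
  | nil => exact h'
  | up h _ ih => exact .up h (ih h')
  | down h _ ih => exact .down h (ih h')
  | right hg h _ ih => exact .right hg h (ih h')
  | swap h _ ih => exact .swap h (ih h')

namespace SingleLayerMT

variable (P : SingleLayerMT)

/-- Every step is hinged on one of the given gridfaces or on the gridface of an earlier step. -/
def Hinged : List GridFace → Strip → Prop
  | _, [] => True
  | seen, s :: ξ => (∃ g ∈ seen, s.hinge = some g ∧ P.MeetInEdge g s.face) ∧
      Hinged (s.face :: seen) ξ

variable {P}

theorem Hinged.mono {seen seen' : List GridFace} {ξ : Strip} (h : P.Hinged seen ξ)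
    (hs : seen ⊆ seen') : P.Hinged seen' ξ := by
  induction ξ generalizing seen seen' with
  | nil => trivial
  | cons s ξ ih =>
    obtain ⟨⟨g, hg, h1⟩, h2⟩ := h
    exact ⟨⟨g, hs hg, h1⟩, ih h2 (List.cons_subset_cons _ hs)⟩

theorem Unrolls.hinged {σ τ : List Panel} {ξ : Strip} (h : Unrolls σ ξ τ) {seen : List GridFace}
    (hs : ∀ g ∈ σ, g.1 ∈ seen) : P.Hinged seen ξ := by
  induction h generalizing seen with
  | nil => trivial
  | @up σ g f ξ τ h _ ih =>
    refine ⟨⟨g.1, hs g (by simp), rfl, h.meetInEdge P⟩, ih fun g' hg' => ?_⟩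
    simp only [List.mem_append, List.mem_cons, List.not_mem_nil, or_false] at hg' hs ⊢
    rcases hg' with hg' | rfl | rfl
    · exact Or.inr (hs g' (Or.inl hg'))
    · exact Or.inr (hs g' (Or.inr rfl))
    · exact Or.inl rfl
  | @down σ g f ξ τ h _ ih =>
    refine ⟨⟨g.1, hs g (by simp), rfl, (h.meetInEdge P).symm⟩, ih fun g' hg' => ?_⟩
    simp only [List.mem_cons] at hg' hs ⊢
    rcases hg' with rfl | hg'
    · exact Or.inl rfl
    · exact Or.inr (hs g' hg')
  | @right σ g f ξ τ hg h _ ih =>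
    refine ⟨⟨g.1, hs g hg, rfl, h.meetInEdge P⟩, ih fun g' hg' => ?_⟩
    rw [List.mem_singleton] at hg'
    subst hg'
    exact List.mem_cons_self
  | @swap σ a b ξ τ h2 _ ih =>
    -- By the side condition of `swap`, the step `a` does not hang on `b`, so it may come first.
    obtain ⟨⟨g, hg, h3, h4⟩, ⟨g', hg', h3', h4'⟩, h5⟩ := ih hs
    refine ⟨⟨g', ?_, h3', h4'⟩, ⟨g, List.mem_cons_of_mem _ hg, h3, h4⟩, h5.mono ?_⟩
    · exact (List.mem_cons.1 hg').resolve_left fun e => h2 g' h3' e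
    · intro x hx
      simp only [List.mem_cons] at hx ⊢
      tauto

theorem Hinged.isPiece {f : GridFace} {ξ : Strip} (h : P.Hinged [f] ξ)
    (hn : ((⟨none, f⟩ :: ξ : Strip).map Step.face).Nodup) : P.IsPiece (⟨none, f⟩ :: ξ) := by
  refine ⟨by simp, hn, ?_⟩
  have key : ∀ (seen : List GridFace) (ξ : Strip), P.Hinged seen ξ →
      ∀ before step after, ξ = before ++ step :: after →
      ∃ g, (g ∈ seen ∨ g ∈ before.map Step.face) ∧ step.hinge = some g ∧
        P.MeetInEdge g step.face := by
    intro seen ξ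
    induction ξ generalizing seen with
    | nil => simp
    | cons s ξ ih =>
      rintro ⟨⟨g, hg, h1, h2⟩, h3⟩ before step after he
      cases before with
      | nil =>
        obtain ⟨rfl, rfl⟩ := List.cons.inj he
        exact ⟨g, Or.inl hg, h1, h2⟩
      | cons s' before =>
        rw [List.cons_append] at he
        obtain ⟨rfl, rfl⟩ := List.cons.inj he
        obtain ⟨g, h4, h5, h6⟩ := ih _ h3 before step after rfl
        refine ⟨g, ?_, h5, h6⟩
        simp only [List.mem_cons, List.map_cons] at h4 ⊢
        tauto
  intro before step after he
  cases before with
  | nil =>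
    obtain ⟨rfl, rfl⟩ := List.cons.inj he
    exact Or.inl ⟨rfl, rfl⟩
  | cons s before =>
    rw [List.cons_append] at he
    obtain ⟨rfl, rfl⟩ := List.cons.inj he
    obtain ⟨g, h1, h2, h3⟩ := key _ _ h before step after rfl
    refine Or.inr ⟨g, ?_, h2, h3⟩
    simp only [List.mem_cons, List.map_cons, List.not_mem_nil, or_false] at h1 ⊢
    exact h1

end SingleLayerMT
end ManhattanTower

/-! ### Layouts: planar strips without overlap -/

namespace ManhattanTower

open Set Matrix

namespace SingleLayerMT

variable (P : SingleLayerMT)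

/-- The panels of a list are placed in a column over `[xl, xr]`, from height `y` to height `y'`. -/
def Stacked (Φ : GridFace → Placement) (xl xr : ℝ) : ℝ → List Panel → ℝ → Prop
  | y, [], y' => y = y'
  | y, g :: σ, y' => Φ g.1 = P.place g xl y ∧ xl + P.faceWidth g.1 = xr ∧
      Stacked Φ xl xr (y + P.faceHeight g.1) σ y'

variable {P} {Φ Φ' : GridFace → Placement} {xl xr y y' : ℝ} {σ : List Panel}

theorem Stacked.le (h : P.Stacked Φ xl xr y σ y') : y ≤ y' := by
  induction σ generalizing y with
  | nil => exact (show y = y' from h).le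
  | cons g σ ih =>
    have := ih h.2.2
    have := P.faceHeight_pos g.1
    linarith

theorem Stacked.congr (h : P.Stacked Φ xl xr y σ y') (hΦ : ∀ g ∈ σ, Φ' g.1 = Φ g.1) :
    P.Stacked Φ' xl xr y σ y' := by
  induction σ generalizing y with
  | nil => exact h
  | cons g σ ih =>
    exact ⟨(hΦ g (by simp)).trans h.1, h.2.1, ih h.2.2 fun g' hg' => hΦ g' (by simp [hg'])⟩

theorem Stacked.exists_of_mem (h : P.Stacked Φ xl xr y σ y') {g : Panel} (hg : g ∈ σ) :
    ∃ z, y ≤ z ∧ z + P.faceHeight g.1 ≤ y' ∧ Φ g.1 = P.place g xl z ∧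
      xl + P.faceWidth g.1 = xr := by
  induction σ generalizing y with
  | nil => simp at hg
  | cons g' σ ih =>
    rcases List.mem_cons.1 hg with rfl | hg
    · exact ⟨y, le_rfl, h.2.2.le, h.1, h.2.1⟩
    · obtain ⟨z, h1, h2⟩ := ih h.2.2 hg
      have := P.faceHeight_pos g'.1
      exact ⟨z, by linarith, h2⟩

theorem Stacked.append_singleton {g : Panel} : P.Stacked Φ xl xr y (σ ++ [g]) y' ↔
    ∃ z, P.Stacked Φ xl xr y σ z ∧ Φ g.1 = P.place g xl z ∧ xl + P.faceWidth g.1 = xr ∧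
      z + P.faceHeight g.1 = y' := by
  induction σ generalizing y with
  | nil =>
    constructor
    · intro h
      exact ⟨y, rfl, h.1, h.2.1, h.2.2⟩
    · rintro ⟨z, h1, h2⟩
      obtain rfl : y = z := h1
      exact h2
  | cons g' σ ih =>
    constructor
    · intro h
      obtain ⟨z, h1, h2⟩ := ih.1 h.2.2
      exact ⟨z, ⟨h.1, h.2.1, h1⟩, h2⟩
    · rintro ⟨z, h1, h2⟩
      exact ⟨h1.1, h1.2.1, ih.2 ⟨z, h1.2.2, h2⟩⟩

variable (P) in
/-- The strip is unfolded by `Φ` to a planar strip between `x₁` and `xr` with last column `σ`. -/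
structure Layout (x₁ : ℝ) (ξ : Strip) (Φ : GridFace → Placement) (σ : List Panel)
    (xl xr yb yt : ℝ) : Prop where
  dev : P.IsDevelopment ξ Φ
  hinges : ∀ s ∈ ξ, ∀ g, s.hinge = some g → g ∈ ξ.map Step.face
  disj : ∀ f ∈ ξ.map Step.face, ∀ g ∈ ξ.map Step.face, f ≠ g →
    Disjoint (interior (P.planarFace Φ f)) (interior (P.planarFace Φ g))
  mono : ∀ x : ℝ, IsPreconnected {p ∈ P.planarStrip ξ Φ | p.1 = x}
  bound : ∀ p ∈ P.planarStrip ξ Φ, x₁ ≤ p.1 ∧ p.1 ≤ xr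
  old : ∀ f ∈ ξ.map Step.face, (∃ g ∈ σ, g.1 = f) ∨ ∀ p ∈ P.planarFace Φ f, p.1 ≤ xl
  stacked : P.Stacked Φ xl xr yb σ yt
  column : ∀ g ∈ σ, g.1 ∈ ξ.map Step.face
  lt : x₁ < xr

theorem planarStrip_congr {ξ ξ' : Strip} (h : ∀ f, f ∈ ξ.map Step.face ↔ f ∈ ξ'.map Step.face)
    (Φ : GridFace → Placement) : P.planarStrip ξ Φ = P.planarStrip ξ' Φ := by
  simp only [planarStrip, h]

theorem Layout.perm {x₁ yb yt : ℝ} {ξ ξ' : Strip} (h : P.Layout x₁ ξ Φ σ xl xr yb yt)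
    (hp : ξ.Perm ξ') : P.Layout x₁ ξ' Φ σ xl xr yb yt := by
  have hf : ∀ f, f ∈ ξ.map Step.face ↔ f ∈ ξ'.map Step.face := fun f =>
    (hp.map Step.face).mem_iff
  obtain ⟨h1, h0, h2, h3, h4, h5, h6, h7, h8⟩ := h
  rw [planarStrip_congr hf] at h4
  simp only [planarStrip_congr hf] at h3
  simp only [hf] at h0 h2 h5 h7
  exact ⟨fun s hs => h1 s (hp.mem_iff.2 hs), fun s hs => h0 s (hp.mem_iff.2 hs), h2, h3, h4, h5,
    h6, h7, h8⟩

theorem planarFace_congr {f : GridFace} (h : Φ' f = Φ f) : P.planarFace Φ' f = P.planarFace Φ f := by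
  rw [planarFace, planarFace, h]

theorem planarFace_eq {g : Panel} {x y : ℝ} (h : Φ g.1 = P.place g x y) :
    P.planarFace Φ g.1 = Icc x (x + P.faceWidth g.1) ×ˢ Icc y (y + P.faceHeight g.1) := by
  rw [planarFace, h, image_place]

theorem interior_rect {a b c d : ℝ} : interior (Icc a b ×ˢ Icc c d) = Ioo a b ×ˢ Ioo c d := by
  rw [interior_prod_eq, interior_Icc, interior_Icc]

/-- A further gridface is placed beside the planar strip. -/
theorem Layout.extend {x₁ yb yt : ℝ} {ξ : Strip} (h : P.Layout x₁ ξ Φ σ xl xr yb yt) {g f : Panel}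
    (hg : g.1 ∈ ξ.map Step.face) (hf : f.1 ∉ ξ.map Step.face) {x y xl' xr' yb' yt' : ℝ}
    {σ' : List Panel} [DecidableEq GridFace]
    (hag : ∀ p ∈ P.carrier g.1 ∩ P.carrier f.1, (Φ g.1).apply p = (P.place f x y).apply p)
    (hx : x₁ ≤ x) (hxr : x + P.faceWidth f.1 = xr') (hxr' : xr ≤ xr')
    (hdisj : ∀ e ∈ ξ.map Step.face, Disjoint (interior (P.planarFace Φ e))
      (Ioo x xr' ×ˢ Ioo y (y + P.faceHeight f.1)))
    (hmono : ∀ x' ∈ Icc x xr', xr < x' ∨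
      ∃ z ∈ Icc y (y + P.faceHeight f.1), (x', z) ∈ P.planarStrip ξ Φ)
    (hold : ∀ e ∈ ξ.map Step.face, (∃ g ∈ σ', g.1 = e) ∨ ∀ p ∈ P.planarFace Φ e, p.1 ≤ xl')
    (hst : ∀ Φ' : GridFace → Placement, Φ' f.1 = P.place f x y →
      (∀ e ∈ ξ.map Step.face, Φ' e = Φ e) → P.Stacked Φ' xl' xr' yb' σ' yt')
    (hcol : ∀ g ∈ σ', g = f ∨ g.1 ∈ ξ.map Step.face) (hfσ : f ∈ σ') :
    P.Layout x₁ (ξ ++ [⟨some g.1, f.1⟩]) (Function.update Φ f.1 (P.place f x y)) σ' xl' xr'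
      yb' yt' := by
  set Φ' := Function.update Φ f.1 (P.place f x y) with hΦ'
  have hnew : Φ' f.1 = P.place f x y := Function.update_self _ _ _
  have hkeep : ∀ e ∈ ξ.map Step.face, Φ' e = Φ e := fun e he =>
    Function.update_of_ne (ne_of_mem_of_not_mem he hf) _ _
  have hrect : P.planarFace Φ' f.1 = Icc x xr' ×ˢ Icc y (y + P.faceHeight f.1) := by
    rw [planarFace_eq hnew, hxr]
  have hfaces : ∀ e, e ∈ (ξ ++ [(⟨some g.1, f.1⟩ : Step)]).map Step.face ↔
      e ∈ ξ.map Step.face ∨ e = f.1 := by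
    intro e
    simp
  have hpf : ∀ e ∈ ξ.map Step.face, P.planarFace Φ' e = P.planarFace Φ e := fun e he =>
    planarFace_congr (hkeep e he)
  have hstrip : P.planarStrip (ξ ++ [(⟨some g.1, f.1⟩ : Step)]) Φ' =
      P.planarStrip ξ Φ ∪ Icc x xr' ×ˢ Icc y (y + P.faceHeight f.1) := by
    ext p
    simp only [planarStrip, mem_iUnion, hfaces, mem_union, exists_prop]
    constructor
    · rintro ⟨e, he | rfl, hp⟩
      · exact Or.inl ⟨e, he, hpf e he ▸ hp⟩
      · exact Or.inr (hrect ▸ hp)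
    · rintro (⟨e, he, hp⟩ | hp)
      · exact ⟨e, Or.inl he, (hpf e he).symm ▸ hp⟩
      · exact ⟨f.1, Or.inr rfl, hrect.symm ▸ hp⟩
  have hw := P.faceWidth_pos f.1
  have hh := P.faceHeight_pos f.1
  have hlt := h.lt
  refine ⟨?_, ?_, ?_, ?_, ?_, ?_, hst Φ' hnew hkeep, ?_, by linarith⟩
  · intro s hs
    rcases List.mem_append.1 hs with hs | hs
    · have hsf : s.face ∈ ξ.map Step.face := List.mem_map_of_mem hs
      refine ⟨?_, fun e he p hp => ?_⟩
      · rw [hkeep _ hsf]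
        exact (h.dev s hs).1
      · rw [hkeep _ hsf, hkeep e (h.hinges s hs e he)]
        exact (h.dev s hs).2 e he p hp
    · rw [List.mem_singleton] at hs
      subst hs
      refine ⟨?_, fun e he p hp => ?_⟩
      · rw [hnew]
        exact P.laysFlat_place f x y
      · obtain rfl := Option.some.inj he
        rw [hnew, hkeep _ hg]
        exact hag p hp
  · intro s hs e he
    rw [hfaces]
    rcases List.mem_append.1 hs with hs | hs
    · exact Or.inl (h.hinges s hs e he)
    · rw [List.mem_singleton] at hs
      subst hs
      obtain rfl := Option.some.inj he
      exact Or.inl hg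
  · intro e he e' he' hne
    rw [hfaces] at he he'
    rcases he with he | rfl <;> rcases he' with he' | rfl
    · rw [hpf e he, hpf e' he']
      exact h.disj e he e' he' hne
    · rw [hpf e he, hrect, interior_rect]
      exact hdisj e he
    · rw [hpf e' he', hrect, interior_rect]
      exact (hdisj e' he').symm
    · exact absurd rfl hne
  · intro x'
    rw [hstrip]
    have e1 : {p ∈ P.planarStrip ξ Φ ∪ Icc x xr' ×ˢ Icc y (y + P.faceHeight f.1) | p.1 = x'} =
        {p ∈ P.planarStrip ξ Φ | p.1 = x'} ∪
          {p ∈ Icc x xr' ×ˢ Icc y (y + P.faceHeight f.1) | p.1 = x'} := by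
      ext p
      simp only [mem_ofPred_eq, mem_union]
      tauto
    rw [e1]
    by_cases hx' : x' ∈ Icc x xr'
    · have e2 : {p ∈ Icc x xr' ×ˢ Icc y (y + P.faceHeight f.1) | p.1 = x'} =
          {x'} ×ˢ Icc y (y + P.faceHeight f.1) := by
        ext p
        constructor
        · rintro ⟨⟨h1, h2⟩, h3⟩
          exact ⟨h3, h2⟩
        · rintro ⟨h1, h2⟩
          obtain rfl : p.1 = x' := h1
          exact ⟨⟨hx', h2⟩, rfl⟩
      have hpre : IsPreconnected ({x'} ×ˢ Icc y (y + P.faceHeight f.1)) :=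
        isPreconnected_singleton.prod isPreconnected_Icc
      rw [e2]
      -- On a vertical line through the new rectangle, either there is nothing old, or the old part
      -- and the new segment are connected sets with a common point.
      rcases hmono x' hx' with h1 | ⟨z, hz, hz'⟩
      · have e3 : {p ∈ P.planarStrip ξ Φ | p.1 = x'} = ∅ := by
          ext p
          simp only [mem_ofPred_eq, mem_empty_iff_false, iff_false, not_and]
          rintro hp rfl
          exact absurd (h.bound p hp).2 (not_le.2 h1)
        rw [e3, empty_union]
        exact hpre
      · exact (h.mono x').union (x', z) ⟨hz', rfl⟩ ⟨rfl, hz⟩ hpre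
    · have e2 : {p ∈ Icc x xr' ×ˢ Icc y (y + P.faceHeight f.1) | p.1 = x'} = ∅ := by
        ext p
        simp only [mem_ofPred_eq, mem_empty_iff_false, iff_false, not_and]
        rintro hp rfl
        exact hx' hp.1
      rw [e2, union_empty]
      exact h.mono x'
  · intro p hp
    rw [hstrip] at hp
    rcases hp with hp | hp
    · have := h.bound p hp
      exact ⟨this.1, by linarith⟩
    · exact ⟨hx.trans hp.1.1, hp.1.2⟩
  · intro e he
    rw [hfaces] at he
    rcases he with he | rfl
    · rw [hpf e he]
      exact hold e he
    · exact Or.inl ⟨f, hfσ, rfl⟩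
  · intro g' hg'
    rw [hfaces]
    rcases hcol g' hg' with rfl | h1
    · exact Or.inr rfl
    · exact Or.inl h1

/-- The planar strip contains the rectangles of its last column. -/
theorem Layout.mem_planarStrip {x₁ yb yt : ℝ} {ξ : Strip} (h : P.Layout x₁ ξ Φ σ xl xr yb yt)
    {g : Panel} (hg : g ∈ σ) {z : ℝ} (hz : Φ g.1 = P.place g xl z) {p : ℝ × ℝ}
    (hp : p ∈ Icc xl xr ×ˢ Icc z (z + P.faceHeight g.1)) : p ∈ P.planarStrip ξ Φ := by
  refine mem_biUnion (h.column g hg) ?_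
  obtain ⟨-, -, -, -, h2⟩ := h.stacked.exists_of_mem hg
  rw [planarFace_eq hz, h2]
  exact hp

/-- Everything outside the last column lies to its left, so a rectangle placed above or below the
last column overlaps nothing. -/
theorem Layout.interior_old {x₁ yb yt : ℝ} {ξ : Strip} (h : P.Layout x₁ ξ Φ σ xl xr yb yt)
    {e : GridFace} (he : e ∈ ξ.map Step.face) {p : ℝ × ℝ} (hp : p ∈ interior (P.planarFace Φ e)) :
    p.1 ≤ xl ∨ yb < p.2 ∧ p.2 < yt := by
  rcases h.old e he with ⟨g, hg, rfl⟩ | h1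
  · obtain ⟨z, h1, h2, h3, h4⟩ := h.stacked.exists_of_mem hg
    rw [planarFace_eq h3, interior_rect] at hp
    exact Or.inr ⟨by linarith [hp.2.1], by linarith [hp.2.2]⟩
  · exact Or.inl (h1 p (interior_subset hp))

theorem exists_agreeing {ξ : Strip} {s : Step} [DecidableEq GridFace] {f : GridFace}
    {pl : Placement} {Q : (GridFace → Placement) → Prop} (hf : f ∉ ξ.map Step.face)
    (h : ∃ Φ', (∀ e ∈ (ξ ++ [s]).map Step.face, Φ' e = Function.update Φ f pl e) ∧ Q Φ') :
    ∃ Φ', (∀ e ∈ ξ.map Step.face, Φ' e = Φ e) ∧ Q Φ' := by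
  obtain ⟨Φ', h1, h2⟩ := h
  refine ⟨Φ', fun e he => ?_, h2⟩
  rw [h1 e (by simp only [List.map_append, List.mem_append]; exact Or.inl he),
    Function.update_of_ne (ne_of_mem_of_not_mem he hf)]

/-- A panel placed above or below has the same width as the last column and shares a whole edge with
it; a panel placed on the right lies beyond everything and begins a new last column. In each case
vertical lines still meet the strip in connected sets. Distinctness of the gridfaces permits
defining the placement one gridface at a time. -/
theorem Layout.exists_of_unrolls {x₁ yb yt : ℝ} {ξ ζ : Strip} {τ : List Panel}
    (h : Unrolls σ ζ τ) (hl : P.Layout x₁ ξ Φ σ xl xr yb yt)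
    (hn : ((ξ ++ ζ).map Step.face).Nodup) :
    ∃ Φ', (∀ e ∈ ξ.map Step.face, Φ' e = Φ e) ∧
      ∃ xl xr yb yt, P.Layout x₁ (ξ ++ ζ) Φ' τ xl xr yb yt := by
  classical
  induction h generalizing ξ Φ xl xr yb yt with
  | nil => exact ⟨Φ, fun _ _ => rfl, xl, xr, yb, yt, by rwa [List.append_nil]⟩
  | @up σ g f ζ τ h _ ih =>
    have hn' := hn
    rw [List.append_cons] at hn ⊢
    obtain ⟨z, hs, hg, hw, hz⟩ := Stacked.append_singleton.1 hl.stacked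
    have hgm : g ∈ σ ++ [g] := by simp
    have hgξ := hl.column g hgm
    have hf : f.1 ∉ ξ.map Step.face := by
      simp only [List.map_append, List.map_cons, List.nodup_append] at hn'
      exact fun hm => hn'.2.2 f.1 hm f.1 (by simp) rfl
    obtain ⟨e1, e2, e3⟩ := h.geometry P
    have hwp := P.faceWidth_pos g.1
    have hxl : x₁ ≤ xl := (hl.bound (xl, z) (hl.mem_planarStrip hgm hg
      ⟨⟨le_rfl, by linarith⟩, le_rfl, by linarith [P.faceHeight_pos g.1]⟩)).1
    refine exists_agreeing hf (ih (hl.extend (x := xl) (y := yt) (xl' := xl) (xr' := xr) (yb' := yb)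
      (yt' := yt + P.faceHeight f.1) (σ' := σ ++ [g, f]) hgξ hf ?_ hxl (by rw [e1, hw]) le_rfl
      ?_ ?_ ?_ ?_ ?_ (by simp)) hn)
    · intro p hp
      rw [hg, ← hz]
      exact h.place_agree P xl z hp.1 hp.2
    · intro e he
      rw [Set.disjoint_left]
      intro p hp hp'
      rcases hl.interior_old he hp with h1 | h1
      · exact absurd hp'.1.1 (not_lt.2 h1)
      · exact absurd hp'.2.1 (not_lt.2 h1.2.le)
    · intro x' hx'
      exact Or.inr ⟨yt, ⟨le_rfl, by linarith [P.faceHeight_pos f.1]⟩,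
        hl.mem_planarStrip hgm hg ⟨hx', by simp only; linarith [P.faceHeight_pos g.1], hz.ge⟩⟩
    · intro e he
      rcases hl.old e he with ⟨g', hg', h1⟩ | h1
      · exact Or.inl ⟨g', by simp only [List.mem_append, List.mem_cons] at hg' ⊢; tauto, h1⟩
      · exact Or.inr h1
    · intro Φ' hf' hk
      rw [show σ ++ [g, f] = (σ ++ [g]) ++ [f] by simp]
      exact Stacked.append_singleton.2 ⟨yt, hl.stacked.congr fun g' hg' => hk _ (hl.column g' hg'),
        hf', by rw [e1, hw], rfl⟩
    · intro g' hg'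
      rw [show σ ++ [g, f] = (σ ++ [g]) ++ [f] by simp, List.mem_append,
        List.mem_singleton] at hg'
      exact hg'.symm.imp_right (hl.column g')
  | @down σ g f ζ τ h _ ih =>
    have hn' := hn
    rw [List.append_cons] at hn ⊢
    obtain ⟨hg, hw, hs⟩ := hl.stacked
    have hgm : g ∈ g :: σ := by simp
    have hgξ := hl.column g hgm
    have hf : f.1 ∉ ξ.map Step.face := by
      simp only [List.map_append, List.map_cons, List.nodup_append] at hn'
      exact fun hm => hn'.2.2 f.1 hm f.1 (by simp) rfl
    obtain ⟨e1, e2, e3⟩ := h.geometry P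
    have hwp := P.faceWidth_pos g.1
    have hhp := P.faceHeight_pos g.1
    have hhf := P.faceHeight_pos f.1
    have hxl : x₁ ≤ xl := (hl.bound (xl, yb) (hl.mem_planarStrip hgm hg
      ⟨⟨le_rfl, by linarith⟩, le_rfl, by linarith⟩)).1
    refine exists_agreeing hf (ih (hl.extend (x := xl) (y := yb - P.faceHeight f.1) (xl' := xl) (xr' := xr)
      (yb' := yb - P.faceHeight f.1) (yt' := yt) (σ' := f :: g :: σ) hgξ hf ?_ hxl
      (by rw [← e1, hw]) le_rfl ?_ ?_ ?_ ?_ ?_ (by simp)) hn)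
    · intro p hp
      rw [hg, h.place_agree P xl (yb - P.faceHeight f.1) hp.2 hp.1, sub_add_cancel]
    · intro e he
      rw [Set.disjoint_left]
      intro p hp hp'
      rcases hl.interior_old he hp with h1 | h1
      · exact absurd hp'.1.1 (not_lt.2 h1)
      · have := hp'.2.2
        linarith
    · intro x' hx'
      exact Or.inr ⟨yb, ⟨by linarith, by linarith⟩,
        hl.mem_planarStrip hgm hg ⟨hx', le_rfl, by simp only; linarith⟩⟩
    · intro e he
      rcases hl.old e he with ⟨g', hg', h1⟩ | h1
      · exact Or.inl ⟨g', List.mem_cons_of_mem _ hg', h1⟩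
      · exact Or.inr h1
    · intro Φ' hf' hk
      refine ⟨hf', by rw [← e1, hw], ?_⟩
      rw [sub_add_cancel]
      exact hl.stacked.congr fun g' hg' => hk _ (hl.column g' hg')
    · intro g' hg'
      exact (List.mem_cons.1 hg').imp_right (hl.column g')
  | @right σ g f ζ τ hgm h _ ih =>
    have hn' := hn
    rw [List.append_cons] at hn ⊢
    obtain ⟨z, hz, hz', hg, hw⟩ := hl.stacked.exists_of_mem hgm
    have hgξ := hl.column g hgm
    have hf : f.1 ∉ ξ.map Step.face := by
      simp only [List.map_append, List.map_cons, List.nodup_append] at hn'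
      exact fun hm => hn'.2.2 f.1 hm f.1 (by simp) rfl
    obtain ⟨e1, e2, e3⟩ := h.geometry P
    have hwp := P.faceWidth_pos g.1
    have hwf := P.faceWidth_pos f.1
    have hhf := P.faceHeight_pos f.1
    refine exists_agreeing hf (ih (hl.extend (x := xr) (y := z) (xl' := xr) (xr' := xr + P.faceWidth f.1)
      (yb' := z) (yt' := z + P.faceHeight f.1) (σ' := [f]) hgξ hf ?_ hl.lt.le rfl (by linarith)
      ?_ ?_ ?_ ?_ ?_ (by simp)) hn)
    · intro p hp
      rw [hg, h.place_agree P xl z hp.1 hp.2, hw]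
    · intro e he
      rw [Set.disjoint_left]
      intro p hp hp'
      exact absurd hp'.1.1 (not_lt.2 (hl.bound p (mem_biUnion he (interior_subset hp))).2)
    · intro x' hx'
      rcases hx'.1.lt_or_eq with h1 | rfl
      · exact Or.inl h1
      · exact Or.inr ⟨z, ⟨le_rfl, by linarith⟩, hl.mem_planarStrip hgm hg
          ⟨⟨by simp only; linarith, le_rfl⟩, le_rfl, by simp only; linarith⟩⟩
    · intro e he
      exact Or.inr fun p hp => (hl.bound p (mem_biUnion he hp)).2
    · intro Φ' hf' hk
      exact ⟨hf', rfl, rfl⟩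
    · intro g' hg'
      exact Or.inl (List.mem_singleton.1 hg')
  | @swap σ a b ζ τ h _ ih =>
    -- A layout depends on the set of steps and not on their order.
    have hp : (ξ ++ b :: a :: ζ).Perm (ξ ++ a :: b :: ζ) :=
      (List.Perm.swap a b ζ).append_left ξ
    obtain ⟨Φ', hk, xl', xr', yb', yt', h1⟩ := ih hl ((hp.map Step.face).nodup_iff.2 hn)
    exact ⟨Φ', hk, xl', xr', yb', yt', h1.perm hp⟩

/-- The vertical edge of a panel on its right (left) is placed on a vertical line. -/
theorem apply_segment_fst {g : Panel} {x y : ℝ} (a : Bool) {p : Fin 3 → ℝ}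
    (hp : p ∈ segment ℝ (P.point (g.corner a false)) (P.point (g.corner a true))) :
    ((P.place g x y).apply p).1 = x + if a then P.faceWidth g.1 else 0 := by
  rw [P.point_corner, P.point_corner, segment_eq_image'] at hp
  obtain ⟨θ, -, h⟩ := hp
  have e : p = P.base g + (if a then P.faceWidth g.1 else 0) • g.right +
      (θ * P.faceHeight g.1) • g.up := by
    rw [← h]
    simp [smul_smul]
  rw [e, place_apply]

theorem segment_subset_carrier (g : Panel) (a b a' b' : Bool) :
    segment ℝ (P.point (g.corner a b)) (P.point (g.corner a' b')) ⊆ P.carrier g.1 :=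
  (P.convex_carrier _).segment_subset (P.point_corner_mem g _ _) (P.point_corner_mem g _ _)

/-- A strip that unrolls column by column has a development without overlap that is monotone and
lies between the left edge of its first and the right edge of its last panel. -/
theorem exists_development {f₀ e : Panel} {ξ : Strip} {τ : List Panel}
    (h : Unrolls [f₀] ξ (τ ++ [e]))
    (hn : ((⟨none, f₀.1⟩ :: ξ : Strip).map Step.face).Nodup) :
    P.IsPiece (⟨none, f₀.1⟩ :: ξ) ∧ ∃ Φ : GridFace → Placement,
      P.IsDevelopment (⟨none, f₀.1⟩ :: ξ) Φ ∧
      (∀ f ∈ (⟨none, f₀.1⟩ :: ξ : Strip).map Step.face,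
        ∀ g ∈ (⟨none, f₀.1⟩ :: ξ : Strip).map Step.face, f ≠ g →
          Disjoint (interior (P.planarFace Φ f)) (interior (P.planarFace Φ g))) ∧
      (∀ x : ℝ, IsPreconnected {p ∈ P.planarStrip (⟨none, f₀.1⟩ :: ξ) Φ | p.1 = x}) ∧
      ∃ x₁ x₂ : ℝ, x₁ < x₂ ∧
        (∀ p ∈ segment ℝ (P.point (f₀.corner false false)) (P.point (f₀.corner false true)),
          ((Φ f₀.1).apply p).1 = x₁) ∧
        e.1 ∈ (⟨none, f₀.1⟩ :: ξ : Strip).map Step.face ∧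
        (∀ p ∈ segment ℝ (P.point (e.corner true false)) (P.point (e.corner true true)),
          ((Φ e.1).apply p).1 = x₂) ∧
        ∀ p ∈ P.planarStrip (⟨none, f₀.1⟩ :: ξ) Φ, x₁ ≤ p.1 ∧ p.1 ≤ x₂ := by
  refine ⟨(Unrolls.hinged (P := P) h (seen := [f₀.1]) (by simp)).isPiece hn, ?_⟩
  have hw := P.faceWidth_pos f₀.1
  have hrect : P.planarFace (fun _ => P.place f₀ 0 0) f₀.1 =
      Icc 0 (P.faceWidth f₀.1) ×ˢ Icc 0 (P.faceHeight f₀.1) := by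
    rw [planarFace_eq (g := f₀) rfl, zero_add, zero_add]
  have hstrip : P.planarStrip [⟨none, f₀.1⟩] (fun _ => P.place f₀ 0 0) =
      Icc 0 (P.faceWidth f₀.1) ×ˢ Icc 0 (P.faceHeight f₀.1) := by
    simp [planarStrip, hrect]
  have h0 : P.Layout 0 [⟨none, f₀.1⟩] (fun _ => P.place f₀ 0 0) [f₀] 0 (P.faceWidth f₀.1) 0
      (P.faceHeight f₀.1) := by
    refine ⟨?_, ?_, ?_, ?_, ?_, ?_, ⟨rfl, zero_add _, zero_add _⟩, by simp, hw⟩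
    · intro s hs
      rw [List.mem_singleton] at hs
      subst hs
      exact ⟨P.laysFlat_place f₀ 0 0, by simp⟩
    · simp
    · simp
    · intro x
      rw [hstrip]
      refine (Convex.inter ((convex_Icc _ _).prod (convex_Icc _ _)) ?_).isPreconnected
      exact convex_hyperplane (f := fun p : ℝ × ℝ => p.1) ⟨fun _ _ => rfl, fun _ _ => rfl⟩ x
    · intro p hp
      rw [hstrip] at hp
      exact hp.1
    · intro f hf
      rw [List.map_singleton, List.mem_singleton] at hf
      exact Or.inl ⟨f₀, by simp, hf.symm⟩
  obtain ⟨Φ, hk, xl, xr, yb, yt, hL⟩ := h0.exists_of_unrolls h hn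
  obtain ⟨z, -, hz, hz', -⟩ := Stacked.append_singleton.1 hL.stacked
  refine ⟨Φ, hL.dev, hL.disj, hL.mono, 0, xr, hL.lt, ?_, hL.column e (by simp), ?_, hL.bound⟩
  · intro p hp
    rw [hk f₀.1 (by simp), apply_segment_fst false hp]
    simp
  · intro p hp
    rw [hz, apply_segment_fst true hp]
    simpa using hz'

end SingleLayerMT
end ManhattanTower

/-! ### Panels of a call, read in its frame -/

namespace ManhattanTower

open Matrix

namespace Panel

/-- The panel turned by a half-turn. -/
def flip (g : Panel) : Panel := (g.1, !g.2)

theorem corner_flip (g : Panel) (a b : Bool) : g.flip.corner a b = g.corner (!a) (!b) :=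
  g.1.corner_not g.2 a b

theorem up_flip (g : Panel) : g.flip.up = -g.up := by
  obtain ⟨f | f | f, τ⟩ := g <;> cases τ <;> simp [flip, up, sign]

theorem right_flip (g : Panel) : g.flip.right = -g.right := by
  obtain ⟨⟨f, k, l⟩ | ⟨f, k, l⟩ | ⟨f, k, l⟩, τ⟩ := g <;> cases τ <;> cases f <;>
    simp [flip, right, sign]

end Panel

/-- Half-turns exchange above with below and left with right; this yields all adjacencies of the
backward spiral from those of the forward spiral. -/
theorem UpAdj.flip {g f : Panel} (h : UpAdj g f) : UpAdj f.flip g.flip := by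
  refine ⟨?_, ?_, ?_⟩
  · rw [Panel.corner_flip, Panel.corner_flip]
    exact h.right.symm
  · rw [Panel.corner_flip, Panel.corner_flip]
    exact h.left.symm
  · rw [Panel.up_flip, Panel.up_flip, neg_dotProduct_neg, dotProduct_comm]
    exact h.noFold

theorem RightAdj.flip {g f : Panel} (h : RightAdj g f) : RightAdj f.flip g.flip := by
  refine ⟨?_, ?_, ?_⟩
  · rw [Panel.corner_flip, Panel.corner_flip]
    exact h.upper.symm
  · rw [Panel.corner_flip, Panel.corner_flip]
    exact h.lower.symm
  · rw [Panel.right_flip, Panel.right_flip, neg_dotProduct_neg, dotProduct_comm]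
    exact h.noFold

namespace Call

variable (c : Call)

/-- The refined `y`-plane between rows `q - 1` and `q`. -/
def rowPlane (q : ℕ) : ℕ := 5 * c.box.slab + if c.reversed then 5 - q else q

/-- The vertex on boundary `i` between rows `q - 1` and `q`. -/
def vertex (i q : ℕ) : Vertex :=
  if i % c.girth ≤ c.width then (c.plane (i % c.girth), c.rowPlane q, !c.inverted)
  else (c.plane (2 * c.width + 1 - i % c.girth), c.rowPlane q, c.inverted)

/-- The panel of a gridface of the support faces, placed with the front below (`forward`), or with
the front above. -/
def panel (i q : ℕ) (forward : Bool) : Panel := (c.support i q, forward != c.reversed)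

/-- The panel of a gridface of the front face, placed below the gridface of column `i`. -/
def frontPanel (i : ℕ) : Panel := (c.front i, c.onBottom i == c.inverted)

/-- The panel of a gridface of the back face, placed below the gridface of column `i`. -/
def backPanel (i : ℕ) : Panel := (c.back i, c.onBottom i == c.inverted)

/-- Column `i` belongs to the top or the bottom. -/
def Horizontal (i : ℕ) : Prop :=
  i % c.girth < c.width ∨ c.width < i % c.girth ∧ i % c.girth ≤ 2 * c.width

theorem flip_panel (i q : ℕ) (forward : Bool) :
    (c.panel i q forward).flip = c.panel i q (!forward) := by
  cases forward <;> simp [panel, Panel.flip]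

theorem mod_girth_lt (i : ℕ) : i % c.girth < 2 * c.width + 2 := Nat.mod_lt _ (Nat.succ_pos _)

theorem succ_mod_girth (i : ℕ) : (i + 1) % c.girth = i % c.girth + 1 ∧ i % c.girth < 2 * c.width + 1 ∨
    (i + 1) % c.girth = 0 ∧ i % c.girth = 2 * c.width + 1 := by
  have h := c.mod_girth_lt i
  rw [← Nat.mod_add_mod]
  by_cases h1 : i % c.girth = 2 * c.width + 1
  · right
    rw [h1]
    exact ⟨Nat.mod_self _, rfl⟩
  · left
    have h2 : i % c.girth < 2 * c.width + 1 := by omega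
    exact ⟨Nat.mod_eq_of_lt (show i % c.girth + 1 < 2 * c.width + 2 by omega), h2⟩

theorem support_add_girth (i q : ℕ) : c.support (i + c.girth) q = c.support i q := by
  simp [support]

theorem panel_add_girth (i q : ℕ) (fwd : Bool) : c.panel (i + c.girth) q fwd = c.panel i q fwd := by
  simp [panel, support_add_girth]

theorem vertex_add_girth (i q : ℕ) : c.vertex (i + c.girth) q = c.vertex i q := by
  simp [vertex]

variable {c}

/-- The numbering of columns and rows is uniform on all four sides and in all frames, which is
checked by cases. After this, adjacency of support gridfaces is arithmetic with boundary numbers. -/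
theorem corner_support (hw : c.box.lo < c.box.hi) (i : ℕ) {q : ℕ} (hq : q ≤ 4) (a b : Bool) :
    (c.support i q).corner (!c.reversed) a b = c.vertex (i + a.toNat) (q + b.toNat) := by
  have hm := c.mod_girth_lt i
  have hs := c.succ_mod_girth i
  have hW : c.width = 4 * (c.box.hi - c.box.lo) := rfl
  obtain ⟨⟨slab, lo, hi⟩, par, rev, inv, s, st, t⟩ := c
  simp only [support, vertex, interval, plane, row, rowPlane, mirrored] at *
  generalize hn : (⟨⟨slab, lo, hi⟩, par, rev, inv, s, st, t⟩ : Call).girth = n at *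
  generalize hwg : (⟨⟨slab, lo, hi⟩, par, rev, inv, s, st, t⟩ : Call).width = W at *
  generalize hmg : i % n = m at *
  clear hn hwg
  rcases Nat.lt_trichotomy m W with h1 | h1 | h1
  · have hs1 : (i + 1) % n = m + 1 := by omega
    have h2 : m ≤ W := by omega
    have h3 : m + 1 ≤ W := by omega
    cases rev <;> cases inv <;> cases a <;> cases b <;>
      simp [GridFace.corner, hs1, h1, h2, h3, hmg] <;> omega
  · have hs1 : (i + 1) % n = m + 1 := by omega
    have h2 : m ≤ W := by omega
    have h3 : ¬ m + 1 ≤ W := by omega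
    have h4 : ¬ m < W := by omega
    cases rev <;> cases inv <;> cases a <;> cases b <;>
      simp [GridFace.corner, hs1, h1, hmg] <;> omega
  · have h2 : ¬ m ≤ W := by omega
    have h4 : ¬ m < W := by omega
    have h5 : ¬ m = W := by omega
    by_cases h6 : m ≤ 2 * W
    · have hs1 : (i + 1) % n = m + 1 := by omega
      have h3 : ¬ m + 1 ≤ W := by omega
      cases rev <;> cases inv <;> cases a <;> cases b <;>
        simp [GridFace.corner, hs1, h2, h3, h4, h5, h6, hmg] <;> omega
    · have hs1 : (i + 1) % n = 0 := by omega
      cases rev <;> cases inv <;> cases a <;> cases b <;>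
        simp [GridFace.corner, hs1, h2, h4, h5, h6, hmg] <;> omega

theorem corner_panel (hw : c.box.lo < c.box.hi) (i : ℕ) {q : ℕ} (hq : q ≤ 4) (a b : Bool) :
    (c.panel i q true).corner a b = c.vertex (i + a.toNat) (q + b.toNat) := by
  have := corner_support hw i hq a b
  rwa [show (!c.reversed) = (true != c.reversed) by simp] at this

theorem corner_panel_backward (hw : c.box.lo < c.box.hi) (i : ℕ) {q : ℕ} (hq : q ≤ 4)
    (a b : Bool) :
    (c.panel i q false).corner a b = c.vertex (i + (!a).toNat) (q + (!b).toNat) := by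
  rw [← corner_panel hw i hq, ← Panel.corner_flip, flip_panel]
  rfl

theorem up_panel (i q : ℕ) (fwd : Bool) :
    (c.panel i q fwd).up = ![0, sign (fwd != c.reversed), 0] := by
  unfold panel support
  split_ifs <;> rfl

theorem right_panel (i q : ℕ) : (c.panel i q true).right =
    if i % c.girth < c.width then ![sign (!c.mirrored), 0, 0]
    else if i % c.girth = c.width then ![0, 0, sign c.inverted]
    else if i % c.girth ≤ 2 * c.width then ![sign c.mirrored, 0, 0]
    else ![0, 0, sign (!c.inverted)] := by
  unfold panel support mirrored
  cases c.reversed <;> cases c.inverted <;> split_ifs <;> rfl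

theorem sign_mul_self (a : Bool) : sign a * sign a = 1 := by cases a <;> simp [sign]

theorem upAdj_panel (hw : c.box.lo < c.box.hi) (i : ℕ) {q : ℕ} (hq : q ≤ 3) :
    UpAdj (c.panel i q true) (c.panel i (q + 1) true) := by
  refine ⟨?_, ?_, ?_⟩
  · rw [corner_panel hw i (by omega), corner_panel hw i (by omega)]
    rfl
  · rw [corner_panel hw i (by omega), corner_panel hw i (by omega)]
    rfl
  · rw [up_panel, up_panel]
    simp [sign_mul_self]

theorem upAdj_panel_backward (hw : c.box.lo < c.box.hi) (i : ℕ) {q : ℕ} (hq : q ≤ 3) :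
    UpAdj (c.panel i (q + 1) false) (c.panel i q false) := by
  have := (upAdj_panel hw i hq).flip
  rwa [flip_panel, flip_panel] at this

/-- Consecutive columns lie in one plane or meet at a right angle: as the width is positive, a
column of the top or bottom always comes between the right and the left face. -/
theorem rightAdj_panel (hw : c.box.lo < c.box.hi) (i : ℕ) {q : ℕ} (hq : q ≤ 4) :
    RightAdj (c.panel i q true) (c.panel (i + 1) q true) := by
  refine ⟨?_, ?_, ?_⟩
  · rw [corner_panel hw i hq, corner_panel hw _ hq]
    rfl
  · rw [corner_panel hw i hq, corner_panel hw _ hq]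
    rfl
  · rw [right_panel, right_panel]
    have h1 := c.succ_mod_girth i
    have hW : c.width = 4 * (c.box.hi - c.box.lo) := rfl
    split_ifs <;> first | omega | simp [sign_mul_self]

theorem rightAdj_panel_backward (hw : c.box.lo < c.box.hi) (i : ℕ) {q : ℕ} (hq : q ≤ 4) :
    RightAdj (c.panel (i + 1) q false) (c.panel i q false) := by
  have := (rightAdj_panel hw i hq).flip
  rwa [flip_panel, flip_panel] at this

theorem opposite_mod (i : ℕ) : c.opposite i % c.girth = c.opposite i :=
  Nat.mod_eq_of_lt (lt_of_le_of_lt (Nat.sub_le _ _) (by unfold girth; omega))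

theorem place_of_top {i : ℕ} (h : i % c.girth < c.width) :
    c.place i = some (i % c.girth) ∧ c.onBottom i = false := by
  simp [place, onBottom, h, h.le]

theorem place_of_bottom {i : ℕ} (h : c.width < i % c.girth) (h' : i % c.girth ≤ 2 * c.width) :
    c.place i = some (2 * c.width - i % c.girth) ∧ c.onBottom i = true := by
  simp [place, onBottom, h, h', h.not_gt, h.ne']

/-- The upper edge of the front panel is the front edge of column `i`; its lower edge is that of the
opposite column. The latter is traversed the other way in the clockwise numbering, hence the
negation. -/
theorem corner_front {i : ℕ} (h : c.Horizontal i) (a : Bool) :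
    (c.frontPanel i).corner a true = c.vertex (i + a.toNat) 0 ∧
    (c.frontPanel i).corner a false = c.vertex (c.opposite i + (!a).toNat) 0 := by
  have ho := c.opposite_mod i
  have hs := c.succ_mod_girth i
  have hs' := c.succ_mod_girth (c.opposite i)
  have hW : c.width = 4 * (c.box.hi - c.box.lo) := rfl
  rw [ho] at hs'
  unfold Call.opposite at *
  rcases h with h1 | ⟨h1, h2⟩
  · have hp := place_of_top h1
    simp only [Panel.corner, frontPanel, front, hp.1, hp.2, vertex, interval, plane, rowPlane, mirrored,
      Option.getD_some]
    generalize c.girth = n at *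
    generalize c.width = W at *
    generalize hmg : i % n = m at *
    have hs1 : (i + 1) % n = m + 1 := by omega
    have hs2 : (2 * W - m + 1) % n = 2 * W - m + 1 := by omega
    have h2 : m ≤ W := by omega
    have h3 : m + 1 ≤ W := by omega
    have h5 : ¬ (2 * W - m ≤ W) := by omega
    have h6 : ¬ (2 * W - m + 1 ≤ W) := by omega
    clear hp
    obtain ⟨⟨slab, lo, hi⟩, par, rev, inv, s, st, t⟩ := c
    simp only at *
    cases rev <;> cases inv <;> cases a <;>
      simp [GridFace.corner, hs1, hs2, h2, h3, h5, h6, hmg, ho] <;> omega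
  · have hp := place_of_bottom h1 h2
    simp only [Panel.corner, frontPanel, front, hp.1, hp.2, vertex, interval, plane, rowPlane, mirrored,
      Option.getD_some]
    generalize c.girth = n at *
    generalize c.width = W at *
    generalize hmg : i % n = m at *
    have hs1 : (i + 1) % n = m + 1 := by omega
    have hs2 : (2 * W - m + 1) % n = 2 * W - m + 1 := by omega
    have h3 : ¬ m + 1 ≤ W := by omega
    have h4 : ¬ m ≤ W := by omega
    have h5 : 2 * W - m ≤ W := by omega
    have h6 : 2 * W - m + 1 ≤ W := by omega
    clear hp
    obtain ⟨⟨slab, lo, hi⟩, par, rev, inv, s, st, t⟩ := c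
    simp only at *
    cases rev <;> cases inv <;> cases a <;>
      simp [GridFace.corner, hs1, hs2, h3, h4, h5, h6, hmg, ho] <;> omega

/-- The back panel carries the turned gridface of column `i`, so left and right are exchanged in
comparison with `corner_front`. -/
theorem corner_back {i : ℕ} (h : c.Horizontal i) (a : Bool) :
    (c.backPanel i).corner a true = c.vertex (i + (!a).toNat) 5 ∧
    (c.backPanel i).corner a false = c.vertex (c.opposite i + a.toNat) 5 := by
  have ho := c.opposite_mod i
  have hs := c.succ_mod_girth i
  have hs' := c.succ_mod_girth (c.opposite i)
  have hW : c.width = 4 * (c.box.hi - c.box.lo) := rfl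
  rw [ho] at hs'
  unfold Call.opposite at *
  rcases h with h1 | ⟨h1, h2⟩
  · have hp := place_of_top h1
    simp only [Panel.corner, backPanel, back, hp.1, hp.2, vertex, interval, plane, rowPlane, mirrored,
      Option.getD_some]
    generalize c.girth = n at *
    generalize c.width = W at *
    generalize hmg : i % n = m at *
    have hs1 : (i + 1) % n = m + 1 := by omega
    have hs2 : (2 * W - m + 1) % n = 2 * W - m + 1 := by omega
    have h2 : m ≤ W := by omega
    have h3 : m + 1 ≤ W := by omega
    have h5 : ¬ (2 * W - m ≤ W) := by omega
    have h6 : ¬ (2 * W - m + 1 ≤ W) := by omega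
    clear hp
    obtain ⟨⟨slab, lo, hi⟩, par, rev, inv, s, st, t⟩ := c
    simp only at *
    cases rev <;> cases inv <;> cases a <;>
      simp [GridFace.corner, hs1, hs2, h2, h3, h5, h6, hmg, ho] <;> omega
  · have hp := place_of_bottom h1 h2
    simp only [Panel.corner, backPanel, back, hp.1, hp.2, vertex, interval, plane, rowPlane, mirrored,
      Option.getD_some]
    generalize c.girth = n at *
    generalize c.width = W at *
    generalize hmg : i % n = m at *
    have hs1 : (i + 1) % n = m + 1 := by omega
    have hs2 : (2 * W - m + 1) % n = 2 * W - m + 1 := by omega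
    have h3 : ¬ m + 1 ≤ W := by omega
    have h4 : ¬ m ≤ W := by omega
    have h5 : 2 * W - m ≤ W := by omega
    have h6 : 2 * W - m + 1 ≤ W := by omega
    clear hp
    obtain ⟨⟨slab, lo, hi⟩, par, rev, inv, s, st, t⟩ := c
    simp only at *
    cases rev <;> cases inv <;> cases a <;>
      simp [GridFace.corner, hs1, hs2, h3, h4, h5, h6, hmg, ho] <;> omega

theorem up_front (i : ℕ) : (c.frontPanel i).up = ![0, 0, sign (c.onBottom i == c.inverted)] := rfl

theorem up_back (i : ℕ) : (c.backPanel i).up = ![0, 0, sign (c.onBottom i == c.inverted)] := rfl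

theorem upAdj_front (hw : c.box.lo < c.box.hi) {i : ℕ} (h : c.Horizontal i) :
    UpAdj (c.frontPanel i) (c.panel i 0 true) := by
  refine ⟨?_, ?_, ?_⟩
  · rw [corner_panel hw i (by omega), (corner_front h _).1]
    rfl
  · rw [corner_panel hw i (by omega), (corner_front h _).1]
    rfl
  · rw [up_panel, up_front]
    simp

theorem upAdj_opposite_front (hw : c.box.lo < c.box.hi) {i : ℕ} (h : c.Horizontal i) :
    UpAdj (c.panel (c.opposite i) 0 false) (c.frontPanel i) := by
  refine ⟨?_, ?_, ?_⟩
  · rw [corner_panel_backward hw _ (by omega), (corner_front h _).2]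
    rfl
  · rw [corner_panel_backward hw _ (by omega), (corner_front h _).2]
    rfl
  · rw [up_panel, up_front]
    simp

theorem upAdj_back (hw : c.box.lo < c.box.hi) {i : ℕ} (h : c.Horizontal i) :
    UpAdj (c.backPanel i) (c.panel i 4 false) := by
  refine ⟨?_, ?_, ?_⟩
  · rw [corner_panel_backward hw i (by omega), (corner_back h _).1]
    rfl
  · rw [corner_panel_backward hw i (by omega), (corner_back h _).1]
    rfl
  · rw [up_panel, up_back]
    simp

theorem upAdj_opposite_back (hw : c.box.lo < c.box.hi) {i : ℕ} (h : c.Horizontal i) :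
    UpAdj (c.panel (c.opposite i) 4 true) (c.backPanel i) := by
  refine ⟨?_, ?_, ?_⟩
  · rw [corner_panel hw _ (by omega), (corner_back h _).2]
    rfl
  · rw [corner_panel hw _ (by omega), (corner_back h _).2]
    rfl
  · rw [up_panel, up_back]
    simp

end Call
end ManhattanTower

/-! ### Valid calls, and where front children are met -/

namespace ManhattanTower

namespace Call

variable (c : Call) (cells : Finset (ℕ × ℕ))

/-- The grid interval at place `m`, counted from the left. -/
def cell (m : ℕ) : ℕ := if c.mirrored then c.box.hi - 1 - m else c.box.lo + m

/-- The box that adjoins the box of the call along grid interval `m`, in the next slab (`up`) or in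
the slab before. -/
def adjacentBox (up : Bool) (m : ℕ) : Option Box :=
  if up then boxAt cells (c.cell m) (c.box.slab + 1)
  else if c.box.slab = 0 then none
  else boxAt cells (c.cell m) (c.box.slab - 1)

variable {c cells}

theorem adjacentBox_eq_some_iff {up : Bool} {m : ℕ} {b : Box} :
    c.adjacentBox cells up m = some b ↔ IsBox cells b ∧
      (if up then b.slab = c.box.slab + 1 else b.slab + 1 = c.box.slab) ∧
      b.lo ≤ c.cell m ∧ c.cell m < b.hi := by
  unfold adjacentBox
  cases up
  · simp only [Bool.false_eq_true, if_false]
    split_ifs with h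
    · simp only [false_iff]
      rintro ⟨-, h1, -⟩
      omega
    · rw [boxAt_eq_some_iff]
      refine and_congr_right fun _ => and_congr_left fun _ => ?_
      omega
  · simp [boxAt_eq_some_iff]

theorem width_eq : c.width = 4 * (c.box.hi - c.box.lo) := rfl

theorem cell_eq {m : ℕ} (hm : 4 * m < c.width) :
    (c.mirrored = false ∧ c.cell m = c.box.lo + m) ∨
      (c.mirrored = true ∧ c.cell m + m + 1 = c.box.hi) := by
  have := c.width_eq
  unfold cell
  cases c.mirrored <;> simp <;> omega

/-- Distinct boxes of a slab leave a missing cell between them. Hence where a child ends within the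
width of the box, the next grid interval is free. -/
theorem adjacentBox_succ {up : Bool} {m : ℕ} {b b' : Box} (hm : 4 * (m + 1) < c.width)
    (h : c.adjacentBox cells up m = some b) (h' : c.adjacentBox cells up (m + 1) = some b') :
    b = b' := by
  rw [adjacentBox_eq_some_iff] at h h'
  have hs : b.slab = b'.slab := by
    have h1 := h.2.1
    have h2 := h'.2.1
    cases up <;> simp at h1 h2 <;> omega
  have e1 := c.cell_eq hm
  have e2 := c.cell_eq (m := m) (by omega)
  rcases h.1.separated h'.1 hs with h1 | h1 | h1
  · exact h1
  · rcases e1 with e1 | e1 <;> rcases e2 with e2 | e2 <;> simp [e1.1] at e2 <;> omega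
  · rcases e1 with e1 | e1 <;> rcases e2 with e2 | e2 <;> simp [e1.1] at e2 <;> omega

theorem interval_div {j : ℕ} (hj : j < c.width) : c.interval j / 4 = c.cell (j / 4) := by
  have := c.width_eq
  unfold interval cell
  split_ifs <;> omega

theorem frontNeighbor_eq {i j : ℕ} (h : c.place i = some j) (hj : j < c.width) :
    c.frontNeighbor cells i = c.adjacentBox cells c.reversed (j / 4) := by
  unfold frontNeighbor adjacentBox
  rw [h, Option.bind_some, interval_div hj]

theorem backNeighbor_eq {i j : ℕ} (h : c.place i = some j) (hj : j < c.width) :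
    c.backNeighbor cells i = c.adjacentBox cells (!c.reversed) (j / 4) := by
  unfold backNeighbor adjacentBox
  rw [h, Option.bind_some, interval_div hj]
  cases c.reversed <;> simp

theorem mod_of_lt {i : ℕ} (h : i < c.girth) : i % c.girth = i := Nat.mod_eq_of_lt h

theorem mod_of_ge {i : ℕ} (h : c.girth ≤ i) (h' : i < 2 * c.girth) :
    i % c.girth = i - c.girth := by
  rw [Nat.mod_eq_sub_mod h, Nat.mod_eq_of_lt (by omega)]

theorem girth_eq : c.girth = 2 * c.width + 2 := rfl

/-- The place of a column in the first or second turn around the box. -/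
theorem place_eq_some {i j : ℕ} (h : i < 2 * c.girth) : c.place i = some j ↔
    (i = j ∧ j < c.width) ∨ (i + j = 2 * c.width ∧ j < c.width) ∨
      (i = c.girth + j ∧ j < c.width) ∨ (i + j = c.girth + 2 * c.width ∧ j < c.width) := by
  have hg := c.girth_eq
  unfold place
  rcases Nat.lt_or_ge i c.girth with h1 | h1
  · rw [mod_of_lt h1]
    split_ifs <;> simp <;> omega
  · rw [mod_of_ge h1 h]
    split_ifs <;> simp <;> omega

theorem onBottom_eq {i : ℕ} (h : i < 2 * c.girth) : c.onBottom i = true ↔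
    (c.width < i ∧ i < c.girth) ∨ c.girth + c.width < i := by
  have hg := c.girth_eq
  unfold onBottom
  rcases Nat.lt_or_ge i c.girth with h1 | h1
  · rw [mod_of_lt h1]
    simp
    omega
  · rw [mod_of_ge h1 h]
    simp
    omega

theorem frontChild_eq_some {i : ℕ} (hi : i < 2 * c.girth) {b : Box} :
    c.frontChild cells i = some b ↔
      ∃ j, c.place i = some j ∧ c.adjacentBox cells c.reversed (j / 4) = some b ∧
        some b ≠ c.parent := by
  unfold frontChild
  rw [Option.filter_eq_some_iff]
  constructor
  · rintro ⟨h1, h2⟩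
    cases hp : c.place i with
    | none => simp [frontNeighbor, hp] at h1
    | some j =>
      have hj : j < c.width := by
        have := (place_eq_some hi).1 hp
        omega
      rw [frontNeighbor_eq hp hj] at h1
      exact ⟨j, rfl, h1, by simpa using h2⟩
  · rintro ⟨j, hp, h1, h2⟩
    have hj : j < c.width := by
      have := (place_eq_some hi).1 hp
      omega
    rw [frontNeighbor_eq hp hj]
    exact ⟨h1, by simpa using h2⟩

theorem backChild_eq_some' {i : ℕ} (hi : i < 2 * c.girth) {b : Box} :
    c.backChild cells i = some b ↔
      ∃ j, c.place i = some j ∧ c.adjacentBox cells (!c.reversed) (j / 4) = some b ∧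
        some b ≠ c.parent := by
  unfold backChild
  rw [Option.filter_eq_some_iff]
  constructor
  · rintro ⟨h1, h2⟩
    cases hp : c.place i with
    | none => simp [backNeighbor, hp] at h1
    | some j =>
      have hj : j < c.width := by
        have := (place_eq_some hi).1 hp
        omega
      rw [backNeighbor_eq hp hj] at h1
      exact ⟨j, rfl, h1, by simpa using h2⟩
  · rintro ⟨j, hp, h1, h2⟩
    have hj : j < c.width := by
      have := (place_eq_some hi).1 hp
      omega
    rw [backNeighbor_eq hp hj]
    exact ⟨h1, by simpa using h2⟩

variable (cells c)

/-- The calls that the algorithm makes. Either `c` is the call for a root box, or a child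
sutured in the same direction as its parent, or one sutured in the reverse direction. -/
structure Valid : Prop where
  isBox : IsBox cells c.box
  kind :
    (c.parent = none ∧ c.sTop = true ∧ (∀ m, c.adjacentBox cells c.reversed m = none) ∧
      c.s ≤ c.width ∧ c.t ≤ c.width ∧ (c.s = c.t + 1 ∨ c.t = c.s + 1)) ∨
    ∃ p, c.parent = some p ∧ c.adjacentBox cells c.reversed (c.t / 4) = some p ∧
      ((c.sTop = false ∧ c.s + 1 = c.width ∧ c.t + 1 = c.width) ∨
        (c.sTop = true ∧ c.s = c.t + 1 ∧ c.t + 2 ≤ c.width ∧ (c.t + 1) / 4 = c.t / 4))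

variable {cells c}

theorem Valid.width_ge (h : c.Valid cells) : ∃ w, c.width = 4 * w ∧ 1 ≤ w :=
  ⟨_, c.width_eq, by have := h.isBox.1; omega⟩

theorem Valid.t_le (h : c.Valid cells) : c.t ≤ c.width := by
  rcases h.kind with h | ⟨p, -, -, h | h⟩ <;> omega

/-- At the root both orders of `s` and `t` occur: the front spiral omits only column `t`, or
consists of the single column before `t`. For a child, the grid interval at `t` always adjoins the
parent. -/
theorem Valid.start_cases (h : c.Valid cells) :
    (c.parent = none ∧ (∀ m, c.adjacentBox cells c.reversed m = none) ∧
      (c.start = c.t + 1 ∧ c.t < c.width ∨ c.start + 1 = c.girth + c.t ∧ 1 ≤ c.t)) ∨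
    ∃ p, c.parent = some p ∧ c.adjacentBox cells c.reversed (c.t / 4) = some p ∧
      ((c.start = c.width + 2 ∧ c.t + 1 = c.width) ∨
        (c.start = c.t + 1 ∧ c.t + 2 ≤ c.width ∧ (c.t + 1) / 4 = c.t / 4)) := by
  have hg := c.girth_eq
  obtain ⟨w, hw, hw'⟩ := h.width_ge
  rcases h.kind with ⟨h1, h2, h3, h4, h5, h6⟩ | ⟨p, h1, h2, ⟨h3, h4, h5⟩ | ⟨h3, h4, h5, h6⟩⟩
  · refine Or.inl ⟨h1, h3, ?_⟩
    unfold start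
    simp only [h2, if_true]
    split_ifs <;> omega
  · refine Or.inr ⟨p, h1, h2, Or.inl ?_⟩
    unfold start
    simp only [h3, Bool.false_eq_true, if_false]
    omega
  · refine Or.inr ⟨p, h1, h2, Or.inr ?_⟩
    unfold start
    simp only [h3, if_true]
    rw [if_pos (by omega)]
    omega

/-- The bounds on the start of a call. -/
theorem Valid.start_bounds (h : c.Valid cells) : c.t < c.start ∧ c.start < c.girth + c.t := by
  have hg := c.girth_eq
  obtain ⟨w, hw, hw'⟩ := h.width_ge
  rcases h.start_cases with ⟨-, -, h⟩ | ⟨p, -, -, h⟩ <;> omega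

theorem frontSuture_eq_some {i : ℕ} {d : Call} : c.frontSuture cells i = some d ↔
    ∃ b, c.frontChild cells i = some b ∧
      (∀ q, c.start ≤ q → q < i → c.frontChild cells q ≠ some b) ∧
      d = c.sameDirectionCall b true (c.onBottom i) := by
  unfold frontSuture
  rw [Option.bind_eq_some_iff]
  refine exists_congr fun b => and_congr_right fun _ => ?_
  split_ifs with h
  · simp only [false_iff, not_and]
    intro h'
    obtain ⟨q, hq, h1⟩ := h
    rw [Finset.mem_Ico] at hq
    exact absurd h1 (h' q hq.1 hq.2)
  · rw [Option.some_inj]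
    constructor
    · rintro rfl
      exact ⟨fun q h1 h2 h3 => h ⟨q, Finset.mem_Ico.2 ⟨h1, h2⟩, h3⟩, rfl⟩
    · rintro ⟨-, rfl⟩
      rfl

/-- A front child is first met at its right end on the bottom, or at its left end on the top. -/
theorem Valid.frontSuture_cases (h : c.Valid cells) {i : ℕ} (hi : c.start ≤ i)
    (hi' : i < c.girth + c.t) {d : Call} (hd : c.frontSuture cells i = some d) :
    ∃ b, c.frontChild cells i = some b ∧ d = c.sameDirectionCall b true (c.onBottom i) ∧
    ((∃ ρ, i + 4 * ρ = 2 * c.width + 1 ∧ 1 ≤ ρ ∧ 4 * ρ + 4 ≤ c.t ∧ c.onBottom i = true ∧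
        c.adjacentBox cells c.reversed (ρ - 1) = some b ∧
        c.adjacentBox cells c.reversed ρ = none) ∨
      (∃ l, i = 4 * l ∧ c.t + 5 ≤ 4 * l ∧ 4 * l < c.width ∧ c.onBottom i = false ∧
        c.start = c.t + 1 ∧ c.adjacentBox cells c.reversed l = some b ∧
        c.adjacentBox cells c.reversed (l - 1) = none)) := by
  have hg := c.girth_eq
  have ht := h.t_le
  obtain ⟨w, hw, hw'⟩ := h.width_ge
  obtain ⟨b, hb, hmin, rfl⟩ := frontSuture_eq_some.1 hd
  refine ⟨b, hb, rfl, ?_⟩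
  have hi2 : i < 2 * c.girth := by omega
  obtain ⟨j, hj, hbj, hbp⟩ := (frontChild_eq_some hi2).1 hb
  have hmin' : ∀ q k, c.start ≤ q → q < i → c.place q = some k →
      c.adjacentBox cells c.reversed (k / 4) ≠ some b := fun q k h1 h2 h3 h4 =>
    hmin q h1 h2 ((frontChild_eq_some (by omega)).2 ⟨k, h3, h4, hbp⟩)
  -- Nothing adjoins the front face of the root.
  rcases h.start_cases with ⟨-, h2, -⟩ | ⟨p, hp, hpt, hst⟩
  · rw [h2] at hbj
    simp at hbj
  have hbp' : b ≠ p := fun e => hbp (by rw [e, hp])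
  have hnt : j / 4 ≠ c.t / 4 := by
    intro e
    rw [e, hpt] at hbj
    exact hbp' (Option.some.inj hbj).symm
  rcases (place_eq_some hi2).1 hj with ⟨rfl, hjw⟩ | ⟨hij, hjw⟩ | ⟨rfl, hjw⟩ | ⟨hij, hjw⟩
  · right
    have hst' : c.start = c.t + 1 := by omega
    have htop : c.onBottom i = false := by
      rw [← Bool.not_eq_true, onBottom_eq hi2]
      omega
    -- The column before `i` is either column `t`, which adjoins the parent, or an earlier column of
    -- the spiral. So `b` begins at column `i`, on a grid line, and the interval before it is free.
    have hprev : c.adjacentBox cells c.reversed ((i - 1) / 4) ≠ some b := by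
      by_cases e : i = c.start
      · rw [show i - 1 = c.t by omega, hpt]
        exact fun e => hbp' (Option.some.inj e).symm
      · exact hmin' (i - 1) (i - 1) (by omega) (by omega)
          ((place_eq_some (by omega)).2 (Or.inl ⟨rfl, by omega⟩))
    have hi4 : i = 4 * (i / 4) := by
      by_contra hne
      rw [show (i - 1) / 4 = i / 4 by omega] at hprev
      exact hprev hbj
    rw [show (i - 1) / 4 = i / 4 - 1 by omega] at hprev
    have hnone : c.adjacentBox cells c.reversed (i / 4 - 1) = none := by
      cases e : c.adjacentBox cells c.reversed (i / 4 - 1) with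
      | none => rfl
      | some b' =>
        have := adjacentBox_succ (m := i / 4 - 1) (by omega) e
          (by rwa [show i / 4 - 1 + 1 = i / 4 by omega])
        rw [e, this] at hprev
        exact absurd rfl hprev
    -- The free interval is not that of `t`, so it lies between the parent and the child. This is
    -- the source of the 5 in the bound.
    have hlt : c.t / 4 ≠ i / 4 - 1 := by
      intro e
      rw [← e, hpt] at hnone
      simp at hnone
    exact ⟨i / 4, hi4, by omega, by omega, htop, hst', hbj, hnone⟩
  · left
    have hbot : c.onBottom i = true := by
      rw [onBottom_eq hi2]
      omega
    have hstart : c.start < i := by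
      rcases hst with hst | hst
      · by_contra hlt
        exact hnt (by omega)
      · omega
    have hprev : ∀ k, k = j + 1 → k < c.width → c.adjacentBox cells c.reversed (k / 4) ≠ some b :=
      fun k hk hk' => hmin' (i - 1) k (by omega) (by omega)
        ((place_eq_some (by omega)).2 (Or.inr (Or.inl ⟨by omega, hk'⟩)))
    have hj4 : j + 1 = 4 * (j / 4 + 1) := by
      by_contra hne
      refine hprev (j + 1) rfl (by omega) ?_
      rwa [show (j + 1) / 4 = j / 4 by omega]
    have hjw' : j + 1 < c.width := by
      by_contra hge
      rcases hst with hst | hst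
      · exact hnt (by omega)
      · exact hmin' j j (by omega) (by omega) ((place_eq_some (by omega)).2 (Or.inl ⟨rfl, hjw⟩)) hbj
    have hnone : c.adjacentBox cells c.reversed (j / 4 + 1) = none := by
      cases e : c.adjacentBox cells c.reversed (j / 4 + 1) with
      | none => rfl
      | some b' =>
        have h1 := hprev (j + 1) rfl hjw'
        rw [show (j + 1) / 4 = j / 4 + 1 by omega, e,
          adjacentBox_succ (m := j / 4) (by omega) hbj e] at h1
        exact absurd rfl h1
    have hlt : c.t / 4 ≠ j / 4 + 1 := by
      intro e
      rw [← e, hpt] at hnone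
      simp at hnone
    have hjt : j ≤ c.t := by
      by_contra hgt
      rcases hst with hst | hst
      · omega
      · exact hmin' j j (by omega) (by omega) ((place_eq_some (by omega)).2 (Or.inl ⟨rfl, hjw⟩)) hbj
    exact ⟨j / 4 + 1, by omega, by omega, by omega, hbot, hbj, hnone⟩
  -- When the spiral reaches the top left of `t`, it has already passed the same place on the
  -- bottom.
  · exact absurd hbj (hmin' (2 * c.width - j) j (by omega) (by omega)
      ((place_eq_some (by omega)).2 (Or.inr (Or.inl ⟨by omega, hjw⟩))))
  · omega

/-- Every front child is met by the front spiral. -/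
theorem Valid.exists_frontSuture (h : c.Valid cells) {m : ℕ} (hm : 4 * m < c.width) {b : Box}
    (hb : c.adjacentBox cells c.reversed m = some b) (hbp : some b ≠ c.parent) :
    ∃ i d, c.start ≤ i ∧ i < c.girth + c.t ∧ c.frontSuture cells i = some d ∧ d.box = b := by
  classical
  have hg := c.girth_eq
  obtain ⟨w, hw, hw'⟩ := h.width_ge
  have hex : ∃ i, c.start ≤ i ∧ i < c.girth + c.t ∧ c.frontChild cells i = some b := by
    -- The bottom column at the first place of interval `m`; for a call with a parent, the front
    -- spiral covers the bottom up to there.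
    refine ⟨2 * c.width - 4 * m, ?_, by omega, (frontChild_eq_some (by omega)).2
      ⟨4 * m, (place_eq_some (by omega)).2 (Or.inr (Or.inl ⟨by omega, hm⟩)), ?_, hbp⟩⟩
    · rcases h.start_cases with ⟨-, h2, -⟩ | ⟨p, hp, hpt, hst⟩
      · rw [h2] at hb
        simp at hb
      · omega
    · rwa [Nat.mul_div_cancel_left _ (by norm_num)]
  obtain ⟨h1, h2, h3⟩ := Nat.find_spec hex
  refine ⟨Nat.find hex, c.sameDirectionCall b true (c.onBottom (Nat.find hex)), h1, h2,
    frontSuture_eq_some.2 ⟨b, h3, fun q hq hq' hc => ?_, rfl⟩, rfl⟩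
  exact Nat.find_min hex hq' ⟨hq, by omega, hc⟩

theorem frontSuture_injective {i i' : ℕ} (hi : c.start ≤ i) (hi' : c.start ≤ i') {d d' : Call}
    (h : c.frontSuture cells i = some d) (h' : c.frontSuture cells i' = some d')
    (hb : d.box = d'.box) : i = i' := by
  obtain ⟨b, h1, h2, rfl⟩ := frontSuture_eq_some.1 h
  obtain ⟨b', h1', h2', rfl⟩ := frontSuture_eq_some.1 h'
  obtain rfl : b = b' := hb
  rcases Nat.lt_trichotomy i i' with h3 | h3 | h3
  · exact absurd h1 (h2' i hi h3)
  · exact h3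
  · exact absurd h1' (h2 i' hi' h3)

end Call
end ManhattanTower

/-! ### Where back children are met -/

namespace ManhattanTower

namespace Call

variable {c : Call} {cells : Finset (ℕ × ℕ)}

/-- The parent adjoins the front face, hence is in the other neighbouring slab. -/
theorem Valid.ne_parent_of_back (h : c.Valid cells) {m : ℕ} {b : Box}
    (hb : c.adjacentBox cells (!c.reversed) m = some b) : some b ≠ c.parent := by
  rcases h.kind with ⟨hp, -⟩ | ⟨p, hp, h1, -⟩
  · rw [hp]
    simp
  · rw [hp]
    intro e
    obtain rfl := Option.some.inj e
    have e1 := (adjacentBox_eq_some_iff.1 hb).2.1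
    have e2 := (adjacentBox_eq_some_iff.1 h1).2.1
    cases hr : c.reversed <;> simp [hr] at e1 e2 <;> omega

theorem Valid.backChild_eq_some (h : c.Valid cells) {i : ℕ} (hi : i < 2 * c.girth) {b : Box} :
    c.backChild cells i = some b ↔
      ∃ j, c.place i = some j ∧ c.adjacentBox cells (!c.reversed) (j / 4) = some b := by
  rw [backChild_eq_some' hi]
  exact exists_congr fun j => and_congr_right fun _ =>
    ⟨fun h => h.1, fun h1 => ⟨h1, h.ne_parent_of_back h1⟩⟩

theorem Valid.backChild_top (h : c.Valid cells) {j : ℕ} (hj : j < c.width) :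
    c.backChild cells j = c.adjacentBox cells (!c.reversed) (j / 4) := by
  have hg := c.girth_eq
  ext b
  rw [h.backChild_eq_some (by omega)]
  constructor
  · rintro ⟨k, hk, hb⟩
    rw [place_eq_some (by omega)] at hk
    obtain rfl : j = k := by omega
    exact hb
  · intro hb
    exact ⟨j, (place_eq_some (by omega)).2 (Or.inl ⟨rfl, hj⟩), hb⟩

/-- The rightmost gridpoint shared with a back child. -/
theorem Valid.rightmost_cases (h : c.Valid cells) :
    (c.rightmost cells = 0 ∧ ∀ m, 4 * m < c.width → c.adjacentBox cells (!c.reversed) m = none) ∨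
    ∃ υ b, c.rightmost cells = 4 * υ ∧ 1 ≤ υ ∧ 4 * υ ≤ c.width ∧
      c.adjacentBox cells (!c.reversed) (υ - 1) = some b ∧
      ∀ m, 4 * m < c.width → υ ≤ m → c.adjacentBox cells (!c.reversed) m = none := by
  have hg := c.girth_eq
  obtain ⟨w, hw, hw'⟩ := h.width_ge
  have hle : c.rightmost cells ≤ c.width := Nat.findGreatest_le _
  have hno : ∀ m, 4 * m < c.width → c.rightmost cells < 4 * m + 4 →
      c.adjacentBox cells (!c.reversed) m = none := by
    intro m hm hlt
    cases e : c.adjacentBox cells (!c.reversed) m with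
    | none => rfl
    | some b =>
      have : 4 * m + 4 ≤ c.rightmost cells := by
        refine Nat.le_findGreatest (by omega) ⟨by omega, ?_⟩
        rw [h.backChild_top (by omega), show (4 * m + 4 - 1) / 4 = m by omega, e]
        rfl
      omega
  rcases Nat.eq_zero_or_pos (c.rightmost cells) with h0 | h0
  · exact Or.inl ⟨h0, fun m hm => hno m hm (by omega)⟩
  · right
    have hs := Nat.findGreatest_of_ne_zero (P := fun u => 0 < u ∧
      (c.backChild cells (u - 1)).isSome) (m := c.rightmost cells) rfl h0.ne'
    have h2 := hs.2
    rw [h.backChild_top (by omega)] at h2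
    obtain ⟨b, hb⟩ := Option.isSome_iff_exists.1 h2
    -- All four columns of a grid interval meet the same box, so the rightmost shared point is on a
    -- grid line.
    have h4 : 4 * ((c.rightmost cells - 1) / 4) + 4 ≤ c.rightmost cells := by
      by_contra hlt
      rw [hno _ (by omega) (by omega)] at hb
      simp at hb
    refine ⟨(c.rightmost cells - 1) / 4 + 1, b, by omega, by omega, by omega,
      by simpa using hb, fun m hm hυ => hno m hm (by omega)⟩

/-- The possible positions of the column `turn`. -/
theorem Valid.turn_cases (h : c.Valid cells) :
    (c.rightmost cells = 0 ∧ c.turn cells = c.width + 1 ∧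
      c.backStart cells = c.girth + c.width - 2) ∨
    (4 ≤ c.rightmost cells ∧ c.rightmost cells ≤ c.width ∧ c.t ≤ c.rightmost cells ∧
      c.turn cells + 1 = c.rightmost cells ∧
      c.backStart cells + 2 = c.girth + c.rightmost cells) ∨
    (4 ≤ c.rightmost cells ∧ c.rightmost cells < c.t ∧
      c.turn cells + c.rightmost cells = 2 * c.width + 2 ∧
      c.backStart cells + c.rightmost cells = c.girth + 2 * c.width + 1) := by
  have hg := c.girth_eq
  have ht := h.t_le
  unfold backStart turn
  rcases h.rightmost_cases with ⟨h0, -⟩ | ⟨υ, b, hu, hυ, hυ', -⟩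
  · left
    simp [h0]
  · right
    have hne : c.rightmost cells ≠ 0 := by omega
    simp only [hne, if_false]
    split_ifs <;> omega

theorem backSuture_eq_some {i : ℕ} {d : Call} : c.backSuture cells i = some d ↔
    ∃ b, c.backChild cells i = some b ∧
      c.backChild cells (c.rightmost cells - 1) ≠ some b ∧
      (∀ q, i < q → q ≤ c.backStart cells → c.backChild cells q ≠ some b) ∧
      d = c.sameDirectionCall b false (c.onBottom i) := by
  unfold backSuture
  rw [Option.bind_eq_some_iff]
  refine exists_congr fun b => and_congr_right fun _ => ?_
  split_ifs with h
  · simp only [false_iff, not_and]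
    intro h0 h'
    rcases h with h | ⟨q, hq, h1⟩
    · exact absurd h h0
    · rw [Finset.mem_Ioc] at hq
      exact absurd h1 (h' q hq.1 hq.2)
  · rw [not_or] at h
    rw [Option.some_inj]
    constructor
    · rintro rfl
      exact ⟨h.1, fun q h1 h2 h3 => h.2 ⟨q, Finset.mem_Ioc.2 ⟨h1, h2⟩, h3⟩, rfl⟩
    · rintro ⟨-, -, rfl⟩
      rfl

/-- A back child other than the rightmost is first met at its right end on the top. -/
theorem Valid.backSuture_cases (h : c.Valid cells) {i : ℕ} (hi : c.t ≤ i)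
    (hi' : i ≤ c.backStart cells) {d : Call} (hd : c.backSuture cells i = some d) :
    ∃ b ρ, d = c.sameDirectionCall b false false ∧ i + 1 = c.girth + 4 * ρ ∧ 1 ≤ ρ ∧
      4 * ρ + 8 ≤ c.rightmost cells ∧ c.onBottom i = false ∧
      c.adjacentBox cells (!c.reversed) (ρ - 1) = some b ∧
      c.adjacentBox cells (!c.reversed) ρ = none := by
  have hg := c.girth_eq
  have ht := h.t_le
  obtain ⟨w, hw, hw'⟩ := h.width_ge
  obtain ⟨b, hb, hbu, hmin, rfl⟩ := backSuture_eq_some.1 hd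
  have htc := h.turn_cases
  have hi2 : i < 2 * c.girth := by omega
  obtain ⟨j, hj, hbj⟩ := (h.backChild_eq_some hi2).1 hb
  have hj2 := (place_eq_some hi2).1 hj
  rcases h.rightmost_cases with ⟨h0, h1⟩ | ⟨υ, b', hu, hυ, hυ', hbυ, hno⟩
  · rw [h1 _ (by omega)] at hbj
    simp at hbj
  rw [h.backChild_top (by omega), show (c.rightmost cells - 1) / 4 = υ - 1 by omega, hbυ] at hbu
  have hbb' : b' ≠ b := fun e => hbu (by rw [e])
  have hju : j / 4 < υ - 1 := by
    have h1 : j / 4 < υ := by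
      by_contra hge
      rw [hno _ (by omega) (by omega)] at hbj
      simp at hbj
    have h2 : j / 4 ≠ υ - 1 := by
      intro e
      rw [e, hbυ] at hbj
      exact hbb' (Option.some.inj hbj)
    omega
  have hmin' : ∀ k, i < c.girth + k → k < 4 * υ - 1 →
      c.adjacentBox cells (!c.reversed) (k / 4) ≠ some b := fun k h1 h2 h4 =>
    hmin (c.girth + k) h1 (by omega) ((h.backChild_eq_some (by omega)).2
      ⟨k, (place_eq_some (by omega)).2 (by omega), h4⟩)
  -- The first meeting is on the top in the second turn: every other number of a column at place `j`
  -- is smaller, so the backward walk reaches it later.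
  have hij : i = c.girth + j := by
    have := hmin' j
    by_contra hne
    exact this (by omega) (by omega) hbj
  subst hij
  have hbot : c.onBottom (c.girth + j) = false := by
    rw [← Bool.not_eq_true, onBottom_eq hi2]
    omega
  have hj4 : j + 1 = 4 * (j / 4 + 1) := by
    by_contra hne
    refine hmin' (j + 1) (by omega) (by omega) ?_
    rwa [show (j + 1) / 4 = j / 4 by omega]
  have hnone : c.adjacentBox cells (!c.reversed) (j / 4 + 1) = none := by
    cases e : c.adjacentBox cells (!c.reversed) (j / 4 + 1) with
    | none => rfl
    | some b'' =>
      have h1 := hmin' (j + 1) (by omega) (by omega)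
      rw [show (j + 1) / 4 = j / 4 + 1 by omega, e,
        adjacentBox_succ (m := j / 4) (by omega) hbj e] at h1
      exact absurd rfl h1
  -- The free interval after `b` is not one of the rightmost child, which lies still further right.
  -- So 8 accounts for the free interval and one interval of that child.
  have hne : j / 4 + 1 ≠ υ - 1 := by
    intro e
    rw [e, hbυ] at hnone
    simp at hnone
  exact ⟨b, j / 4 + 1, by rw [hbot], by omega, by omega, by omega, hbot, hbj, hnone⟩

/-- The end point `t` of the child precedes its start point in walking direction. On the top, the
walk goes right and `t` is two positions before the rightmost shared point; on the bottom, the walk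
goes left and `t` is that point itself. -/
theorem reverseSuture_eq_some {d : Call} (h : c.Valid cells) :
    c.reverseSuture cells = some d ↔ ∃ υ b, c.rightmost cells = 4 * υ ∧ 1 ≤ υ ∧ 4 * υ ≤ c.width ∧
      c.adjacentBox cells (!c.reversed) (υ - 1) = some b ∧
      d.box = b ∧ d.parent = some c.box ∧ d.reversed = c.reversed ∧
      d.inverted = xor c.inverted (!decide (c.t ≤ c.rightmost cells)) ∧ d.sTop = true ∧
      d.t = d.position (if c.t ≤ c.rightmost cells then c.plane (c.rightmost cells - 2)
        else c.plane (c.rightmost cells)) ∧ d.s = d.t + 1 := by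
  unfold reverseSuture
  rcases h.rightmost_cases with ⟨h0, h1⟩ | ⟨υ, b, hu, hυ, hυ', hb, -⟩
  · rw [Option.bind_eq_some_iff]
    simp only [h0, if_true]
    constructor
    · rintro ⟨b, -, hb⟩
      simp at hb
    · rintro ⟨υ, b, hu, hυ, -⟩
      omega
  · have hw := c.width_eq
    have hne : c.rightmost cells ≠ 0 := by omega
    rw [h.backChild_top (by omega), show (c.rightmost cells - 1) / 4 = υ - 1 by omega, hb,
      Option.bind_some, if_neg hne, Option.some_inj]
    constructor
    · rintro rfl
      refine ⟨υ, b, hu, hυ, hυ', hb, rfl, rfl, rfl, rfl, rfl, ?_, rfl⟩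
      by_cases ht : c.t ≤ c.rightmost cells <;> simp [ht] <;> rfl
    · rintro ⟨υ', b', hu', -, -, hb', h1, h2, h3, h4, h5, h6, h7⟩
      obtain rfl : υ' = υ := by omega
      rw [hb] at hb'
      obtain rfl := Option.some.inj hb'
      obtain ⟨bx, par, rev, inv, s, st, t⟩ := d
      simp only at h1 h2 h3 h4 h5 h7
      subst h1 h2 h3 h4 h5 h7
      by_cases ht : c.t ≤ c.rightmost cells
      · simp only [ht, if_true, decide_true] at h6 ⊢
        rw [h6]
        rfl
      · simp only [ht, if_false, decide_false] at h6 ⊢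
        rw [h6]
        rfl

theorem Valid.exists_reverseSuture (h : c.Valid cells) (h0 : c.rightmost cells ≠ 0) :
    ∃ d, c.reverseSuture cells = some d := by
  rcases h.rightmost_cases with ⟨h1, -⟩ | ⟨υ, b, hu, hυ, hυ', hb, -⟩
  · exact absurd h1 h0
  · unfold reverseSuture
    rw [h.backChild_top (by omega), show (c.rightmost cells - 1) / 4 = υ - 1 by omega, hb,
      Option.bind_some, if_neg h0]
    exact ⟨_, rfl⟩

theorem Valid.reverseSuture_of_rightmost (h : c.Valid cells) (h0 : c.rightmost cells = 0) :
    c.reverseSuture cells = none := by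
  cases e : c.reverseSuture cells with
  | none => rfl
  | some d =>
    obtain ⟨υ, b, h1, h2, -⟩ := (reverseSuture_eq_some h).1 e
    omega

/-- Every back child is the rightmost or met by the back spiral. -/
theorem Valid.exists_backSuture (h : c.Valid cells) {m : ℕ} (hm : 4 * m < c.width) {b : Box}
    (hb : c.adjacentBox cells (!c.reversed) m = some b) :
    (∃ d, c.reverseSuture cells = some d ∧ d.box = b) ∨
    ∃ i d, c.t ≤ i ∧ i ≤ c.backStart cells ∧ c.backSuture cells i = some d ∧ d.box = b := by
  classical
  have hg := c.girth_eq
  have ht := h.t_le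
  have htc := h.turn_cases
  obtain ⟨w, hw, hw'⟩ := h.width_ge
  rcases h.rightmost_cases with ⟨h0, h1⟩ | ⟨υ, b', hu, hυ, hυ', hbυ, hno⟩
  · rw [h1 m hm] at hb
    simp at hb
  by_cases hbb : b' = b
  · subst hbb
    obtain ⟨d, hd⟩ := h.exists_reverseSuture (by omega)
    obtain ⟨υ'', b'', h1, h2, h3, h4, h5, -⟩ := (reverseSuture_eq_some h).1 hd
    obtain rfl : υ'' = υ := by omega
    rw [hbυ] at h4
    exact Or.inl ⟨d, hd, by rw [h5, Option.some.inj h4]⟩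
  · right
    have hbu : c.backChild cells (c.rightmost cells - 1) ≠ some b := by
      rw [h.backChild_top (by omega), show (c.rightmost cells - 1) / 4 = υ - 1 by omega, hbυ]
      exact fun e => hbb (Option.some.inj e)
    have hmυ : m < υ - 1 := by
      have h1 : m < υ := by
        by_contra hge
        rw [hno m hm (by omega)] at hb
        simp at hb
      have h2 : m ≠ υ - 1 := by
        rintro rfl
        rw [hbυ] at hb
        exact hbb (Option.some.inj hb)
      omega
    let Q : ℕ → Prop := fun i => c.backChild cells i = some b
    have hQ : Q (c.girth + 4 * m) := (h.backChild_eq_some (by omega)).2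
      ⟨4 * m, (place_eq_some (by omega)).2 (by omega),
        by rwa [Nat.mul_div_cancel_left _ (by norm_num)]⟩
    have hle : c.girth + 4 * m ≤ c.backStart cells := by omega
    -- The walk is backwards, so the first meeting has the greatest column number.
    have hs := Nat.findGreatest_spec (P := Q) hle hQ
    have hge := Nat.le_findGreatest (P := Q) hle hQ
    have hgr : ∀ q, Nat.findGreatest Q (c.backStart cells) < q → q ≤ c.backStart cells → ¬ Q q :=
      fun q h1 h2 => Nat.findGreatest_is_greatest h1 h2
    exact ⟨_, _, by omega, Nat.findGreatest_le _,
      backSuture_eq_some.2 ⟨b, hs, hbu, hgr, rfl⟩, rfl⟩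

theorem backSuture_injective {i i' : ℕ} (hi : i ≤ c.backStart cells)
    (hi' : i' ≤ c.backStart cells) {d d' : Call}
    (h : c.backSuture cells i = some d) (h' : c.backSuture cells i' = some d')
    (hb : d.box = d'.box) : i = i' := by
  obtain ⟨b, h1, h0, h2, rfl⟩ := backSuture_eq_some.1 h
  obtain ⟨b', h1', h0', h2', rfl⟩ := backSuture_eq_some.1 h'
  obtain rfl : b = b' := hb
  rcases Nat.lt_trichotomy i i' with h3 | h3 | h3
  · exact absurd h1' (h2 i' h3 hi')
  · exact h3
  · exact absurd h1 (h2' i h3 hi)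

theorem Valid.reverseSuture_ne_backSuture (h : c.Valid cells) {i : ℕ} {d d' : Call}
    (hd : c.reverseSuture cells = some d) (hd' : c.backSuture cells i = some d') :
    d.box ≠ d'.box := by
  obtain ⟨b', h1, h0, h2, rfl⟩ := backSuture_eq_some.1 hd'
  obtain ⟨υ, b, h1, h2, h3, h4, h5, -⟩ := (reverseSuture_eq_some h).1 hd
  rw [h.backChild_top (by omega), show (c.rightmost cells - 1) / 4 = υ - 1 by omega, h4] at h0
  intro e
  exact h0 (by rw [← h5, e]; rfl)

end Call
end ManhattanTower

/-! ### Sutures: how parent and child fit together -/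

namespace ManhattanTower

open Matrix

namespace Call

variable {c d : Call} {cells : Finset (ℕ × ℕ)}

theorem vertex_top {i : ℕ} (q : ℕ) (h : i ≤ c.width) :
    c.vertex i q = (c.plane i, c.rowPlane q, !c.inverted) := by
  unfold vertex
  rw [mod_of_lt (by rw [girth_eq]; omega), if_pos h]

theorem vertex_bottom {i p : ℕ} (q : ℕ) (h : c.width < i) (h' : i + p = 2 * c.width + 1) :
    c.vertex i q = (c.plane p, c.rowPlane q, c.inverted) := by
  unfold vertex
  rw [mod_of_lt (by rw [girth_eq]; omega), if_neg (by omega)]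
  rw [show 2 * c.width + 1 - i = p by omega]

theorem vertex_of_eq_add_girth {i p : ℕ} (q : ℕ) (h : i = c.girth + p) :
    c.vertex i q = c.vertex p q := by
  rw [h, add_comm, vertex_add_girth]

theorem panel_of_eq_add_girth {i p : ℕ} (q : ℕ) (fwd : Bool) (h : i = c.girth + p) :
    c.panel i q fwd = c.panel p q fwd := by
  rw [h, add_comm, panel_add_girth]

theorem support_of_eq_add_girth {i p : ℕ} (q : ℕ) (h : i = c.girth + p) :
    c.support i q = c.support p q := by
  rw [h, add_comm, support_add_girth]

/-- A front child runs in the opposite direction, so both boxes have their front on the common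
plane. A back child runs in the same direction, and its front is at the back of the parent. -/
theorem rowPlane_front {b : Box} {m : ℕ} (h : c.adjacentBox cells c.reversed m = some b)
    (hb : d.box = b) (hr : d.reversed = !c.reversed) : d.rowPlane 0 = c.rowPlane 0 := by
  have h1 := (adjacentBox_eq_some_iff.1 h).2.1
  unfold rowPlane
  rw [hr, hb]
  cases e : c.reversed <;> simp [e] at h1 ⊢ <;> omega

theorem rowPlane_back {b : Box} {m : ℕ} (h : c.adjacentBox cells (!c.reversed) m = some b)
    (hb : d.box = b) (hr : d.reversed = c.reversed) : d.rowPlane 0 = c.rowPlane 5 := by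
  have h1 := (adjacentBox_eq_some_iff.1 h).2.1
  unfold rowPlane
  rw [hr, hb]
  cases e : c.reversed <;> simp [e] at h1 ⊢ <;> omega

/-- The free interval after `m` fixes the end of `b`, which is `b.lo` if the frame is mirrored. -/
theorem right_end {up : Bool} {b : Box} {m : ℕ} (hm : 4 * (m + 1) < c.width)
    (hb : c.adjacentBox cells up m = some b) (hn : c.adjacentBox cells up (m + 1) = none) :
    (c.mirrored = false ∧ b.hi = c.box.lo + (m + 1)) ∨
      (c.mirrored = true ∧ b.lo + (m + 1) = c.box.hi) := by
  have h1 := adjacentBox_eq_some_iff.1 hb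
  have h2 : ¬ (b.lo ≤ c.cell (m + 1) ∧ c.cell (m + 1) < b.hi) := fun h => by
    have := adjacentBox_eq_some_iff.2 ⟨h1.1, h1.2.1, h⟩
    rw [hn] at this
    simp at this
  rcases c.cell_eq hm with e | e <;> rcases c.cell_eq (m := m) (by omega) with e' | e' <;>
    simp [e.1] at e' ⊢ <;> omega

theorem left_end {up : Bool} {b : Box} {m : ℕ} (hm : 4 * (m + 1) < c.width)
    (hb : c.adjacentBox cells up (m + 1) = some b) (hn : c.adjacentBox cells up m = none) :
    (c.mirrored = false ∧ b.lo = c.box.lo + (m + 1)) ∨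
      (c.mirrored = true ∧ b.hi + (m + 1) = c.box.hi) := by
  have h1 := adjacentBox_eq_some_iff.1 hb
  have h2 : ¬ (b.lo ≤ c.cell m ∧ c.cell m < b.hi) := fun h => by
    have := adjacentBox_eq_some_iff.2 ⟨h1.1, h1.2.1, h⟩
    rw [hn] at this
    simp at this
  rcases c.cell_eq hm with e | e <;> rcases c.cell_eq (m := m) (by omega) with e' | e' <;>
    simp [e.1] at e' ⊢ <;> omega

/-- The right end of a child lies in the parent's frame at position `4 * m + 4`. -/
theorem plane_right_end {up : Bool} {b : Box} {m : ℕ} (hm : 4 * (m + 1) < c.width)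
    (hb : c.adjacentBox cells up m = some b) (hn : c.adjacentBox cells up (m + 1) = none)
    (hd : d.box = b) (hi : d.mirrored = c.mirrored) {x : ℕ} (hx : x ≤ 4) :
    4 ≤ d.width ∧ d.plane (d.width - x) = c.plane (4 * (m + 1) - x) := by
  have h1 := (adjacentBox_eq_some_iff.1 hb).1.1
  have hw := d.width_eq
  have hw' := c.width_eq
  unfold plane
  rw [hi]
  rw [hd] at hw ⊢
  rcases right_end hm hb hn with ⟨e, e'⟩ | ⟨e, e'⟩ <;> simp only [e] <;> simp <;> omega

/-- Parent and child see left and right exchanged, so the end met is again the right end for the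
child. Therefore one form of call serves for all same-direction sutures. -/
theorem plane_left_end {up : Bool} {b : Box} {m : ℕ} (hm : 4 * (m + 1) < c.width)
    (hb : c.adjacentBox cells up (m + 1) = some b) (hn : c.adjacentBox cells up m = none)
    (hd : d.box = b) (hi : d.mirrored = !c.mirrored) {x : ℕ} (hx : x ≤ 4) :
    4 ≤ d.width ∧ d.plane (d.width - x) = c.plane (4 * (m + 1) + x) := by
  have h1 := (adjacentBox_eq_some_iff.1 hb).1.1
  have hw := d.width_eq
  have hw' := c.width_eq
  unfold plane
  rw [hi]
  rw [hd] at hw ⊢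
  rcases left_end hm hb hn with ⟨e, e'⟩ | ⟨e, e'⟩ <;> simp only [e] <;> simp <;> omega

theorem adj_of_adjacentBox {up : Bool} {b : Box} {m : ℕ} (hc : IsBox cells c.box)
    (hm : 4 * m < c.width) (hb : c.adjacentBox cells up m = some b) :
    (dualGraph cells).Adj c.box b := by
  obtain ⟨h1, h2, h3, h4⟩ := adjacentBox_eq_some_iff.1 hb
  have := c.width_eq
  refine ⟨hc, h1, ?_, ?_⟩
  · cases up <;> simp at h2 <;> omega
  · rw [max_lt_iff, lt_min_iff, lt_min_iff]
    have := hc.1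
    have := h1.1
    rcases c.cell_eq hm with e | e <;> omega

theorem start_sameDirection (hs : d.sTop = false) (hs' : d.s + 1 = d.width) :
    d.start = d.width + 2 := by
  unfold start
  simp [hs]
  omega

/-- Two panels that lie one behind the other. -/
theorem upAdj_of_vertex {d' : Call} {i j q q' : ℕ} {u v : Bool}
    (hc : c.box.lo < c.box.hi) (hd : d'.box.lo < d'.box.hi) (hq : q ≤ 4) (hq' : q' ≤ 4)
    (h1 : c.vertex (i + (!u).toNat) (q + u.toNat) = d'.vertex (j + (!v).toNat) (q' + (!v).toNat))
    (h2 : c.vertex (i + u.toNat) (q + u.toNat) = d'.vertex (j + v.toNat) (q' + (!v).toNat))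
    (h3 : (u != c.reversed) = (v != d'.reversed)) :
    UpAdj (c.panel i q u) (d'.panel j q' v) := by
  refine ⟨?_, ?_, ?_⟩
  · cases u <;> cases v <;>
      simpa [corner_panel hc i hq, corner_panel_backward hc i hq, corner_panel hd j hq',
        corner_panel_backward hd j hq'] using h1
  · cases u <;> cases v <;>
      simpa [corner_panel hc i hq, corner_panel_backward hc i hq, corner_panel hd j hq',
        corner_panel_backward hd j hq'] using h2
  · rw [up_panel, up_panel, h3]
    simp [sign_mul_self]

/-- What connects a call to a subcall, made from gridface `(i, q)` and returning to `(j, q)`. -/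
structure Joined (cells : Finset (ℕ × ℕ)) (c d : Call) (i j q : ℕ) (u : Bool) : Prop where
  valid : d.Valid cells
  adj : (dualGraph cells).Adj c.box d.box
  parent : d.parent = some c.box
  ne_parent : some d.box ≠ c.parent
  enter : UpAdj (c.panel i q u) (d.panel d.start 0 true)
  leave : UpAdj (d.panel d.t 0 false) (c.panel j q (!u))

/-- The bite starts in the free interval and ends at the second gridface from the end of the child,
next to the first column of the child's spiral. The child returns at its last place on the opposite
side, next to column `i`. The two cases are a right end met on the bottom and a left end met on the
top. -/
theorem Valid.joined_front (h : c.Valid cells) {i : ℕ} (hi : c.start ≤ i)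
    (hi' : i < c.girth + c.t) (hd : c.frontSuture cells i = some d) :
    Joined cells c d (c.opposite (i - 1) - 2) i 0 false := by
  have hg := c.girth_eq
  have ht := h.t_le
  have hwc := c.width_eq
  have hwd := d.width_eq
  have hlt := h.isBox.1
  obtain ⟨b, hb, hdc, hcase⟩ := h.frontSuture_cases hi hi' hd
  have hbp : some b ≠ c.parent := by
    obtain ⟨j, -, -, h1⟩ := (frontChild_eq_some (by omega)).1 hb
    exact h1
  have hbox : d.box = b := by rw [hdc]; rfl
  have hpar : d.parent = some c.box := by rw [hdc]; rfl
  have hrev : d.reversed = !c.reversed := by rw [hdc]; simp [sameDirectionCall]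
  have hinv : d.inverted = xor c.inverted (c.onBottom i) := by rw [hdc]; rfl
  have hsTop : d.sTop = false := by rw [hdc]; rfl
  have hs : d.s = d.width - 1 := by rw [hdc]; rfl
  have hdt : d.t = d.width - 1 := by rw [hdc]; rfl
  have hmir : d.mirrored = xor c.mirrored (!c.onBottom i) := by
    unfold mirrored
    rw [hrev, hinv]
    cases c.reversed <;> cases c.inverted <;> cases c.onBottom i <;> rfl
  clear hdc
  rcases hcase with ⟨ρ, hiρ, hρ, hρt, hbot, hadj, hnone⟩ | ⟨l, rfl, hlt', hlw, hbot, hst, hadj, hnone⟩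
  · obtain ⟨m, rfl⟩ : ∃ m, ρ = m + 1 := ⟨ρ - 1, by omega⟩
    rw [Nat.add_sub_cancel] at hadj
    rw [hbot, Bool.not_true, Bool.xor_false] at hmir
    have hinv' : d.inverted = !c.inverted := by simp [hinv, hbot]
    have hrow := rowPlane_front hadj hbox hrev
    have hpl := fun x (hx : x ≤ 4) => plane_right_end (x := x) (by omega) hadj hnone hbox hmir hx
    have hA := adjacentBox_eq_some_iff.1 hadj
    have hw4 := (hpl 0 (by omega)).1
    have hend := right_end (by omega) hadj hnone
    have hop : c.opposite (i - 1) = 4 * (m + 1) := by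
      unfold opposite
      rw [mod_of_lt (by omega)]
      omega
    have hst : d.start = d.width + 2 := start_sameDirection hsTop (by omega)
    refine ⟨⟨hbox ▸ hA.1, Or.inr ⟨c.box, hpar, ?_, Or.inl ⟨hsTop, by omega, by omega⟩⟩⟩, ?_, hpar,
      hbox ▸ hbp, ?_, ?_⟩
    · rw [adjacentBox_eq_some_iff]
      refine ⟨h.isBox, ?_, ?_⟩
      · have := hA.2.1
        rw [hrev, hbox]
        cases e : c.reversed <;> simp [e] at this ⊢ <;> omega
      · rw [hbox] at hwd
        rcases d.cell_eq (m := d.t / 4) (by omega) with e | e <;> rw [hbox] at e <;>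
          rcases hend with e' | e' <;> simp [hmir, e'.1] at e <;> omega
    · rw [hbox]
      exact adj_of_adjacentBox h.isBox (by omega) hadj
    · rw [hop, hst]
      refine upAdj_of_vertex hlt (hbox ▸ hA.1.1) (by omega) (by omega) ?_ ?_ (by simp [hrev])
      · simp only [Bool.not_false, Bool.toNat_true, Bool.toNat_false, Bool.not_true, add_zero]
        rw [vertex_top _ (by omega), vertex_bottom (p := d.width - 1) _ (by omega) (by omega),
          (hpl 1 (by omega)).2, hrow, hinv', show 4 * (m + 1) - 2 + 1 = 4 * (m + 1) - 1 by omega]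
      · simp only [Bool.toNat_true, Bool.toNat_false, Bool.not_true, add_zero]
        rw [vertex_top _ (by omega), vertex_bottom (p := d.width - 2) _ (by omega) (by omega),
          (hpl 2 (by omega)).2, hrow, hinv']
    · refine upAdj_of_vertex (hbox ▸ hA.1.1) hlt (by omega) (by omega) ?_ ?_ (by simp [hrev])
      · simp only [Bool.not_false, Bool.toNat_true, Bool.toNat_false, Bool.not_true, add_zero]
        rw [vertex_top _ (by omega), vertex_bottom (p := 4 * (m + 1)) _ (by omega) (by omega),
          hrow, hinv', hdt, show d.width - 1 + 1 = d.width - 0 by omega, (hpl 0 (by omega)).2]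
        simp
      · simp only [Bool.not_false, Bool.toNat_true, Bool.toNat_false, Bool.not_true, add_zero]
        rw [vertex_top _ (by omega), vertex_bottom (p := 4 * (m + 1) - 1) _ (by omega) (by omega),
          hrow, hinv', hdt, (hpl 1 (by omega)).2]
        simp
  · obtain ⟨m, rfl⟩ : ∃ m, l = m + 1 := ⟨l - 1, by omega⟩
    rw [Nat.add_sub_cancel] at hnone
    rw [hbot, Bool.not_false, Bool.xor_true] at hmir
    have hinv' : d.inverted = c.inverted := by simp [hinv, hbot]
    have hrow := rowPlane_front hadj hbox hrev
    have hpl := fun x (hx : x ≤ 4) => plane_left_end (x := x) (by omega) hadj hnone hbox hmir hx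
    have hA := adjacentBox_eq_some_iff.1 hadj
    have hw4 := (hpl 0 (by omega)).1
    have hend := left_end (by omega) hadj hnone
    have hop : c.opposite (4 * (m + 1) - 1) = 2 * c.width - (4 * (m + 1) - 1) := by
      unfold opposite
      rw [mod_of_lt (by omega)]
    have hst : d.start = d.width + 2 := start_sameDirection hsTop (by omega)
    refine ⟨⟨hbox ▸ hA.1, Or.inr ⟨c.box, hpar, ?_, Or.inl ⟨hsTop, by omega, by omega⟩⟩⟩, ?_, hpar,
      hbox ▸ hbp, ?_, ?_⟩
    · rw [adjacentBox_eq_some_iff]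
      refine ⟨h.isBox, ?_, ?_⟩
      · have := hA.2.1
        rw [hrev, hbox]
        cases e : c.reversed <;> simp [e] at this ⊢ <;> omega
      · rw [hbox] at hwd
        rcases d.cell_eq (m := d.t / 4) (by omega) with e | e <;> rw [hbox] at e <;>
          rcases hend with e' | e' <;> simp [hmir, e'.1] at e <;> omega
    · rw [hbox]
      exact adj_of_adjacentBox h.isBox (by omega) hadj
    · rw [hop, hst]
      refine upAdj_of_vertex hlt (hbox ▸ hA.1.1) (by omega) (by omega) ?_ ?_ (by simp [hrev])
      · simp only [Bool.not_false, Bool.toNat_true, Bool.toNat_false, Bool.not_true, add_zero]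
        rw [vertex_bottom (p := 4 * (m + 1) + 1) _ (by omega) (by omega),
          vertex_bottom (p := d.width - 1) _ (by omega) (by omega),
          (hpl 1 (by omega)).2, hrow, hinv']
      · simp only [Bool.toNat_true, Bool.toNat_false, Bool.not_true, add_zero]
        rw [vertex_bottom (p := 4 * (m + 1) + 2) _ (by omega) (by omega),
          vertex_bottom (p := d.width - 2) _ (by omega) (by omega),
          (hpl 2 (by omega)).2, hrow, hinv']
    · refine upAdj_of_vertex (hbox ▸ hA.1.1) hlt (by omega) (by omega) ?_ ?_ (by simp [hrev])
      · simp only [Bool.not_false, Bool.toNat_true, Bool.toNat_false, Bool.not_true, add_zero]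
        rw [vertex_top _ (by omega), vertex_top _ (by omega),
          hrow, hinv', hdt, show d.width - 1 + 1 = d.width - 0 by omega, (hpl 0 (by omega)).2]
        simp
      · simp only [Bool.not_false, Bool.toNat_true, Bool.toNat_false, Bool.not_true, add_zero]
        rw [vertex_top _ (by omega), vertex_top _ (by omega),
          hrow, hinv', hdt, (hpl 1 (by omega)).2]

/-- Such children are met only at a right end on the top, so the flags of the frame are those of the
parent and a single case remains. -/
theorem Valid.joined_back (h : c.Valid cells) {i : ℕ} (hi : c.t ≤ i)
    (hi' : i ≤ c.backStart cells) (hd : c.backSuture cells i = some d) :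
    Joined cells c d (c.opposite (i + 1) + 2) i 4 true := by
  have hg := c.girth_eq
  have ht := h.t_le
  have hwc := c.width_eq
  have hwd := d.width_eq
  have hlt := h.isBox.1
  have htc := h.turn_cases
  obtain ⟨b, ρ, hdc, hiρ, hρ, hρu, -, hadj, hnone⟩ := h.backSuture_cases hi hi' hd
  have hbox : d.box = b := by rw [hdc]; rfl
  have hpar : d.parent = some c.box := by rw [hdc]; rfl
  have hrev : d.reversed = c.reversed := by rw [hdc]; simp [sameDirectionCall]
  have hinv : d.inverted = c.inverted := by rw [hdc]; simp [sameDirectionCall]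
  have hsTop : d.sTop = false := by rw [hdc]; rfl
  have hs : d.s = d.width - 1 := by rw [hdc]; rfl
  have hdt : d.t = d.width - 1 := by rw [hdc]; rfl
  have hmir : d.mirrored = c.mirrored := by
    unfold mirrored
    rw [hrev, hinv]
  clear hdc
  obtain ⟨m, rfl⟩ : ∃ m, ρ = m + 1 := ⟨ρ - 1, by omega⟩
  rw [Nat.add_sub_cancel] at hadj
  have hrow := rowPlane_back hadj hbox hrev
  have hpl := fun x (hx : x ≤ 4) => plane_right_end (x := x) (by omega) hadj hnone hbox hmir hx
  have hA := adjacentBox_eq_some_iff.1 hadj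
  have hw4 := (hpl 0 (by omega)).1
  have hend := right_end (by omega) hadj hnone
  have hop : c.opposite (i + 1) = 2 * c.width - 4 * (m + 1) := by
    unfold opposite
    rw [mod_of_ge (by omega) (by omega)]
    omega
  have hst : d.start = d.width + 2 := start_sameDirection hsTop (by omega)
  refine ⟨⟨hbox ▸ hA.1, Or.inr ⟨c.box, hpar, ?_, Or.inl ⟨hsTop, by omega, by omega⟩⟩⟩, ?_, hpar,
    hbox ▸ h.ne_parent_of_back hadj, ?_, ?_⟩
  · rw [adjacentBox_eq_some_iff]
    refine ⟨h.isBox, ?_, ?_⟩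
    · have := hA.2.1
      rw [hrev, hbox]
      cases e : c.reversed <;> simp [e] at this ⊢ <;> omega
    · rw [hbox] at hwd
      rcases d.cell_eq (m := d.t / 4) (by omega) with e | e <;> rw [hbox] at e <;>
        rcases hend with e' | e' <;> simp [hmir, e'.1] at e <;> omega
  · rw [hbox]
    exact adj_of_adjacentBox h.isBox (by omega) hadj
  · rw [hop, hst]
    refine upAdj_of_vertex hlt (hbox ▸ hA.1.1) (by omega) (by omega) ?_ ?_ (by simp [hrev])
    · simp only [Bool.toNat_true, Bool.toNat_false, Bool.not_true, add_zero]
      rw [vertex_bottom (p := 4 * (m + 1) - 1) _ (by omega) (by omega),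
        vertex_bottom (p := d.width - 1) _ (by omega) (by omega), (hpl 1 (by omega)).2, hrow, hinv]
    · simp only [Bool.toNat_true, Bool.toNat_false, Bool.not_true, add_zero]
      rw [vertex_bottom (p := 4 * (m + 1) - 2) _ (by omega) (by omega),
        vertex_bottom (p := d.width - 2) _ (by omega) (by omega), (hpl 2 (by omega)).2, hrow, hinv]
  · refine upAdj_of_vertex (hbox ▸ hA.1.1) hlt (by omega) (by omega) ?_ ?_ (by simp [hrev])
    · simp only [Bool.not_false, Bool.toNat_true, Bool.toNat_false, Bool.not_true, add_zero]
      rw [vertex_top _ (by omega), hiρ, vertex_of_eq_add_girth _ rfl, vertex_top _ (by omega),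
        hrow, hinv, hdt, show d.width - 1 + 1 = d.width - 0 by omega, (hpl 0 (by omega)).2]
      simp
    · simp only [Bool.not_false, Bool.toNat_true, Bool.toNat_false, Bool.not_true, add_zero]
      rw [vertex_top _ (by omega), vertex_of_eq_add_girth (p := 4 * (m + 1) - 1) _ (by omega),
        vertex_top _ (by omega), hrow, hinv, hdt, (hpl 1 (by omega)).2]

/-- The child starts behind the strip in column `turn` and returns one column before it in walking
direction, which is where the backward spiral starts. -/
theorem Valid.joined_reverse (h : c.Valid cells) (hd : c.reverseSuture cells = some d) :
    Joined cells c d (c.turn cells) (c.backStart cells) 4 true := by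
  have hg := c.girth_eq
  have ht := h.t_le
  have hwc := c.width_eq
  have hwd := d.width_eq
  have hlt := h.isBox.1
  have htc := h.turn_cases
  obtain ⟨υ, b, hu, hυ, hυw, hadj, hbox, hpar, hrev, hinv, hsTop, hdt, hs⟩ :=
    (reverseSuture_eq_some h).1 hd
  obtain ⟨m, rfl⟩ : ∃ m, υ = m + 1 := ⟨υ - 1, by omega⟩
  rw [Nat.add_sub_cancel] at hadj
  have hrow := rowPlane_back hadj hbox hrev
  have hA := adjacentBox_eq_some_iff.1 hadj
  have hcell := c.cell_eq (m := m) (by omega)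
  have hst : d.start = d.t + 1 := by
    unfold start
    simp [hsTop, hs]
  have hmir : d.mirrored = xor c.mirrored (!decide (c.t ≤ c.rightmost cells)) := by
    unfold mirrored
    rw [hrev, hinv]
    cases c.reversed <;> cases c.inverted <;> simp
  -- Three consecutive positions of the child are read in the frame of the parent, in walking
  -- direction. They lie in the last grid interval before the rightmost shared point, hence on both
  -- boxes.
  have key : d.t + 2 ≤ d.width ∧ (d.t + 1) / 4 = d.t / 4 ∧ d.cell (d.t / 4) = c.cell m ∧
      ∀ x, x ≤ 2 → d.plane (d.t + x) =
        if c.t ≤ c.rightmost cells then c.plane (4 * m + 2 + x) else c.plane (4 * m + 4 - x) := by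
    rw [hbox] at hwd
    have e3 := hA.2.2
    unfold position plane at hdt
    have e4 : c.cell m = if c.mirrored then c.box.hi - 1 - m else c.box.lo + m := rfl
    rw [hu] at hmir hdt ⊢
    unfold plane cell
    by_cases hle : c.t ≤ 4 * (m + 1)
    · have hm : d.mirrored = c.mirrored := by simp [hmir, hle]
      rw [hm] at hdt ⊢
      rw [if_pos hle, hbox] at hdt
      rw [hbox]
      rcases hcell with ⟨e1, e2⟩ | ⟨e1, e2⟩ <;>
        simp only [e1, Bool.false_eq_true, if_false, if_true, hle] at e4 hdt ⊢ <;>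
        refine ⟨?_, ?_, ?_, ?_⟩ <;> intros <;> omega
    · have hm : d.mirrored = !c.mirrored := by simp [hmir, hle]
      rw [hm] at hdt ⊢
      rw [if_neg hle, hbox] at hdt
      rw [hbox]
      rcases hcell with ⟨e1, e2⟩ | ⟨e1, e2⟩ <;>
        simp only [e1, Bool.false_eq_true, if_false, if_true, hle, Bool.not_true, Bool.not_false]
          at e4 hdt ⊢ <;>
        refine ⟨?_, ?_, ?_, ?_⟩ <;> intros <;> omega
  obtain ⟨k1, k2, k3, k4⟩ := key
  refine ⟨⟨hbox ▸ hA.1, Or.inr ⟨c.box, hpar, ?_, Or.inr ⟨hsTop, hs, k1, k2⟩⟩⟩, ?_, hpar,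
    hbox ▸ h.ne_parent_of_back hadj, ?_, ?_⟩
  · rw [adjacentBox_eq_some_iff]
    refine ⟨h.isBox, ?_, ?_⟩
    · have := hA.2.1
      rw [hrev, hbox]
      cases e : c.reversed <;> simp [e] at this ⊢ <;> omega
    · rw [k3]
      rcases hcell with e | e <;> omega
  · rw [hbox]
    exact adj_of_adjacentBox h.isBox (by omega) hadj
  · rw [hst]
    by_cases hle : c.t ≤ c.rightmost cells
    · simp only [hle, decide_true, Bool.not_true, Bool.xor_false, if_true] at hinv k4
      refine upAdj_of_vertex hlt (hbox ▸ hA.1.1) (by omega) (by omega) ?_ ?_ (by simp [hrev])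
      · simp only [Bool.toNat_true, Bool.toNat_false, Bool.not_true, add_zero]
        rw [vertex_top _ (by omega), vertex_top _ (by omega), k4 1 (by omega), hrow, hinv,
          show c.turn cells = 4 * m + 2 + 1 by omega]
      · simp only [Bool.toNat_true, Bool.toNat_false, Bool.not_true, add_zero]
        rw [vertex_top _ (by omega), vertex_top _ (by omega), add_assoc, k4 2 (by omega), hrow, hinv,
          show c.turn cells + 1 = 4 * m + 2 + 2 by omega]
    · simp only [hle, decide_false, Bool.not_false, Bool.xor_true, if_false] at hinv k4
      refine upAdj_of_vertex hlt (hbox ▸ hA.1.1) (by omega) (by omega) ?_ ?_ (by simp [hrev])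
      · simp only [Bool.toNat_true, Bool.toNat_false, Bool.not_true, add_zero]
        rw [vertex_bottom (p := 4 * m + 4 - 1) _ (by omega) (by omega), vertex_top _ (by omega),
          k4 1 (by omega), hrow, hinv]
        simp
      · simp only [Bool.toNat_true, Bool.toNat_false, Bool.not_true, add_zero]
        rw [vertex_bottom (p := 4 * m + 4 - 2) _ (by omega) (by omega), vertex_top _ (by omega),
          add_assoc, k4 2 (by omega), hrow, hinv]
        simp
  · by_cases hle : c.t ≤ c.rightmost cells
    · simp only [hle, decide_true, Bool.not_true, Bool.xor_false, if_true] at hinv k4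
      refine upAdj_of_vertex (hbox ▸ hA.1.1) hlt (by omega) (by omega) ?_ ?_ (by simp [hrev])
      · simp only [Bool.toNat_true, Bool.toNat_false, Bool.not_true, Bool.not_false, add_zero]
        rw [vertex_of_eq_add_girth (c := c) (p := 4 * m + 2 + 1) _ (by omega), vertex_top _ (by omega),
          vertex_top _ (by omega), k4 1 (by omega), hrow, hinv]
      · simp only [Bool.toNat_true, Bool.toNat_false, Bool.not_true, Bool.not_false, add_zero]
        have := k4 0 (by omega)
        rw [add_zero] at this
        rw [vertex_of_eq_add_girth (c := c) (p := 4 * m + 2) _ (by omega), vertex_top _ (by omega),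
          vertex_top _ (by omega), this, hrow, hinv]
    · simp only [hle, decide_false, Bool.not_false, Bool.xor_true, if_false] at hinv k4
      refine upAdj_of_vertex (hbox ▸ hA.1.1) hlt (by omega) (by omega) ?_ ?_ (by simp [hrev])
      · simp only [Bool.toNat_true, Bool.toNat_false, Bool.not_true, Bool.not_false, add_zero]
        rw [vertex_of_eq_add_girth (c := c) (p := 2 * c.width + 1 - (4 * m + 4 - 1)) _ (by omega),
          vertex_bottom (c := c) (p := 4 * m + 4 - 1) _ (by omega) (by omega),
          vertex_top _ (by omega), k4 1 (by omega), hrow, hinv]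
        simp
      · simp only [Bool.toNat_true, Bool.toNat_false, Bool.not_true, Bool.not_false, add_zero]
        have := k4 0 (by omega)
        rw [add_zero] at this
        rw [vertex_of_eq_add_girth (c := c) (p := 2 * c.width + 1 - (4 * m + 4)) _ (by omega),
          vertex_bottom (c := c) (p := 4 * m + 4) _ (by omega) (by omega),
          vertex_top _ (by omega), this, hrow, hinv]
        simp

/-- By minimality of the front of the root, no box has a smaller slab number. -/
theorem valid_rootCall {P : SingleLayerMT} {r : Box} (hr : P.IsRootBox r) {s t : ℕ}
    (hs : s ≤ 4 * (r.hi - r.lo)) (ht : t ≤ 4 * (r.hi - r.lo)) (hst : s = t + 1 ∨ t = s + 1) :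
    (rootCall r s t).Valid P.cells := by
  refine ⟨hr.1, Or.inl ⟨rfl, rfl, fun m => ?_, hs, ht, hst⟩⟩
  cases e : (rootCall r s t).adjacentBox P.cells (rootCall r s t).reversed m with
  | none => rfl
  | some b =>
    obtain ⟨h1, h2, -⟩ := adjacentBox_eq_some_iff.1 e
    simp only [rootCall, Bool.false_eq_true, if_false] at h2
    have h3 := P.ys_strictMono.le_iff_le.1 (hr.2 b h1)
    omega

end Call
end ManhattanTower

/-! ### Column arithmetic of supports and bites -/

namespace ManhattanTower

namespace Call

variable {c d : Call} {cells : Finset (ℕ × ℕ)}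

theorem row_inj {q q' : ℕ} (hq : q ≤ 4) (hq' : q' ≤ 4) (h : c.row q = c.row q') : q = q' := by
  unfold row at h
  split_ifs at h <;> omega

theorem interval_inj {j j' : ℕ} (hj : j < c.width) (hj' : j' < c.width)
    (h : c.interval j = c.interval j') : j = j' := by
  have := c.width_eq
  unfold interval at h
  split_ifs at h <;> omega

/-- Opposite sides have opposite normals, and within a side the indices determine place and row. -/
theorem support_inj_mod {i j q q' : ℕ} (hq : q ≤ 4) (hq' : q' ≤ 4)
    (h : c.support i q = c.support j q') : q = q' ∧ i % c.girth = j % c.girth := by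
  have hi := c.mod_girth_lt i
  have hj := c.mod_girth_lt j
  unfold support at h
  have key : ∀ {j j' : ℕ}, j < c.width → j' < c.width →
      c.interval j = c.interval j' ∧ c.row q = c.row q' → q = q' ∧ j = j' :=
    fun h1 h2 h3 => ⟨row_inj hq hq' h3.2, interval_inj h1 h2 h3.1⟩
  have hne : ∀ b : Bool, b ≠ !b := by decide
  split_ifs at h <;> simp only [GridFace.horizontal.injEq, GridFace.lateral.injEq, reduceCtorEq,
    hne, (hne _).symm, false_and, true_and] at h
  · exact key (by omega) (by omega) h
  · exact ⟨row_inj hq hq' h, by omega⟩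
  · have := key (by omega) (by omega) h
    omega
  · exact ⟨row_inj hq hq' h, by omega⟩

theorem support_inj {i j q q' : ℕ} (hi : i < 2 * c.girth) (hj : j < 2 * c.girth) (hq : q ≤ 4)
    (hq' : q' ≤ 4) (h : c.support i q = c.support j q') :
    q = q' ∧ (i = j ∨ i = c.girth + j ∨ j = c.girth + i) := by
  obtain ⟨h1, h2⟩ := support_inj_mod hq hq' h
  refine ⟨h1, ?_⟩
  rcases Nat.lt_or_ge i c.girth with h3 | h3 <;> rcases Nat.lt_or_ge j c.girth with h4 | h4 <;>
    simp only [mod_of_lt, mod_of_ge, h3, h4, hi, hj] at h2 <;> omega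

/-- The columns in which the front spiral meets a child and bites off the opposite face. -/
theorem Valid.frontSuture_column (h : c.Valid cells) {a : ℕ} (ha : c.start ≤ a)
    (ha' : a < c.girth + c.t) (hd : c.frontSuture cells a = some d) :
    ∃ x, c.frontBite a = [c.support x 0, c.support (x - 1) 0, c.support (x - 2) 0] ∧
      ((∃ ρ, a + 4 * ρ = 2 * c.width + 1 ∧ 1 ≤ ρ ∧ 4 * ρ + 4 ≤ c.t ∧ x = c.girth + 4 * ρ ∧
          c.opposite (a - 1) = 4 * ρ) ∨
        ∃ l, a = 4 * l ∧ c.t + 5 ≤ 4 * l ∧ 4 * l < c.width ∧ c.start = c.t + 1 ∧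
          x + 4 * l = 2 * c.width + 1 ∧ c.opposite (a - 1) = x) := by
  have hg := c.girth_eq
  have ht := h.t_le
  obtain ⟨b, -, -, h1⟩ := h.frontSuture_cases ha ha' hd
  unfold frontBite
  rcases h1 with ⟨ρ, h2, h3, h4, -⟩ | ⟨l, h2, h3, h4, -, h5, -⟩
  · have hop : c.opposite (a - 1) = 4 * ρ := by
      unfold opposite
      rw [mod_of_lt (by omega)]
      omega
    -- The bite is on the top left of `t`, which the front spiral reaches in its second turn; this
    -- numbering puts it in the range of the spiral.
    refine ⟨c.girth + 4 * ρ, ?_, Or.inl ⟨ρ, h2, h3, h4, rfl, hop⟩⟩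
    rw [hop, support_of_eq_add_girth (i := c.girth + 4 * ρ) (p := 4 * ρ) _ rfl,
      support_of_eq_add_girth (i := c.girth + 4 * ρ - 1) (p := 4 * ρ - 1) _ (by omega),
      support_of_eq_add_girth (i := c.girth + 4 * ρ - 2) (p := 4 * ρ - 2) _ (by omega)]
  · have hop : c.opposite (a - 1) = 2 * c.width + 1 - 4 * l := by
      unfold opposite
      rw [mod_of_lt (by omega)]
      omega
    refine ⟨2 * c.width + 1 - 4 * l, ?_, Or.inr ⟨l, h2, h3, h4, h5, by omega, hop⟩⟩
    rw [hop]

theorem Valid.backSuture_column (h : c.Valid cells) {a : ℕ} (ha : c.t ≤ a)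
    (ha' : a ≤ c.backStart cells) (hd : c.backSuture cells a = some d) :
    ∃ x ρ, c.backBite a = [c.support x 4, c.support (x + 1) 4, c.support (x + 2) 4] ∧
      a + 1 = c.girth + 4 * ρ ∧ 1 ≤ ρ ∧ 4 * ρ + 8 ≤ c.rightmost cells ∧
      x + 4 * ρ = 2 * c.width ∧ c.opposite (a + 1) = x := by
  have hg := c.girth_eq
  have ht := h.t_le
  have htc := h.turn_cases
  obtain ⟨b, ρ, -, h1, h2, h3, -⟩ := h.backSuture_cases ha ha' hd
  have hop : c.opposite (a + 1) = 2 * c.width - 4 * ρ := by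
    unfold opposite
    rw [mod_of_ge (by omega) (by omega)]
    omega
  refine ⟨2 * c.width - 4 * ρ, ρ, ?_, h1, h2, h3, by omega, hop⟩
  unfold backBite
  rw [hop]

/-- The start is not in the wrong place. -/
theorem Valid.start_arith (h : c.Valid cells) : ∃ w, c.width = 4 * w ∧ 1 ≤ w ∧ c.t ≤ c.width ∧
    ((c.start = c.t + 1 ∧ c.t < c.width) ∨ (c.start + 1 = c.girth + c.t ∧ 1 ≤ c.t) ∨
      (c.start = c.width + 2 ∧ c.t + 1 = c.width)) := by
  obtain ⟨w, hw, hw'⟩ := h.width_ge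
  refine ⟨w, hw, hw', h.t_le, ?_⟩
  rcases h.start_cases with ⟨-, -, h1⟩ | ⟨p, -, -, h1⟩ <;> omega

theorem horizontal_of_lt {i : ℕ} (h : i < c.width) : c.Horizontal i := by
  have := c.girth_eq
  unfold Horizontal
  rw [mod_of_lt (by omega)]
  exact Or.inl h

theorem horizontal_of_gt {i : ℕ} (h : c.width < i) (h' : i ≤ 2 * c.width) : c.Horizontal i := by
  have := c.girth_eq
  unfold Horizontal
  rw [mod_of_lt (by omega)]
  exact Or.inr ⟨h, h'⟩

theorem horizontal_add_girth {i p : ℕ} (h : i = c.girth + p) (h' : c.Horizontal p) :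
    c.Horizontal i := by
  unfold Horizontal at *
  rwa [h, Nat.add_mod_left]

theorem Valid.horizontal_frontSuture (h : c.Valid cells) {a : ℕ} (ha : c.start ≤ a)
    (ha' : a < c.girth + c.t) (hd : c.frontSuture cells a = some d) : c.Horizontal (a - 1) := by
  obtain ⟨w, hw⟩ := h.start_arith
  obtain ⟨x, -, hx⟩ := h.frontSuture_column ha ha' hd
  rcases hx with ⟨ρ, hx⟩ | ⟨l, hx⟩
  · exact horizontal_of_gt (by omega) (by omega)
  · exact horizontal_of_lt (by omega)

theorem Valid.horizontal_backSuture (h : c.Valid cells) {a : ℕ} (ha : c.t ≤ a)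
    (ha' : a ≤ c.backStart cells) (hd : c.backSuture cells a = some d) :
    c.Horizontal (a + 1) := by
  obtain ⟨x, ρ, -, hx⟩ := h.backSuture_column ha ha' hd
  have := h.turn_cases
  exact horizontal_add_girth (p := 4 * ρ) (by omega) (horizontal_of_lt (by omega))

variable (cells c) in
/-- Column `i` loses its gridface of row `0` to a bite. -/
def FrontBitten (i : ℕ) : Prop := ∃ a ∈ Finset.Ico c.start (c.girth + c.t),
  (c.frontSuture cells a).isSome ∧ c.support i 0 ∈ c.frontBite a

variable (cells c) in
/-- Column `i` loses its gridface of row `4` to a bite. -/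
def BackBitten (i : ℕ) : Prop := ∃ a ∈ Finset.Icc c.t (c.backStart cells),
  (c.backSuture cells a).isSome ∧ c.support i 4 ∈ c.backBite a

/-- A bite has three gridfaces, in the columns `x`, `x - 1`, `x - 2`. In this form conflicts with
bites are decided by linear arithmetic. -/
theorem Valid.frontBitten_arith (h : c.Valid cells) {i : ℕ} (hi : c.start ≤ i)
    (hi' : i < c.girth + c.t) (hb : c.FrontBitten cells i) : ∃ a d x, c.start ≤ a ∧
      a < c.girth + c.t ∧ c.frontSuture cells a = some d ∧ i ≤ x ∧ x ≤ i + 2 ∧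
      ((∃ ρ, a + 4 * ρ = 2 * c.width + 1 ∧ 1 ≤ ρ ∧ 4 * ρ + 4 ≤ c.t ∧ x = c.girth + 4 * ρ) ∨
        ∃ l, a = 4 * l ∧ c.t + 5 ≤ 4 * l ∧ 4 * l < c.width ∧ c.start = c.t + 1 ∧
          x + 4 * l = 2 * c.width + 1) := by
  have hg := c.girth_eq
  obtain ⟨w, hw⟩ := h.start_arith
  obtain ⟨a, ha, hs, hm⟩ := hb
  rw [Finset.mem_Ico] at ha
  obtain ⟨d, hd⟩ := Option.isSome_iff_exists.1 hs
  obtain ⟨x, hx, hx'⟩ := h.frontSuture_column ha.1 ha.2 hd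
  have hx'' : ((∃ ρ, a + 4 * ρ = 2 * c.width + 1 ∧ 1 ≤ ρ ∧ 4 * ρ + 4 ≤ c.t ∧ x = c.girth + 4 * ρ) ∨
        ∃ l, a = 4 * l ∧ c.t + 5 ≤ 4 * l ∧ 4 * l < c.width ∧ c.start = c.t + 1 ∧
          x + 4 * l = 2 * c.width + 1) := by
    rcases hx' with ⟨ρ, hx'⟩ | ⟨l, hx'⟩
    · exact Or.inl ⟨ρ, by omega⟩
    · exact Or.inr ⟨l, by omega⟩
  refine ⟨a, d, x, ha.1, ha.2, hd, ?_⟩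
  rw [hx] at hm
  simp only [List.mem_cons, List.not_mem_nil, or_false] at hm
  have : i ≤ x ∧ x ≤ i + 2 := by
    rcases hm with hm | hm | hm <;>
      have := (support_inj (by omega) (by omega) (by omega) (by omega) hm).2 <;>
      rcases hx' with ⟨ρ, hx'⟩ | ⟨l, hx'⟩ <;> omega
  exact ⟨this.1, this.2, hx''⟩

theorem Valid.backBitten_arith (h : c.Valid cells) {i : ℕ} (hi : c.turn cells < i)
    (hi' : i < c.girth + c.turn cells) (hb : c.BackBitten cells i) : ∃ a d x ρ, c.t ≤ a ∧
      a ≤ c.backStart cells ∧ c.backSuture cells a = some d ∧ x ≤ i ∧ i ≤ x + 2 ∧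
      a + 1 = c.girth + 4 * ρ ∧ 1 ≤ ρ ∧ 4 * ρ + 8 ≤ c.rightmost cells ∧
      x + 4 * ρ = 2 * c.width := by
  have hg := c.girth_eq
  have ht := h.turn_cases
  obtain ⟨w, hw⟩ := h.start_arith
  obtain ⟨a, ha, hs, hm⟩ := hb
  rw [Finset.mem_Icc] at ha
  obtain ⟨d, hd⟩ := Option.isSome_iff_exists.1 hs
  obtain ⟨x, ρ, hx, hx'⟩ := h.backSuture_column ha.1 ha.2 hd
  rw [hx] at hm
  simp only [List.mem_cons, List.not_mem_nil, or_false] at hm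
  have : x ≤ i ∧ i ≤ x + 2 := by
    rcases hm with hm | hm | hm <;>
      have := (support_inj (by omega) (by omega) (by omega) (by omega) hm).2 <;> omega
  exact ⟨a, d, x, ρ, ha.1, ha.2, hd, this.1, this.2, by omega, by omega, by omega, by omega⟩

end Call
end ManhattanTower

/-! ### Unrolling the front spiral -/

namespace ManhattanTower

/-- From any column of panels with `g` on top, the strip leads to one with `f` on top. -/
def Climbs (g : Panel) (ξ : Strip) (f : Panel) : Prop :=
  ∀ σ : List Panel, ∃ τ : List Panel, Unrolls (σ ++ [g]) ξ (τ ++ [f])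

namespace Climbs

variable {g f e : Panel} {ξ ζ : Strip}

theorem nil (g : Panel) : Climbs g [] g := fun σ => ⟨σ, .nil _⟩

theorem trans (h : Climbs g ξ f) (h' : Climbs f ζ e) : Climbs g (ξ ++ ζ) e := fun σ => by
  obtain ⟨τ, h1⟩ := h σ
  obtain ⟨ρ, h2⟩ := h' τ
  exact ⟨ρ, h1.trans h2⟩

theorem up (h : UpAdj g f) (h' : Climbs f ζ e) : Climbs g (⟨some g.1, f.1⟩ :: ζ) e := fun σ => by
  obtain ⟨ρ, h2⟩ := h' (σ ++ [g])
  rw [List.append_assoc] at h2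
  exact ⟨ρ, .up h h2⟩

theorem right (h : RightAdj g f) (h' : Climbs f ζ e) : Climbs g (⟨some g.1, f.1⟩ :: ζ) e :=
  fun σ => by
    obtain ⟨ρ, h2⟩ := h' []
    exact ⟨ρ, .right (by simp) h h2⟩

end Climbs

/-- A recursion unfolds the call `d` from its first to its last gridface on the front edges. -/
def UnrollsCall (recurse : Call → Option GridFace → Strip) (d : Call) : Prop :=
  ∃ rest, (∀ h, recurse d h = ⟨h, d.support d.start 0⟩ :: rest) ∧
    Climbs (d.panel d.start 0 true) rest (d.panel d.t 0 false)

theorem chain_cons (g f : GridFace) (l : List GridFace) :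
    chain g (f :: l) = ⟨some g, f⟩ :: chain f l := rfl

theorem chain_nil (g : GridFace) : chain g [] = [] := rfl

namespace Call

variable {c d : Call} {cells : Finset (ℕ × ℕ)} {recurse : Call → Option GridFace → Strip}

variable (c cells recurse) in
/-- The part of the front spiral in its `q`-th column. -/
def frontStep (h : Option GridFace) (q : ℕ) : Strip :=
  let i := c.start + q
  match c.frontSuture cells i with
  | some d =>
      chain (c.support (i - 1) 0) (c.front (i - 1) :: c.frontBite i) ++
      recurse d (some (c.support (c.opposite (i - 1) - 2) 0)) ++
      chain d.endFace [c.support i 0, c.support i 1]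
  | none =>
      if q = 0 then
        ⟨h, c.support i 0⟩ :: chain (c.support i 0) [c.support i 1]
      else
        chain (c.support (i - 1) 1) [c.support i 1] ++
        (if ∃ a ∈ Finset.Ico c.start (c.girth + c.t),
            (c.frontSuture cells a).isSome ∧ c.support i 0 ∈ c.frontBite a then []
          else chain (c.support i 1) [c.support i 0])

variable (c cells recurse) in
/-- The part of the backward spiral in its `q`-th column. -/
def backwardStep (q : ℕ) : Strip :=
  let i := c.backStart cells - q
  let gap : Strip :=
    if i < c.start then chain (c.support i 2) [c.support i 1, c.support i 0] else []
  let middle : Bool := decide (i + 1 < c.girth + c.t ∧ c.turn cells < i)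
  let down : Strip :=
    (if middle then chain (c.support i 4) [c.support i 3, c.support i 2] else []) ++ gap
  match c.backSuture cells i with
  | some d =>
      chain (c.support (i + 1) 4) (c.back (i + 1) :: c.backBite i) ++
      recurse d (some (c.support (c.opposite (i + 1) + 2) 4)) ++
      chain d.endFace [c.support i 4] ++ down
  | none =>
      if c.girth + c.t ≤ i + 2 then
        (match c.reverseSuture cells, q with
          | some d, 0 => chain d.endFace [c.support i 4]
          | _, _ => chain (c.support (i + 1) 4) [c.support i 4]) ++ down
      else if middle then
        chain (c.support (i + 1) 2) [c.support i 2, c.support i 3] ++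
        (if ∃ a ∈ Finset.Icc c.t (c.backStart cells),
            (c.backSuture cells a).isSome ∧ c.support i 4 ∈ c.backBite a then []
          else chain (c.support i 3) [c.support i 4]) ++ gap
      else
        chain (c.support (i + 1) 2) [c.support i 2] ++ gap

theorem frontSpiral_eq (h : Option GridFace) : c.frontSpiral cells recurse h =
    (List.range (c.girth + c.t - c.start)).flatMap (c.frontStep cells recurse h) := rfl

theorem backwardSpiral_eq : c.backwardSpiral cells recurse =
    (List.range (c.backStart cells + 1 - c.t)).flatMap (c.backwardStep cells recurse) := rfl

/-- The strip of the child is placed above `(i, q)`, and `(j, q)` above its end. The bite was walked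
against the direction of the parent's spiral, which then resumes; hence the change from `u` to `!u`.
-/
theorem Joined.climbs {i j q : ℕ} {u : Bool} (hj : Joined cells c d i j q u)
    (hr : UnrollsCall recurse d) : Climbs (c.panel i q u)
      (recurse d (some (c.support i q)) ++ [⟨some d.endFace, c.support j q⟩]) (c.panel j q (!u)) := by
  obtain ⟨rest, h1, h2⟩ := hr
  rw [h1]
  exact Climbs.up hj.enter (h2.trans (Climbs.up hj.leave (Climbs.nil _)))

/-- The strip across the front face and the first gridface of the bite go below row 0 of column `i -
1`, so row 0 must be at the bottom there. The rest of the bite goes to the right and the child is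
put on top of it. -/
theorem Valid.climbs_frontSuture (h : c.Valid cells) {i : ℕ} (hi : c.start ≤ i)
    (hi' : i < c.girth + c.t) (hd : c.frontSuture cells i = some d) (hr : UnrollsCall recurse d) :
    ∃ τ, Unrolls [c.panel (i - 1) 0 true, c.panel (i - 1) 1 true]
      (chain (c.support (i - 1) 0) (c.front (i - 1) :: c.frontBite i) ++
        recurse d (some (c.support (c.opposite (i - 1) - 2) 0)) ++
        chain d.endFace [c.support i 0, c.support i 1]) (τ ++ [c.panel i 1 true]) := by
  have hw := h.isBox.1
  have hh := h.horizontal_frontSuture hi hi' hd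
  obtain ⟨w, hw4⟩ := h.start_arith
  obtain ⟨x, -, hx⟩ := h.frontSuture_column hi hi' hd
  have hop : 2 ≤ c.opposite (i - 1) := by
    rcases hx with ⟨ρ, hx⟩ | ⟨l, hx⟩ <;> omega
  have hj := h.joined_front hi hi' hd
  have h1 := (hj.climbs hr).trans (Climbs.up (upAdj_panel hw i (q := 0) (by omega)) (Climbs.nil _))
  obtain ⟨τ, h2⟩ := h1 []
  refine ⟨τ, ?_⟩
  simp only [frontBite, chain_cons, chain_nil, List.cons_append, List.nil_append]
  refine .down (upAdj_front hw hh) (.down (upAdj_opposite_front hw hh) ?_)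
  have e1 := rightAdj_panel_backward hw (c.opposite (i - 1) - 1) (q := 0) (by omega)
  have e2 := rightAdj_panel_backward hw (c.opposite (i - 1) - 2) (q := 0) (by omega)
  rw [Nat.sub_add_cancel (by omega)] at e1
  rw [show c.opposite (i - 1) - 2 + 1 = c.opposite (i - 1) - 1 by omega] at e2
  refine .right (by simp) e1 (.right (by simp) e2 ?_)
  simp only [List.append_assoc, List.nil_append, List.cons_append] at h2 ⊢
  exact h2

theorem Valid.unrolls_frontSpiral (h : c.Valid cells)
    (hr : ∀ i d, c.start ≤ i → i < c.girth + c.t → c.frontSuture cells i = some d →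
      UnrollsCall recurse d) :
    ∃ rest, (∀ h, c.frontSpiral cells recurse h = ⟨h, c.support c.start 0⟩ :: rest) ∧
      Climbs (c.panel c.start 0 true) rest (c.panel (c.girth + c.t - 1) 1 true) := by
  have hg := c.girth_eq
  have hw := h.isBox.1
  have hsb := h.start_bounds
  obtain ⟨w, hw4⟩ := h.start_arith
  -- After each column row 1 is on top, and if a child is met next, the planar column consists of
  -- rows 0 and 1 only. By the positions of sutures and bites, the column before a suture is neither
  -- the first, nor bitten, nor itself a suture.
  have key : ∀ k, c.start + k < c.girth + c.t → ∃ rest,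
      (∀ hinge, (List.range (k + 1)).flatMap (c.frontStep cells recurse hinge) =
          ⟨hinge, c.support c.start 0⟩ :: rest) ∧
      ∀ σ, ∃ τ, Unrolls (σ ++ [c.panel c.start 0 true]) rest τ ∧
        (∃ l, τ = l ++ [c.panel (c.start + k) 1 true]) ∧
        (c.start + k + 1 < c.girth + c.t → (c.frontSuture cells (c.start + k + 1)).isSome →
          τ = [c.panel (c.start + k) 0 true, c.panel (c.start + k) 1 true]) := by
    intro k
    induction k with
    | zero =>
      intro hk
      have h0 : c.frontSuture cells c.start = none := by
        cases e : c.frontSuture cells c.start with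
        | none => rfl
        | some d =>
          obtain ⟨x, -, hx⟩ := h.frontSuture_column le_rfl hsb.2 e
          rcases hx with ⟨ρ, hx⟩ | ⟨l, hx⟩ <;> omega
      refine ⟨[⟨some (c.support c.start 0), c.support c.start 1⟩], fun hinge => ?_, fun σ => ?_⟩
      · simp [frontStep, h0, chain]
      · refine ⟨_, .up (upAdj_panel hw c.start (q := 0) (by omega)) (.nil _),
          ⟨σ ++ [c.panel c.start 0 true], by simp⟩, fun h1 h2 => ?_⟩
        obtain ⟨d, e⟩ := Option.isSome_iff_exists.1 h2
        obtain ⟨x, -, hx⟩ := h.frontSuture_column (by omega) h1 e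
        rcases hx with ⟨ρ, hx⟩ | ⟨l, hx⟩ <;> omega
    | succ k ih =>
      intro hk
      obtain ⟨rest, h1, h2⟩ := ih (by omega)
      rw [← add_assoc] at hk ⊢
      cases e : c.frontSuture cells (c.start + k + 1) with
      | some d =>
        refine ⟨rest ++ (chain (c.support (c.start + k) 0)
          (c.front (c.start + k) :: c.frontBite (c.start + k + 1)) ++
            recurse d (some (c.support (c.opposite (c.start + k) - 2) 0)) ++
            chain d.endFace [c.support (c.start + k + 1) 0, c.support (c.start + k + 1) 1]),
          fun hinge => ?_, fun σ => ?_⟩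
        · rw [List.range_succ, List.flatMap_append, h1 hinge]
          simp [frontStep, ← add_assoc, e]
        · obtain ⟨τ, h3, -, h5⟩ := h2 σ
          rw [h5 hk (by rw [e]; rfl)] at h3
          obtain ⟨τ', h6⟩ := h.climbs_frontSuture (by omega) hk e (hr _ _ (by omega) hk e)
          refine ⟨_, h3.trans h6, ⟨τ', rfl⟩, fun h7 h8 => ?_⟩
          obtain ⟨d', e'⟩ := Option.isSome_iff_exists.1 h8
          obtain ⟨x, -, hx⟩ := h.frontSuture_column (by omega) h7 e'
          obtain ⟨x', -, hx'⟩ := h.frontSuture_column (by omega) hk e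
          rcases hx with ⟨ρ, hx⟩ | ⟨l, hx⟩ <;> rcases hx' with ⟨ρ', hx'⟩ | ⟨l', hx'⟩ <;> omega
      | none =>
        have hright := rightAdj_panel hw (c.start + k) (q := 1) (by omega)
        by_cases hb : c.FrontBitten cells (c.start + k + 1)
        · refine ⟨rest ++ [⟨some (c.support (c.start + k) 1), c.support (c.start + k + 1) 1⟩],
            fun hinge => ?_, fun σ => ?_⟩
          · rw [List.range_succ, List.flatMap_append, h1 hinge]
            have hb' := hb
            unfold FrontBitten at hb'
            simp only [frontStep, List.flatMap_cons, List.flatMap_nil, List.append_nil, ← add_assoc, e,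
              Nat.add_eq_zero_iff, one_ne_zero, and_false, if_false, hb', if_true]
            simp [chain]
          · obtain ⟨τ, h3, ⟨l, rfl⟩, -⟩ := h2 σ
            refine ⟨_, h3.trans (.right (by simp) hright (.nil _)), ⟨[], rfl⟩, fun h7 h8 => ?_⟩
            obtain ⟨d', e'⟩ := Option.isSome_iff_exists.1 h8
            obtain ⟨x, -, hx⟩ := h.frontSuture_column (by omega) h7 e'
            obtain ⟨a, d'', x', ha, ha', e'', hxi, hxi', hx'⟩ := h.frontBitten_arith (by omega) hk hb
            rcases hx with ⟨ρ, hx⟩ | ⟨l, hx⟩ <;> rcases hx' with ⟨ρ', hx'⟩ | ⟨l', hx'⟩ <;> omega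
        · refine ⟨rest ++ [⟨some (c.support (c.start + k) 1), c.support (c.start + k + 1) 1⟩,
            ⟨some (c.support (c.start + k + 1) 1), c.support (c.start + k + 1) 0⟩],
            fun hinge => ?_, fun σ => ?_⟩
          · rw [List.range_succ, List.flatMap_append, h1 hinge]
            have hb' := hb
            unfold FrontBitten at hb'
            simp only [frontStep, List.flatMap_cons, List.flatMap_nil, List.append_nil, ← add_assoc, e,
              Nat.add_eq_zero_iff, one_ne_zero, and_false, if_false, hb']
            simp [chain]
          · obtain ⟨τ, h3, ⟨l, rfl⟩, -⟩ := h2 σ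
            exact ⟨_, h3.trans (.right (by simp) hright
              (.down (upAdj_panel hw (c.start + k + 1) (q := 0) (by omega)) (.nil _))),
              ⟨[_], rfl⟩, fun _ _ => rfl⟩
  obtain ⟨rest, h1, h2⟩ := key (c.girth + c.t - c.start - 1) (by omega)
  rw [show c.girth + c.t - c.start - 1 + 1 = c.girth + c.t - c.start by omega] at h1
  rw [show c.start + (c.girth + c.t - c.start - 1) = c.girth + c.t - 1 by omega] at h2
  refine ⟨rest, fun hinge => (frontSpiral_eq hinge).trans (h1 hinge), fun σ => ?_⟩
  obtain ⟨τ, h3, ⟨l, rfl⟩, -⟩ := h2 σ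
  exact ⟨l, h3⟩

end Call
end ManhattanTower

/-! ### Unrolling the second cycle -/

namespace ManhattanTower

namespace Call

variable {c d : Call} {cells : Finset (ℕ × ℕ)} {recurse : Call → Option GridFace → Strip}

/-- The hinge is numbered one turn later, because the column before `t` would have the number `t -
1`, which is truncated at `t = 0`. -/
theorem Valid.climbs_thirdRow (h : c.Valid cells) (k : ℕ) :
    Climbs (c.panel (c.girth + c.t - 1) 3 true)
      ((List.range k).flatMap fun q =>
        chain (c.support (c.girth + c.t + q - 1) 3) [c.support (c.t + q) 3])
      (c.panel (c.girth + c.t + k - 1) 3 true) := by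
  have hg := c.girth_eq
  have hw := h.isBox.1
  induction k with
  | zero => exact Climbs.nil _
  | succ k ih =>
    rw [List.range_succ, List.flatMap_append]
    refine ih.trans ?_
    have e1 := rightAdj_panel hw (c.girth + c.t + k - 1) (q := 3) (by omega)
    rw [show c.girth + c.t + k - 1 + 1 = c.girth + (c.t + k) by omega] at e1
    rw [show c.girth + c.t + (k + 1) - 1 = c.girth + (c.t + k) by omega]
    have := Climbs.right e1 (Climbs.nil _)
    simp only [List.flatMap_cons, List.flatMap_nil, List.append_nil, chain_cons, chain_nil]
    rwa [panel_of_eq_add_girth _ _ rfl] at this ⊢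

theorem Valid.climbs_secondCycle (h : c.Valid cells) :
    Climbs (c.panel (c.girth + c.t - 1) 1 true) (c.secondCycle cells)
      (if c.rightmost cells = 0 then c.panel (c.width - 1) 4 false
        else c.panel (c.turn cells) 4 true) := by
  have hg := c.girth_eq
  have hw := h.isBox.1
  obtain ⟨w, hw4⟩ := h.start_arith
  have htc := h.turn_cases
  have hup : Climbs (c.panel (c.girth + c.t - 1) 1 true)
      (chain (c.support (c.girth + c.t - 1) 1)
        [c.support (c.girth + c.t - 1) 2, c.support (c.girth + c.t - 1) 3])
      (c.panel (c.girth + c.t - 1) 3 true) :=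
    Climbs.up (upAdj_panel hw _ (q := 1) (by omega))
      (Climbs.up (upAdj_panel hw _ (q := 2) (by omega)) (Climbs.nil _))
  unfold secondCycle
  rw [List.append_assoc]
  refine hup.trans ?_
  by_cases h0 : c.rightmost cells = 0
  · rw [if_pos h0, if_pos h0]
    rw [show c.turn cells + 1 - c.t = (c.width + 1 - c.t) + 1 by omega, List.range_succ,
      List.flatMap_append, List.append_assoc]
    have h1 := h.climbs_thirdRow (c.width + 1 - c.t)
    rw [show c.girth + c.t + (c.width + 1 - c.t) - 1 = c.girth + c.width by omega,
      panel_of_eq_add_girth _ _ rfl] at h1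
    refine h1.trans ?_
    simp only [List.flatMap_cons, List.flatMap_nil, List.append_nil, chain_cons, chain_nil,
      List.cons_append, List.nil_append]
    rw [show c.girth + c.t + (c.width + 1 - c.t) - 1 = c.girth + c.width by omega,
      support_of_eq_add_girth _ rfl, show c.t + (c.width + 1 - c.t) = c.width + 1 by omega]
    intro σ
    have hh : c.Horizontal (c.width + 1) := horizontal_of_gt (by omega) (by omega)
    have hop : c.opposite (c.width + 1) = c.width - 1 := by
      unfold opposite
      rw [mod_of_lt (by omega)]
      omega
    have e1 := upAdj_panel hw c.width (q := 3) (by omega)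
    have e2 := rightAdj_panel hw c.width (q := 3) (by omega)
    have e3 := upAdj_panel hw (c.width + 1) (q := 3) (by omega)
    -- Turned around: the strip goes up from the bottom over the back face and arrives on the top
    -- with the front above, as the backward spiral needs it.
    have e4 := (upAdj_back hw hh).flip
    have e5 := (upAdj_opposite_back hw hh).flip
    rw [flip_panel] at e4 e5
    rw [hop] at e5
    obtain ⟨τ, h2⟩ := Climbs.up e3 (Climbs.up e4 (Climbs.up e5 (Climbs.nil _))) []
    -- The strip lists row 3 of column `width + 1` before row 4 of column `width`. The latter must
    -- be placed before a new planar column begins, and neither hangs on the other.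
    refine ⟨τ, .swap (fun g hg => ?_) (.up e1 (.right (by simp) e2 h2))⟩
    simp only [Option.some.injEq] at hg
    rw [← hg]
    intro h3
    have := (support_inj_mod (by omega) (by omega) h3).1
    omega
  · rw [if_neg h0, if_neg h0]
    have h1 := h.climbs_thirdRow (c.turn cells + 1 - c.t)
    rw [show c.girth + c.t + (c.turn cells + 1 - c.t) - 1 = c.girth + c.turn cells by omega,
      panel_of_eq_add_girth _ _ rfl] at h1
    exact h1.trans (Climbs.up (upAdj_panel hw _ (q := 3) (by omega)) (Climbs.nil _))

variable (c cells) in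
/-- What the backward spiral needs to know of the column of panels after column `i`. -/
structure BackState (i : ℕ) (τ : List Panel) : Prop where
  fourth : c.girth + c.t ≤ i + 1 → c.panel i 4 false ∈ τ
  second : i + 1 < c.girth + c.t → c.panel i 2 false ∈ τ
  suture : c.t < i → (c.backSuture cells (i - 1)).isSome → ∃ l, τ = c.panel i 4 false :: l
  gap : i < c.start → ∃ l, τ = l ++ [c.panel i 0 false]

/-- Panels are turned here, so the rows decrease upwards. Where the front spiral did not pass, row 0
ends up on top; in column `t` this is the last gridface of the call. -/
theorem Valid.unrolls_gap (h : c.Valid cells) (i : ℕ) (l : List Panel) :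
    ∃ l', Unrolls (l ++ [c.panel i 2 false])
      (if i < c.start then chain (c.support i 2) [c.support i 1, c.support i 0] else [])
      (l ++ c.panel i 2 false :: l') ∧
      (i < c.start → ∃ l'', l ++ c.panel i 2 false :: l' = l'' ++ [c.panel i 0 false]) := by
  have hw := h.isBox.1
  by_cases hi : i < c.start
  · rw [if_pos hi]
    refine ⟨[c.panel i 1 false, c.panel i 0 false], ?_, fun _ =>
      ⟨l ++ [c.panel i 2 false, c.panel i 1 false], by simp⟩⟩
    have h2 : Unrolls ((l ++ [c.panel i 2 false]) ++ [c.panel i 1 false])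
        [⟨some (c.support i 1), c.support i 0⟩] ((l ++ [c.panel i 2 false]) ++
          [c.panel i 1 false, c.panel i 0 false]) :=
      .up (upAdj_panel_backward hw i (q := 0) (by omega)) (.nil _)
    simp only [List.append_assoc, List.cons_append, List.nil_append] at h2
    exact .up (upAdj_panel_backward hw i (q := 1) (by omega)) h2
  · rw [if_neg hi]
    exact ⟨[], .nil _, fun h => absurd h hi⟩

theorem Valid.unrolls_down (h : c.Valid cells) {i : ℕ}
    (hi : i < c.start → i + 1 < c.girth + c.t ∧ c.turn cells < i) (l : List Panel) :
    ∃ l', Unrolls (l ++ [c.panel i 4 false])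
      ((if decide (i + 1 < c.girth + c.t ∧ c.turn cells < i) then
          chain (c.support i 4) [c.support i 3, c.support i 2] else []) ++
        (if i < c.start then chain (c.support i 2) [c.support i 1, c.support i 0] else []))
      (l ++ c.panel i 4 false :: l') ∧
      (i + 1 < c.girth + c.t ∧ c.turn cells < i → c.panel i 2 false ∈ l') ∧
      (i < c.start → ∃ l'', l ++ c.panel i 4 false :: l' = l'' ++ [c.panel i 0 false]) := by
  have hw := h.isBox.1
  by_cases hm : i + 1 < c.girth + c.t ∧ c.turn cells < i
  · simp only [hm, and_self, decide_true, if_true]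
    obtain ⟨l', h1, h2⟩ := h.unrolls_gap i (l ++ [c.panel i 4 false, c.panel i 3 false])
    have h3 : Unrolls ((l ++ [c.panel i 4 false]) ++ [c.panel i 3 false])
        [⟨some (c.support i 3), c.support i 2⟩] ((l ++ [c.panel i 4 false]) ++
          [c.panel i 3 false, c.panel i 2 false]) :=
      .up (upAdj_panel_backward hw i (q := 2) (by omega)) (.nil _)
    simp only [List.append_assoc, List.cons_append, List.nil_append] at h1 h2 h3
    exact ⟨c.panel i 3 false :: c.panel i 2 false :: l',
      (Unrolls.up (upAdj_panel_backward hw i (q := 3) (by omega)) h3).trans h1, by simp, h2⟩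
  · have hi' : ¬ i < c.start := fun h' => hm (hi h')
    simp only [hm, decide_false, Bool.false_eq_true, if_false, hi', List.append_nil]
    exact ⟨[], .nil _, fun h => h.elim, fun h => h.elim⟩

end Call
end ManhattanTower

/-! ### Unrolling the backward spiral -/

namespace ManhattanTower

namespace Call

variable {c d : Call} {cells : Finset (ℕ × ℕ)} {recurse : Call → Option GridFace → Strip}

theorem Valid.backSuture_arith (h : c.Valid cells) {a : ℕ} (ha : c.t ≤ a)
    (ha' : a ≤ c.backStart cells) (hs : (c.backSuture cells a).isSome) :
    ∃ ρ, a + 1 = c.girth + 4 * ρ ∧ 1 ≤ ρ ∧ 4 * ρ + 8 ≤ c.rightmost cells := by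
  obtain ⟨d, hd⟩ := Option.isSome_iff_exists.1 hs
  obtain ⟨x, ρ, -, h1, h2, h3, -⟩ := h.backSuture_column ha ha' hd
  exact ⟨ρ, h1, h2, h3⟩

/-- The counterpart of `climbs_frontSuture`: row 4 of column `i + 1` is at the bottom of its planar
column, and the strip across the back face and the bite are attached below it. -/
theorem Valid.unrolls_backSuture (h : c.Valid cells) {q : ℕ}
    (hq : c.t + q ≤ c.backStart cells) (hd : c.backSuture cells (c.backStart cells - q) = some d)
    (hr : UnrollsCall recurse d) (l : List Panel) :
    ∃ τ, Unrolls (c.panel (c.backStart cells - q + 1) 4 false :: l)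
      (c.backwardStep cells recurse q) τ ∧ c.BackState cells (c.backStart cells - q) τ := by
  have hg := c.girth_eq
  have hw := h.isBox.1
  have htc := h.turn_cases
  obtain ⟨w, hw4⟩ := h.start_arith
  unfold backwardStep
  simp only [hd]
  generalize hi : c.backStart cells - q = i at *
  have hti : c.t ≤ i := by omega
  have hib : i ≤ c.backStart cells := by omega
  have hh := h.horizontal_backSuture hti hib hd
  obtain ⟨ρ, h1, h2, h3⟩ := h.backSuture_arith hti hib (by rw [hd]; rfl)
  have hj := h.joined_back hti hib hd
  obtain ⟨τ, h4⟩ := hj.climbs hr []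
  have hmid : c.turn cells < i := by omega
  obtain ⟨l', h5, h6, h7⟩ := h.unrolls_down (i := i) (fun hlt => by omega) τ
  refine ⟨_, Unrolls.trans ?_ h5, ⟨fun _ => by simp, fun h8 => ?_, fun h8 h9 => ?_, h7⟩⟩
  · simp only [backBite, chain_cons, chain_nil, List.cons_append, List.nil_append]
    refine .down (upAdj_back hw hh) (.down (upAdj_opposite_back hw hh) ?_)
    have e1 := rightAdj_panel hw (c.opposite (i + 1)) (q := 4) (by omega)
    have e2 := rightAdj_panel hw (c.opposite (i + 1) + 1) (q := 4) (by omega)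
    exact .right (by simp) e1 (.right (by simp) e2 h4)
  · exact List.mem_append_right _ (List.mem_cons_of_mem _ (h6 ⟨h8, hmid⟩))
  · obtain ⟨ρ', h10⟩ := h.backSuture_arith (by omega) (by omega) h9
    omega

/-- The first column hangs either on the gridface reached across the back face or on the end of the
rightmost child. -/
theorem Valid.unrolls_backwardStep_zero (h : c.Valid cells)
    (hr : ∀ d, c.reverseSuture cells = some d → UnrollsCall recurse d) (σ : List Panel) :
    ∃ τ, Unrolls (σ ++ [if c.rightmost cells = 0 then c.panel (c.width - 1) 4 false
        else c.panel (c.turn cells) 4 true])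
      ((match c.reverseSuture cells with
        | some d => recurse d (some (c.support (c.turn cells) 4))
        | none => []) ++ c.backwardStep cells recurse 0) τ ∧
      c.BackState cells (c.backStart cells) τ := by
  have hg := c.girth_eq
  have hw := h.isBox.1
  have htc := h.turn_cases
  obtain ⟨w, hw4⟩ := h.start_arith
  have hnone : c.backSuture cells (c.backStart cells) = none := by
    rw [← Option.not_isSome_iff_eq_none]
    intro hs
    obtain ⟨ρ, h1⟩ := h.backSuture_arith (by omega) le_rfl hs
    omega
  have hno : c.t < c.backStart cells → ¬ (c.backSuture cells (c.backStart cells - 1)).isSome :=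
    fun hlt hs => by
      obtain ⟨ρ, h1⟩ := h.backSuture_arith (by omega) (by omega) hs
      omega
  have hstate : ∀ τ l', (c.backStart cells + 1 < c.girth + c.t ∧ c.turn cells < c.backStart cells →
        c.panel (c.backStart cells) 2 false ∈ l') →
      (c.backStart cells < c.start → ∃ l'', τ ++ c.panel (c.backStart cells) 4 false :: l' =
        l'' ++ [c.panel (c.backStart cells) 0 false]) →
      c.BackState cells (c.backStart cells) (τ ++ c.panel (c.backStart cells) 4 false :: l') := by
    refine fun τ l' h6 h7 => ⟨fun _ => by simp, fun h8 => ?_, fun h8 h9 => absurd h9 (hno h8), h7⟩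
    exact List.mem_append_right _ (List.mem_cons_of_mem _ (h6 ⟨h8, by omega⟩))
  unfold backwardStep
  rw [Nat.sub_zero]
  simp only [hnone]
  have hA : c.girth + c.t ≤ c.backStart cells + 2 := by omega
  rw [if_pos hA]
  by_cases h0 : c.rightmost cells = 0
  · rw [if_pos h0, h.reverseSuture_of_rightmost h0]
    obtain ⟨l', h5, h6, h7⟩ := h.unrolls_down (i := c.backStart cells) (fun hlt => by omega) []
    refine ⟨_, ?_, hstate _ _ h6 h7⟩
    have e1 := rightAdj_panel_backward hw (c.backStart cells) (q := 4) (by omega)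
    have e2 := c.support_of_eq_add_girth (i := c.backStart cells + 1) (p := c.width - 1) 4 (by omega)
    rw [c.panel_of_eq_add_girth (i := c.backStart cells + 1) (p := c.width - 1) _ _ (by omega)] at e1
    rw [e2]
    exact .right (by simp) e1 h5
  · obtain ⟨d, hd⟩ := h.exists_reverseSuture h0
    rw [if_neg h0, hd]
    simp only
    have hj := h.joined_reverse hd
    obtain ⟨τ, h4⟩ := hj.climbs (hr d hd) σ
    obtain ⟨l', h5, h6, h7⟩ := h.unrolls_down (i := c.backStart cells) (fun hlt => by omega) τ
    refine ⟨_, ?_, hstate _ _ h6 h7⟩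
    rw [chain_cons, chain_nil, ← List.append_assoc]
    exact h4.trans h5

theorem Valid.unrolls_backwardStep (h : c.Valid cells) {q : ℕ}
    (hq : c.t + (q + 1) ≤ c.backStart cells)
    (hr : ∀ d, c.backSuture cells (c.backStart cells - (q + 1)) = some d → UnrollsCall recurse d)
    {σ : List Panel} (hσ : c.BackState cells (c.backStart cells - q) σ) :
    ∃ τ, Unrolls σ (c.backwardStep cells recurse (q + 1)) τ ∧
      c.BackState cells (c.backStart cells - (q + 1)) τ := by
  have hg := c.girth_eq
  have hw := h.isBox.1
  have htc := h.turn_cases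
  obtain ⟨w, hw4⟩ := h.start_arith
  cases hd : c.backSuture cells (c.backStart cells - (q + 1)) with
  | some d =>
    obtain ⟨l, rfl⟩ := hσ.suture (by omega) (by
      rw [show c.backStart cells - q - 1 = c.backStart cells - (q + 1) by omega, hd]; rfl)
    have := h.unrolls_backSuture hq hd (hr d hd) l
    rwa [show c.backStart cells - (q + 1) + 1 = c.backStart cells - q by omega] at this
  | none =>
    unfold backwardStep
    simp only [hd]
    have hi' : c.backStart cells - q = c.backStart cells - (q + 1) + 1 := by omega
    rw [hi'] at hσ
    generalize hi : c.backStart cells - (q + 1) = i at *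
    have hti : c.t ≤ i := by omega
    have hib : i + 1 ≤ c.backStart cells := by omega
    -- This first stretch, in row 4, includes column `girth + t - 2`, which is entered in row 4 and
    -- where the walk changes to row 2. Later columns are entered in row 2, and rows 3 and 4 are
    -- added unless the second cycle covers that column.
    by_cases hA : c.girth + c.t ≤ i + 2
    · rw [if_pos hA]
      obtain ⟨l', h5, h6, h7⟩ := h.unrolls_down (i := i) (fun hlt => by omega) []
      refine ⟨_, ?_, ⟨fun _ => by simp, fun h8 => ?_, fun h8 h9 => ⟨l', rfl⟩, h7⟩⟩
      · have e1 := Unrolls.right (hσ.fourth (by omega))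
          (rightAdj_panel_backward hw i (q := 4) (by omega)) h5
        cases c.reverseSuture cells <;> exact e1
      · exact List.mem_cons_of_mem _ (h6 ⟨h8, by omega⟩)
    · rw [if_neg hA]
      have e1 := rightAdj_panel_backward hw i (q := 2) (by omega)
      have hmem := hσ.second (by omega)
      by_cases hm : c.turn cells < i
      · rw [if_pos (by simp; omega)]
        have e2 := upAdj_panel_backward hw i (q := 2) (by omega)
        have e3 := upAdj_panel_backward hw i (q := 3) (by omega)
        by_cases hb : c.BackBitten cells i
        · have hb' := hb
          unfold BackBitten at hb'
          rw [if_pos hb']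
          obtain ⟨l', h5, h6⟩ := h.unrolls_gap i [c.panel i 3 false]
          refine ⟨_, .right hmem e1 (.down e2 h5),
            ⟨fun _ => by omega, fun h8 => by simp, fun h8 h9 => ?_, h6⟩⟩
          obtain ⟨ρ, h10⟩ := h.backSuture_arith (by omega) (by omega) h9
          obtain ⟨a, d, x, ρ', -, -, -, hx⟩ := h.backBitten_arith hm (by omega) hb
          omega
        · have hb' := hb
          unfold BackBitten at hb'
          rw [if_neg hb']
          obtain ⟨l', h5, h6⟩ := h.unrolls_gap i [c.panel i 4 false, c.panel i 3 false]
          exact ⟨_, .right hmem e1 (.down e2 (.down e3 h5)),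
            ⟨fun _ => by omega, fun h8 => by simp, fun h8 h9 => ⟨_, rfl⟩, h6⟩⟩
      · rw [if_neg (by simp; omega)]
        obtain ⟨l', h5, h6⟩ := h.unrolls_gap i []
        refine ⟨_, .right hmem e1 h5,
          ⟨fun _ => by omega, fun h8 => by simp, fun h8 h9 => ?_, h6⟩⟩
        obtain ⟨ρ, h10⟩ := h.backSuture_arith (by omega) (by omega) h9
        omega

/-- `BackState` is the invariant from column to column. Column `t` comes before `start`, so at the
end its clause `gap` puts row 0 of column `t` on top. -/
theorem Valid.climbs_backwardSpiral (h : c.Valid cells)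
    (hr : ∀ d, c.reverseSuture cells = some d → UnrollsCall recurse d)
    (hr' : ∀ i d, c.t ≤ i → i ≤ c.backStart cells → c.backSuture cells i = some d →
      UnrollsCall recurse d) :
    Climbs (if c.rightmost cells = 0 then c.panel (c.width - 1) 4 false
        else c.panel (c.turn cells) 4 true)
      ((match c.reverseSuture cells with
        | some d => recurse d (some (c.support (c.turn cells) 4))
        | none => []) ++ c.backwardSpiral cells recurse) (c.panel c.t 0 false) := by
  have hg := c.girth_eq
  have htc := h.turn_cases
  obtain ⟨w, hw4⟩ := h.start_arith
  intro σ
  have key : ∀ k, c.t + k ≤ c.backStart cells → ∃ τ,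
      Unrolls (σ ++ [if c.rightmost cells = 0 then c.panel (c.width - 1) 4 false
        else c.panel (c.turn cells) 4 true])
      ((match c.reverseSuture cells with
        | some d => recurse d (some (c.support (c.turn cells) 4))
        | none => []) ++ (List.range (k + 1)).flatMap (c.backwardStep cells recurse)) τ ∧
      c.BackState cells (c.backStart cells - k) τ := by
    intro k
    induction k with
    | zero =>
      intro _
      have := h.unrolls_backwardStep_zero hr σ
      simpa using this
    | succ k ih =>
      intro hk
      obtain ⟨τ, h1, h2⟩ := ih (by omega)
      obtain ⟨τ', h3, h4⟩ := h.unrolls_backwardStep hk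
        (fun d hd => hr' _ d (by omega) (by omega) hd) h2
      refine ⟨τ', ?_, h4⟩
      rw [List.range_succ, List.flatMap_append, ← List.append_assoc]
      simpa using h1.trans h3
  obtain ⟨τ, h1, h2⟩ := key (c.backStart cells - c.t) (by omega)
  rw [show c.backStart cells - (c.backStart cells - c.t) = c.t by omega] at h2
  rw [backwardSpiral_eq, show c.backStart cells + 1 - c.t = c.backStart cells - c.t + 1 by omega]
  obtain ⟨l, rfl⟩ := h2.gap (by omega)
  exact ⟨l, h1⟩

/-- A call unfolds from its first to its last gridface if all of its subcalls do. -/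
theorem Valid.unrollsCall (h : c.Valid cells) {depth : ℕ}
    (hr : ∀ d, IsSubcall cells c d → UnrollsCall (unfoldDepth cells depth) d) :
    UnrollsCall (unfoldDepth cells (depth + 1)) c := by
  obtain ⟨rest, h1, h2⟩ := h.unrolls_frontSpiral (recurse := unfoldDepth cells depth)
    fun i d hi hi' hd => hr d (Or.inl ⟨i, Finset.mem_Ico.2 ⟨hi, hi'⟩, hd⟩)
  have h3 := h.climbs_backwardSpiral (recurse := unfoldDepth cells depth)
    (fun d hd => hr d (Or.inr (Or.inl hd)))
    fun i d hi hi' hd => hr d (Or.inr (Or.inr ⟨i, Finset.mem_Icc.2 ⟨hi, hi'⟩, hd⟩))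
  refine ⟨_, fun hinge => ?_, (h2.trans h.climbs_secondCycle).trans h3⟩
  rw [unfoldDepth, h1]
  simp only [List.cons_append, List.append_assoc]

end Call
end ManhattanTower

/-! ### Separating the gridfaces of a call from those of its subcalls -/

namespace ManhattanTower

theorem map_face_chain (g : GridFace) (l : List GridFace) : (chain g l).map Step.face = l := by
  induction l generalizing g with
  | nil => rfl
  | cons f l ih => rw [chain_cons, List.map_cons, ih]

/-- Up to order, what recursive calls contribute to the single steps can be moved behind everything
else. -/
theorem map_face_flatMap_perm {α : Type*} (l : List α) {F F₀ : α → Strip} {s : α → Option Call}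
    {G : Call → List GridFace}
    (h : ∀ q ∈ l, ((F q).map Step.face).Perm ((F₀ q).map Step.face ++ (s q).toList.flatMap G)) :
    ((l.flatMap F).map Step.face).Perm
      ((l.flatMap F₀).map Step.face ++ (l.filterMap s).flatMap G) := by
  induction l with
  | nil => simp
  | cons q l ih =>
    have h1 := (h q (by simp)).append (ih fun q' hq' => h q' (by simp [hq']))
    have h2 : (List.filterMap s (q :: l)).flatMap G =
        (s q).toList.flatMap G ++ (l.filterMap s).flatMap G := by
      cases e : s q <;> simp [e]
    rw [List.flatMap_cons, List.flatMap_cons, List.map_append, List.map_append, h2]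
    refine h1.trans ?_
    simp only [List.append_assoc]
    refine List.Perm.append_left _ ?_
    simp only [← List.append_assoc]
    exact List.Perm.append_right _ List.perm_append_comm

theorem UnrollsCall.map_face {recurse : Call → Option GridFace → Strip} {d : Call}
    (h : UnrollsCall recurse d) (g : Option GridFace) :
    (recurse d g).map Step.face = (recurse d none).map Step.face := by
  obtain ⟨rest, h1, -⟩ := h
  rw [h1, h1]
  rfl

namespace Call

variable (c : Call) (cells : Finset (ℕ × ℕ))

/-- The gridfaces that a call unfolds itself. -/
def ownFaces : List GridFace :=
  (c.frontSpiral cells (fun _ _ => []) none ++ c.secondCycle cells ++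
    c.backwardSpiral cells fun _ _ => []).map Step.face

/-- The calls that a call makes directly. -/
def subcalls : List Call :=
  (List.range (c.girth + c.t - c.start)).filterMap (fun q => c.frontSuture cells (c.start + q)) ++
    (c.reverseSuture cells).toList ++
    (List.range (c.backStart cells + 1 - c.t)).filterMap
      fun q => c.backSuture cells (c.backStart cells - q)

variable {c cells} {d : Call} {recurse : Call → Option GridFace → Strip}

theorem mem_subcalls (ht : c.t ≤ c.backStart cells + 1) : d ∈ c.subcalls cells ↔ IsSubcall cells c d := by
  unfold subcalls IsSubcall
  simp only [List.mem_append, List.mem_filterMap, List.mem_range, Option.mem_toList,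
    Finset.mem_Ico, Finset.mem_Icc, or_assoc]
  refine or_congr ?_ (or_congr Iff.rfl ?_)
  · constructor
    · rintro ⟨q, hq, h⟩
      exact ⟨_, ⟨by omega, by omega⟩, h⟩
    · rintro ⟨i, hi, h⟩
      exact ⟨i - c.start, by omega, by rwa [show c.start + (i - c.start) = i by omega]⟩
  · constructor
    · rintro ⟨q, hq, h⟩
      exact ⟨_, ⟨by omega, by omega⟩, h⟩
    · rintro ⟨i, hi, h⟩
      exact ⟨c.backStart cells - i, by omega,
        by rwa [show c.backStart cells - (c.backStart cells - i) = i by omega]⟩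

theorem faces_frontStep (hinge : Option GridFace) (q : ℕ)
    (hr : ∀ d, c.frontSuture cells (c.start + q) = some d → UnrollsCall recurse d) :
    ((c.frontStep cells recurse hinge q).map Step.face).Perm
      ((c.frontStep cells (fun _ _ => []) none q).map Step.face ++
        (c.frontSuture cells (c.start + q)).toList.flatMap
          fun d => (recurse d none).map Step.face) := by
  unfold frontStep
  cases e : c.frontSuture cells (c.start + q) with
  | none =>
    simp only [e, Option.toList_none, List.flatMap_nil, List.append_nil]
    split_ifs <;> simp
  | some d =>
    simp only [e, List.map_append, map_face_chain, (hr d e).map_face, Option.toList_some,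
      List.flatMap_cons, List.flatMap_nil, List.append_nil, List.append_assoc]
    exact List.Perm.append_left _ List.perm_append_comm

theorem faces_backwardStep (q : ℕ)
    (hr : ∀ d, c.backSuture cells (c.backStart cells - q) = some d → UnrollsCall recurse d) :
    ((c.backwardStep cells recurse q).map Step.face).Perm
      ((c.backwardStep cells (fun _ _ => []) q).map Step.face ++
        (c.backSuture cells (c.backStart cells - q)).toList.flatMap
          fun d => (recurse d none).map Step.face) := by
  unfold backwardStep
  cases e : c.backSuture cells (c.backStart cells - q) with
  | none => simp [e]
  | some d =>
    simp only [e, List.map_append, map_face_chain, (hr d e).map_face, Option.toList_some,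
      List.flatMap_cons, List.flatMap_nil, List.append_nil, List.append_assoc]
    refine List.Perm.append_left _ ?_
    refine List.perm_append_comm.trans ?_
    simp only [List.append_assoc]
    exact List.Perm.refl _

theorem unfoldDepth_succ (depth : ℕ) (hinge : Option GridFace) :
    unfoldDepth cells (depth + 1) c hinge =
      c.frontSpiral cells (unfoldDepth cells depth) hinge ++ c.secondCycle cells ++
        (c.reverseSuture cells).toList.flatMap
          (fun d => unfoldDepth cells depth d (some (c.support (c.turn cells) 4))) ++
        c.backwardSpiral cells (unfoldDepth cells depth) := by
  rw [unfoldDepth]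
  cases c.reverseSuture cells <;> simp

/-- The gridfaces of a call are its own and those of its subcalls. -/
theorem faces_unfoldDepth (ht : c.t ≤ c.backStart cells + 1) {depth : ℕ}
    (hr : ∀ d, IsSubcall cells c d → UnrollsCall (unfoldDepth cells depth) d)
    (hinge : Option GridFace) :
    ((unfoldDepth cells (depth + 1) c hinge).map Step.face).Perm (c.ownFaces cells ++
      (c.subcalls cells).flatMap fun d => (unfoldDepth cells depth d none).map Step.face) := by
  have h1 := map_face_flatMap_perm (List.range (c.girth + c.t - c.start))
    (fun q hq => faces_frontStep (cells := cells) (recurse := unfoldDepth cells depth) hinge q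
      fun d hd => hr d (Or.inl ⟨_, Finset.mem_Ico.2 ⟨by omega, by
        rw [List.mem_range] at hq
        omega⟩, hd⟩))
  have h2 := map_face_flatMap_perm (List.range (c.backStart cells + 1 - c.t))
    (fun q hq => faces_backwardStep (cells := cells) (recurse := unfoldDepth cells depth) q
      fun d hd => hr d (Or.inr (Or.inr ⟨_, Finset.mem_Icc.2 ⟨by
        rw [List.mem_range] at hq
        omega, by omega⟩, hd⟩)))
  rw [← frontSpiral_eq, ← frontSpiral_eq] at h1
  rw [← backwardSpiral_eq, ← backwardSpiral_eq] at h2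
  have h3 : (((c.reverseSuture cells).toList.flatMap
      (fun d => unfoldDepth cells depth d (some (c.support (c.turn cells) 4)))).map Step.face) =
        (c.reverseSuture cells).toList.flatMap
          fun d => (unfoldDepth cells depth d none).map Step.face := by
    cases e : c.reverseSuture cells with
    | none => rfl
    | some d => simp [(hr d (Or.inr (Or.inl e))).map_face]
  rw [unfoldDepth_succ, List.map_append, List.map_append, List.map_append, h3]
  unfold ownFaces subcalls
  rw [List.flatMap_append, List.flatMap_append, List.map_append, List.map_append]
  refine ((h1.append_right _).append_right _ |>.append h2).trans ?_
  rw [List.perm_iff_count]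
  intro a
  simp only [List.count_append]
  omega

end Call
end ManhattanTower

/-! ### The front spiral takes no gridface twice -/

namespace ManhattanTower

namespace Call

variable {c d : Call} {cells : Finset (ℕ × ℕ)}

variable (c cells) in
/-- The gridfaces that the front spiral takes in column `i`. -/
def FrontSlot (i : ℕ) (f : GridFace) : Prop :=
  f = c.support i 1 ∨ (f = c.support i 0 ∧ ¬ c.FrontBitten cells i) ∨
    ((c.frontSuture cells i).isSome ∧ (f = c.front (i - 1) ∨ f ∈ c.frontBite i))

variable (c cells) in
/-- The gridfaces that the second cycle takes. -/
def SecondSlot (f : GridFace) : Prop :=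
  f = c.support (c.girth + c.t - 1) 2 ∨
    (∃ j, (j = c.girth + c.t - 1 ∨ c.t ≤ j ∧ j ≤ c.turn cells) ∧ f = c.support j 3) ∨
    (∃ j, c.backStart cells < c.girth + j ∧ j ≤ c.turn cells ∧ f = c.support j 4) ∨
    (c.rightmost cells = 0 ∧ f = c.back (c.width + 1))

variable (c cells) in
/-- The rows that the backward spiral takes in column `i`. -/
def BackRow (i q : ℕ) : Prop :=
  (q = 4 ∧ c.turn cells < i ∧ ¬ c.BackBitten cells i) ∨
    (q = 3 ∧ c.turn cells < i ∧ i + 1 < c.girth + c.t) ∨ (q = 2 ∧ i + 1 < c.girth + c.t) ∨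
    (q ≤ 1 ∧ i < c.start)

variable (c cells) in
/-- The gridfaces that the backward spiral takes in column `i`. -/
def BackSlot (i : ℕ) (f : GridFace) : Prop :=
  (∃ q, c.BackRow cells i q ∧ f = c.support i q) ∨
    ((c.backSuture cells i).isSome ∧ (f = c.back (i + 1) ∨ f ∈ c.backBite i))

theorem front_ne_support (i j q : ℕ) : c.front i ≠ c.support j q := by
  unfold front support
  split_ifs <;> simp

theorem back_ne_support (i j q : ℕ) : c.back i ≠ c.support j q := by
  unfold back support
  split_ifs <;> simp

theorem front_ne_back (i j : ℕ) : c.front i ≠ c.back j := by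
  unfold front back
  simp

theorem front_inj {i i' j j' : ℕ} (h : c.place i = some j) (h' : c.place i' = some j')
    (hj : j < c.width) (hj' : j' < c.width) (e : c.front i = c.front i') : j = j' := by
  unfold front at e
  rw [h, h'] at e
  simp only [GridFace.vertical.injEq, Option.getD_some] at e
  exact interval_inj hj hj' e.2.1

theorem back_inj {i i' j j' : ℕ} (h : c.place i = some j) (h' : c.place i' = some j')
    (hj : j < c.width) (hj' : j' < c.width) (e : c.back i = c.back i') : j = j' := by
  unfold back at e
  rw [h, h'] at e
  simp only [GridFace.vertical.injEq, Option.getD_some] at e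
  exact interval_inj hj hj' e.2.1

theorem support_ne {i j q q' : ℕ} (hi : i < 2 * c.girth) (hj : j < 2 * c.girth) (hq : q ≤ 4)
    (hq' : q' ≤ 4) (h : q ≠ q' ∨ (i ≠ j ∧ i ≠ c.girth + j ∧ j ≠ c.girth + i)) :
    c.support i q ≠ c.support j q' := fun e => by
  have := support_inj hi hj hq hq' e
  omega

/-- In the first column and after a child the spiral takes row 0 without testing for a bite, so
these columns must not be bitten. -/
theorem Valid.not_frontBitten (h : c.Valid cells) {i : ℕ} (hi : c.start ≤ i)
    (hi' : i < c.girth + c.t) (hs : i = c.start ∨ (c.frontSuture cells i).isSome) :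
    ¬ c.FrontBitten cells i := by
  intro hb
  have hg := c.girth_eq
  obtain ⟨w, hw⟩ := h.start_arith
  obtain ⟨a, d, x, h1, h2, h3, h4, h5, h6⟩ := h.frontBitten_arith hi hi' hb
  rcases hs with hs | hs
  · rcases h6 with ⟨ρ, h6⟩ | ⟨l, h6⟩ <;> omega
  · obtain ⟨d', hd'⟩ := Option.isSome_iff_exists.1 hs
    obtain ⟨x', -, h7⟩ := h.frontSuture_column hi hi' hd'
    rcases h6 with ⟨ρ, h6⟩ | ⟨l, h6⟩ <;> rcases h7 with ⟨ρ', h7⟩ | ⟨l', h7⟩ <;> omega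

theorem Valid.not_backBitten (h : c.Valid cells) {i : ℕ} (hi : c.t ≤ i)
    (hi' : i ≤ c.backStart cells)
    (hs : c.girth + c.t ≤ i + 2 ∨ (c.backSuture cells i).isSome) : ¬ c.BackBitten cells i := by
  intro hb
  have hg := c.girth_eq
  have htc := h.turn_cases
  obtain ⟨w, hw⟩ := h.start_arith
  have hsi : c.turn cells < i := by
    rcases hs with hs | hs
    · omega
    · have := h.backSuture_arith hi hi' hs
      omega
  obtain ⟨a, d, x, ρ, h1, h2, h3, h4⟩ := h.backBitten_arith hsi (by omega) hb
  rcases hs with hs | hs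
  · omega
  · have := h.backSuture_arith hi hi' hs
    omega

theorem Valid.mem_frontStep (h : c.Valid cells) {q : ℕ} (hq : c.start + q < c.girth + c.t)
    {f : GridFace} : f ∈ (c.frontStep cells (fun _ _ => []) none q).map Step.face ↔
      c.FrontSlot cells (c.start + q) f := by
  unfold frontStep FrontSlot
  have hnb := h.not_frontBitten (i := c.start + q) (by omega) hq
  cases e : c.frontSuture cells (c.start + q) with
  | some d =>
    simp only [e, hnb (Or.inr (by rw [e]; rfl)), List.map_append, map_face_chain,
      List.append_nil, List.mem_append, List.mem_cons, List.not_mem_nil, or_false,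
      Option.isSome_some, true_and, not_false_eq_true, and_true]
    tauto
  | none =>
    by_cases hq0 : q = 0
    · simp only [hq0, if_true, or_false, Option.isSome_none, Bool.false_eq_true, false_and, add_zero]
      rw [hq0] at e hnb
      rw [add_zero] at e hnb
      simp only [e, hnb (Or.inl rfl), List.map_cons, map_face_chain,
        List.mem_cons, List.not_mem_nil, or_false, not_false_eq_true, and_true]
      tauto
    · by_cases hb : c.FrontBitten cells (c.start + q)
      · have hb' := hb
        unfold FrontBitten at hb'
        simp only [e, hq0, if_false, hb, hb', if_true, map_face_chain, List.append_nil, List.mem_cons, List.not_mem_nil, or_false,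
          Option.isSome_none, Bool.false_eq_true, false_and, not_true_eq_false, and_false]
      · have hb' := hb
        unfold FrontBitten at hb'
        simp only [e, hq0, if_false, hb, hb', List.map_append, map_face_chain,
          List.mem_append, List.mem_cons, List.not_mem_nil, or_false,
          Option.isSome_none, Bool.false_eq_true, false_and, not_false_eq_true, and_true]

theorem Valid.nodup_frontStep (h : c.Valid cells) {q : ℕ} (hq : c.start + q < c.girth + c.t) :
    ((c.frontStep cells (fun _ _ => []) none q).map Step.face).Nodup := by
  have hg := c.girth_eq
  obtain ⟨w, hw⟩ := h.start_arith
  unfold frontStep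
  cases e : c.frontSuture cells (c.start + q) with
  | some d =>
    obtain ⟨x, hx, hx'⟩ := h.frontSuture_column (by omega) hq e
    have hxx : 2 ≤ x ∧ x < 2 * c.girth ∧ x ≠ c.start + q ∧ x ≠ c.start + q + 1 ∧
        x ≠ c.start + q + 2 ∧ x ≠ c.girth + c.start + q ∧ x ≠ c.girth + c.start + q + 1 ∧
        x ≠ c.girth + c.start + q + 2 ∧ c.start + q ≠ c.girth + x ∧
        c.start + q + 1 ≠ c.girth + x ∧ c.start + q + 2 ≠ c.girth + x := by
      rcases hx' with ⟨ρ, hx'⟩ | ⟨l, hx'⟩ <;> omega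
    simp only [e, List.map_append, map_face_chain, hx, List.append_nil,
      List.cons_append, List.nil_append, List.nodup_cons, List.mem_cons, List.not_mem_nil,
      or_false, not_or, not_false_eq_true, List.nodup_nil, and_true]
    refine ⟨⟨?_, ?_, ?_, ?_, ?_⟩, ⟨?_, ?_, ?_, ?_⟩, ⟨?_, ?_, ?_⟩, ⟨?_, ?_⟩, ?_⟩
    iterate 5 exact front_ne_support _ _ _
    all_goals exact support_ne (by omega) (by omega) (by omega) (by omega) (by omega)
  | none =>
    simp only [e]
    have e1 : c.support (c.start + q) 0 ≠ c.support (c.start + q) 1 :=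
      support_ne (by omega) (by omega) (by omega) (by omega) (by omega)
    split_ifs <;> simp [map_face_chain, e1, e1.symm]

/-- Row 0 is skipped exactly where it is bitten. Bites of children met on the bottom lie on the top
and conversely; on one side, bites are three columns wide and their positions differ by multiples of
four. -/
theorem Valid.frontSlot_disjoint (h : c.Valid cells) {i i' : ℕ} (hi : c.start ≤ i)
    (hi' : i < c.girth + c.t) (hj : c.start ≤ i') (hj' : i' < c.girth + c.t) (hne : i ≠ i')
    {f : GridFace} (hf : c.FrontSlot cells i f) (hf' : c.FrontSlot cells i' f) : False := by
  have hg := c.girth_eq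
  obtain ⟨w, hw⟩ := h.start_arith
  have bite : ∀ {a : ℕ}, c.start ≤ a → a < c.girth + c.t → (c.frontSuture cells a).isSome →
      f ∈ c.frontBite a → ∃ y, c.start ≤ y ∧ y < c.girth + c.t ∧ f = c.support y 0 ∧
        ((∃ ρ, a + 4 * ρ = 2 * c.width + 1 ∧ 1 ≤ ρ ∧ 4 * ρ + 4 ≤ c.t ∧ y ≤ c.girth + 4 * ρ ∧
            c.girth + 4 * ρ ≤ y + 2) ∨
          ∃ l, a = 4 * l ∧ c.t + 5 ≤ 4 * l ∧ 4 * l < c.width ∧ c.start = c.t + 1 ∧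
            y + 4 * l ≤ 2 * c.width + 1 ∧ 2 * c.width + 1 ≤ y + 4 * l + 2) := by
    intro a h1 h2 h3 h4
    obtain ⟨d, hd⟩ := Option.isSome_iff_exists.1 h3
    obtain ⟨x, hx, hx'⟩ := h.frontSuture_column h1 h2 hd
    rw [hx] at h4
    simp only [List.mem_cons, List.not_mem_nil, or_false] at h4
    rcases hx' with ⟨ρ, hx'⟩ | ⟨l, hx'⟩
    · rcases h4 with h4 | h4 | h4
      · exact ⟨_, by omega, by omega, h4, Or.inl ⟨ρ, by omega⟩⟩
      · exact ⟨_, by omega, by omega, h4, Or.inl ⟨ρ, by omega⟩⟩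
      · exact ⟨_, by omega, by omega, h4, Or.inl ⟨ρ, by omega⟩⟩
    · rcases h4 with h4 | h4 | h4
      · exact ⟨_, by omega, by omega, h4, Or.inr ⟨l, by omega⟩⟩
      · exact ⟨_, by omega, by omega, h4, Or.inr ⟨l, by omega⟩⟩
      · exact ⟨_, by omega, by omega, h4, Or.inr ⟨l, by omega⟩⟩
  have bitten : ∀ {a b : ℕ}, c.start ≤ a → a < c.girth + c.t → (c.frontSuture cells a).isSome →
      f ∈ c.frontBite a → f = c.support b 0 → c.FrontBitten cells b := fun h1 h2 h3 h4 h5 =>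
    ⟨_, Finset.mem_Ico.2 ⟨h1, h2⟩, h3, h5 ▸ h4⟩
  have inj : ∀ {a b q q' : ℕ}, a < 2 * c.girth → b < 2 * c.girth → q ≤ 4 → q' ≤ 4 →
      f = c.support a q → f = c.support b q' →
        q = q' ∧ (a = b ∨ a = c.girth + b ∨ b = c.girth + a) :=
    fun h1 h2 h3 h4 h5 h6 => support_inj h1 h2 h3 h4 (h5.symm.trans h6)
  have plc : ∀ {a : ℕ}, c.start ≤ a → a < c.girth + c.t → (c.frontSuture cells a).isSome →
      ∃ j, c.place (a - 1) = some j ∧ j < c.width ∧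
        ((∃ ρ, a + 4 * ρ = 2 * c.width + 1 ∧ j = 4 * ρ) ∨ ∃ l, a = 4 * l ∧ j + 1 = 4 * l) := by
    intro a h1 h2 h3
    obtain ⟨d, hd⟩ := Option.isSome_iff_exists.1 h3
    obtain ⟨x, -, hx'⟩ := h.frontSuture_column h1 h2 hd
    rcases hx' with ⟨ρ, hx'⟩ | ⟨l, hx'⟩
    · exact ⟨4 * ρ, (place_eq_some (by omega)).2 (by omega), by omega, Or.inl ⟨ρ, by omega⟩⟩
    · exact ⟨4 * l - 1, (place_eq_some (by omega)).2 (by omega), by omega, Or.inr ⟨l, by omega⟩⟩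
  rcases hf with hf | ⟨hf, hb⟩ | ⟨hs, hf | hf⟩ <;> rcases hf' with hf' | ⟨hf', hb'⟩ | ⟨hs', hf' | hf'⟩
  · have := inj (by omega) (by omega) (by omega) (by omega) hf hf'
    omega
  · have := inj (by omega) (by omega) (by omega) (by omega) hf hf'
    omega
  · exact front_ne_support _ _ _ (hf'.symm.trans hf)
  · obtain ⟨y, h1, h2, h3, h4⟩ := bite hj hj' hs' hf'
    have := inj (by omega) (by omega) (by omega) (by omega) hf h3
    omega
  · have := inj (by omega) (by omega) (by omega) (by omega) hf hf'
    omega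
  · have := inj (by omega) (by omega) (by omega) (by omega) hf hf'
    omega
  · exact front_ne_support _ _ _ (hf'.symm.trans hf)
  · exact hb (bitten hj hj' hs' hf' hf)
  · exact front_ne_support _ _ _ (hf.symm.trans hf')
  · exact front_ne_support _ _ _ (hf.symm.trans hf')
  · obtain ⟨j, h1, h2, h3⟩ := plc hi hi' hs
    obtain ⟨j', h1', h2', h3'⟩ := plc hj hj' hs'
    have := front_inj h1 h1' h2 h2' (hf.symm.trans hf')
    rcases h3 with ⟨ρ, h3⟩ | ⟨l, h3⟩ <;> rcases h3' with ⟨ρ', h3'⟩ | ⟨l', h3'⟩ <;> omega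
  · obtain ⟨y, h1, h2, h3, h4⟩ := bite hj hj' hs' hf'
    exact front_ne_support _ _ _ (hf.symm.trans h3)
  · obtain ⟨y, h1, h2, h3, h4⟩ := bite hi hi' hs hf
    have := inj (by omega) (by omega) (by omega) (by omega) hf' h3
    omega
  · exact hb' (bitten hi hi' hs hf hf')
  · obtain ⟨y, h1, h2, h3, h4⟩ := bite hi hi' hs hf
    exact front_ne_support _ _ _ (hf'.symm.trans h3)
  · obtain ⟨y, h1, h2, h3, h4⟩ := bite hi hi' hs hf
    obtain ⟨y', h1', h2', h3', h4'⟩ := bite hj hj' hs' hf'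
    have := inj (by omega) (by omega) (by omega) (by omega) h3 h3'
    rcases h4 with ⟨ρ, h4⟩ | ⟨l, h4⟩ <;> rcases h4' with ⟨ρ', h4'⟩ | ⟨l', h4'⟩ <;> omega

end Call
end ManhattanTower

/-! ### The backward spiral takes no gridface twice -/

namespace ManhattanTower

namespace Call

variable {c d : Call} {cells : Finset (ℕ × ℕ)}

/-- The inequalities that `omega` needs in the comparisons of columns from here on. -/
theorem Valid.bounds (h : c.Valid cells) : c.backStart cells < c.girth + c.turn cells ∧
    c.girth + c.t ≤ c.backStart cells + 2 ∧ c.backStart cells + 2 < 2 * c.girth ∧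
    c.turn cells + 2 < c.girth + c.t ∧ c.start < c.girth + c.t ∧ c.t < c.start ∧
    c.t ≤ c.turn cells + 1 ∧ c.t ≤ c.width ∧ c.girth = 2 * c.width + 2 ∧ 4 ≤ c.width ∧
    c.girth ≤ c.backStart cells := by
  have hg := c.girth_eq
  have htc := h.turn_cases
  have hsb := h.start_bounds
  obtain ⟨w, hw⟩ := h.start_arith
  omega

/-- The order of the rows depends on the row in which the strip enters the column, but their set
does not; `BackRow` describes this set. -/
theorem Valid.faces_backwardStep_nil (h : c.Valid cells) {i : ℕ} (hti : c.t ≤ i)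
    (hi : i ≤ c.backStart cells) : ∃ rows : List ℕ,
    (c.backwardStep cells (fun _ _ => []) (c.backStart cells - i)).map Step.face =
      (if (c.backSuture cells i).isSome then c.back (i + 1) :: c.backBite i else []) ++
        rows.map (c.support i) ∧ rows.Nodup ∧ ∀ q, q ∈ rows ↔ c.BackRow cells i q := by
  have hb := h.bounds
  have hnb := h.not_backBitten hti hi
  have hsa := h.backSuture_arith hti hi
  have hrm : c.rightmost cells ≤ c.width := Nat.findGreatest_le _
  unfold backwardStep BackRow
  have hii : c.backStart cells - (c.backStart cells - i) = i := by omega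
  simp only [hii]
  generalize c.backStart cells - i = q
  have hgap : (if i < c.start then chain (c.support i 2) [c.support i 1, c.support i 0]
      else []).map Step.face = (if i < c.start then [1, 0] else []).map (c.support i) := by
    split_ifs <;> simp [map_face_chain]
  have hdown : ∀ m : Bool, ((if m then chain (c.support i 4) [c.support i 3, c.support i 2]
      else []) ++ (if i < c.start then chain (c.support i 2) [c.support i 1, c.support i 0]
        else [])).map Step.face =
      ((if m then [3, 2] else []) ++ (if i < c.start then [1, 0] else [])).map (c.support i) := by
    intro m
    rw [List.map_append, hgap, List.map_append]
    cases m <;> simp [map_face_chain]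
  have hlong : c.turn cells < i → ¬ c.BackBitten cells i →
      (4 :: ((if decide (i + 1 < c.girth + c.t ∧ c.turn cells < i) then [3, 2] else []) ++
        (if i < c.start then [1, 0] else []))).Nodup ∧ ∀ q,
      q ∈ 4 :: ((if decide (i + 1 < c.girth + c.t ∧ c.turn cells < i) then [3, 2] else []) ++
        (if i < c.start then [1, 0] else [])) ↔
      (q = 4 ∧ c.turn cells < i ∧ ¬ c.BackBitten cells i) ∨
        (q = 3 ∧ c.turn cells < i ∧ i + 1 < c.girth + c.t) ∨ (q = 2 ∧ i + 1 < c.girth + c.t) ∨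
        (q ≤ 1 ∧ i < c.start) := by
    intro h1 h2
    constructor
    · split_ifs <;> simp
    · intro q
      simp only [h1, h2, and_true, not_false_eq_true, decide_eq_true_eq]
      split_ifs with h3 h4 h4 <;> simp only [List.mem_cons, List.mem_append, List.not_mem_nil,
        or_false, false_or, true_and] <;> omega
  cases e : c.backSuture cells i with
  | some d =>
    have hs := hsa (by rw [e]; rfl)
    have h2 : c.turn cells < i := by
      have := h.turn_cases
      omega
    obtain ⟨k1, k2⟩ := hlong h2 (hnb (Or.inr (by rw [e]; rfl)))
    refine ⟨_, ?_, k1, k2⟩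
    rw [List.append_assoc, List.map_append, hdown, List.map_append, List.map_append,
      map_face_chain, map_face_chain]
    simp
  | none =>
    by_cases hA : c.girth + c.t ≤ i + 2
    · obtain ⟨k1, k2⟩ := hlong (by omega) (hnb (Or.inl hA))
      refine ⟨_, ?_, k1, k2⟩
      rw [if_pos hA]
      rw [List.map_append, hdown]
      cases c.reverseSuture cells <;> cases q <;> simp [map_face_chain]
    · rw [if_neg hA]
      have h3 : i + 1 < c.girth + c.t := by omega
      by_cases hm : c.turn cells < i
      · simp only [h3, hm, and_self, decide_true, if_true, true_and, and_true]
        by_cases hbt : c.BackBitten cells i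
        · have hb' := hbt
          unfold BackBitten at hb'
          refine ⟨2 :: 3 :: if i < c.start then [1, 0] else [], ?_, ?_, fun q => ?_⟩
          · rw [if_pos hb', List.append_nil, List.map_append, hgap, map_face_chain]
            simp
          · split_ifs <;> simp
          · simp only [hbt, not_true_eq_false, and_false, false_or]
            split_ifs <;> simp only [List.mem_cons, List.not_mem_nil, or_false] <;> omega
        · have hb' := hbt
          unfold BackBitten at hb'
          refine ⟨2 :: 3 :: 4 :: if i < c.start then [1, 0] else [], ?_, ?_, fun q => ?_⟩
          · rw [if_neg hb', List.map_append, List.map_append, hgap, map_face_chain, map_face_chain]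
            simp
          · split_ifs <;> simp
          · simp only [hbt, not_false_eq_true, and_true]
            split_ifs <;> simp only [List.mem_cons, List.not_mem_nil, or_false] <;> omega
      · simp only [h3, hm, and_false, decide_false, Bool.false_eq_true, if_false, false_and,
          false_or, and_true]
        refine ⟨2 :: if i < c.start then [1, 0] else [], ?_, ?_, fun q => ?_⟩
        · rw [List.map_append, hgap, map_face_chain]
          simp
        · split_ifs <;> simp
        · split_ifs <;> simp only [List.mem_cons, List.not_mem_nil, or_false] <;> omega

theorem Valid.mem_backwardStep (h : c.Valid cells) {i : ℕ} (hti : c.t ≤ i)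
    (hi : i ≤ c.backStart cells) {f : GridFace} :
    f ∈ (c.backwardStep cells (fun _ _ => []) (c.backStart cells - i)).map Step.face ↔
      c.BackSlot cells i f := by
  obtain ⟨rows, h1, -, h2⟩ := h.faces_backwardStep_nil hti hi
  rw [h1, List.mem_append, List.mem_map, or_comm]
  unfold BackSlot
  refine or_congr (exists_congr fun q => ?_) ?_
  · rw [h2, eq_comm]
  · split_ifs with h3 <;> simp [h3]

theorem Valid.nodup_backwardStep (h : c.Valid cells) {i : ℕ} (hti : c.t ≤ i)
    (hi : i ≤ c.backStart cells) :
    ((c.backwardStep cells (fun _ _ => []) (c.backStart cells - i)).map Step.face).Nodup := by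
  have hb := h.bounds
  obtain ⟨rows, h1, h2, h3⟩ := h.faces_backwardStep_nil hti hi
  have hr : ∀ q ∈ rows, q ≤ 4 := fun q hq => by
    rcases (h3 q).1 hq with h4 | h4 | h4 | h4 <;> omega
  have hn : (rows.map (c.support i)).Nodup := h2.map_on fun q hq q' hq' e =>
    (support_inj_mod (hr q hq) (hr q' hq') e).1
  rw [h1]
  split_ifs with hs
  · obtain ⟨d, hd⟩ := Option.isSome_iff_exists.1 hs
    obtain ⟨x, ρ, hx, hx'⟩ := h.backSuture_column hti hi hd
    have hrm : c.rightmost cells ≤ c.width := Nat.findGreatest_le _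
    rw [hx]
    refine List.nodup_append.2 ⟨?_, hn, ?_⟩
    · simp only [List.nodup_cons, List.mem_cons, List.not_mem_nil,
        or_false, not_or, not_false_eq_true, List.nodup_nil, and_true]
      refine ⟨⟨?_, ?_, ?_⟩, ⟨?_, ?_⟩, ?_⟩
      iterate 3 exact back_ne_support _ _ _
      all_goals exact support_ne (by omega) (by omega) (by omega) (by omega) (by omega)
    · intro a ha b hb'
      obtain ⟨q, hq, rfl⟩ := List.mem_map.1 hb'
      have hq4 := hr q hq
      simp only [List.mem_cons, List.not_mem_nil, or_false] at ha
      rcases ha with rfl | rfl | rfl | rfl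
      · exact back_ne_support _ _ _
      all_goals exact support_ne (by omega) (by omega) (by omega) (by omega) (by omega)
  · exact hn

theorem Valid.exists_backBite (h : c.Valid cells) {a : ℕ} {f : GridFace} (h1 : c.t ≤ a)
    (h2 : a ≤ c.backStart cells) (h3 : (c.backSuture cells a).isSome) (h4 : f ∈ c.backBite a) :
    ∃ y ρ, f = c.support y 4 ∧ a + 1 = c.girth + 4 * ρ ∧ 1 ≤ ρ ∧
      4 * ρ + 8 ≤ c.rightmost cells ∧ 2 * c.width ≤ y + 4 * ρ ∧ y + 4 * ρ ≤ 2 * c.width + 2 := by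
  obtain ⟨d, hd⟩ := Option.isSome_iff_exists.1 h3
  obtain ⟨x, ρ, hx, hx'⟩ := h.backSuture_column h1 h2 hd
  rw [hx] at h4
  simp only [List.mem_cons, List.not_mem_nil, or_false] at h4
  rcases h4 with h4 | h4 | h4
  · exact ⟨_, ρ, h4, by omega⟩
  · exact ⟨_, ρ, h4, by omega⟩
  · exact ⟨_, ρ, h4, by omega⟩

/-- Over two turns, a column may occur twice only with different rows. Bites are avoided by
definition of `BackBitten`, and different bites begin at distances that are multiples of four. -/
theorem Valid.backSlot_disjoint (h : c.Valid cells) {i i' : ℕ} (hi : c.t ≤ i)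
    (hi' : i ≤ c.backStart cells) (hj : c.t ≤ i') (hj' : i' ≤ c.backStart cells) (hne : i ≠ i')
    {f : GridFace} (hf : c.BackSlot cells i f) (hf' : c.BackSlot cells i' f) : False := by
  have hb := h.bounds
  have hrm : c.rightmost cells ≤ c.width := Nat.findGreatest_le _
  have row_bite : ∀ {a b q : ℕ}, c.t ≤ a → a ≤ c.backStart cells → c.t ≤ b →
      b ≤ c.backStart cells → c.BackRow cells a q → f = c.support a q →
      (c.backSuture cells b).isSome → (f = c.back (b + 1) ∨ f ∈ c.backBite b) → False := by
    intro a b q h1 h2 h3 h4 h5 h6 h7 h8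
    rcases h8 with h8 | h8
    · exact back_ne_support _ _ _ (h8.symm.trans h6)
    · obtain ⟨y, ρ, h9, h10⟩ := h.exists_backBite h3 h4 h7 h8
      rcases h5 with ⟨rfl, -, h5⟩ | h5
      · exact h5 ⟨b, Finset.mem_Icc.2 ⟨h3, h4⟩, h7, h6 ▸ h8⟩
      · have := support_inj (by omega) (by omega) (by omega) (by omega) (h6.symm.trans h9)
        omega
  rcases hf with ⟨q, h1, h2⟩ | ⟨h1, h2⟩ <;> rcases hf' with ⟨q', h1', h2'⟩ | ⟨h1', h2'⟩
  · have hq : q ≤ 4 := by rcases h1 with h1 | h1 | h1 | h1 <;> omega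
    have hq' : q' ≤ 4 := by rcases h1' with h1' | h1' | h1' | h1' <;> omega
    have := support_inj (by omega) (by omega) hq hq' (h2.symm.trans h2')
    rcases h1 with ⟨h1, h3, -⟩ | h1 | h1 | h1 <;>
      rcases h1' with ⟨h1', h3', -⟩ | h1' | h1' | h1' <;> omega
  · exact row_bite hi hi' hj hj' h1 h2 h1' h2'
  · exact row_bite hj hj' hi hi' h1' h2' h1 h2
  · obtain ⟨ρ₁, e1⟩ := h.backSuture_arith hi hi' h1
    obtain ⟨ρ₂, e2⟩ := h.backSuture_arith hj hj' h1'
    rcases h2 with h7 | h7 <;> rcases h2' with h7' | h7'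
    · have := back_inj (c := c) (i := i + 1) (i' := i' + 1) (j := 4 * ρ₁) (j' := 4 * ρ₂)
        ((place_eq_some (by omega)).2 (by omega)) ((place_eq_some (by omega)).2 (by omega))
        (by omega) (by omega) (h7.symm.trans h7')
      omega
    · obtain ⟨y, ρ, h8, h9⟩ := h.exists_backBite hj hj' h1' h7'
      exact back_ne_support _ _ _ (h7.symm.trans h8)
    · obtain ⟨y, ρ, h8, h9⟩ := h.exists_backBite hi hi' h1 h7
      exact back_ne_support _ _ _ (h7'.symm.trans h8)
    · obtain ⟨y, ρ, h8, h9⟩ := h.exists_backBite hi hi' h1 h7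
      obtain ⟨y', ρ', h8', h9'⟩ := h.exists_backBite hj hj' h1' h7'
      have := support_inj (by omega) (by omega) (by omega) (by omega) (h8.symm.trans h8')
      omega

end Call
end ManhattanTower

/-! ### A call covers the support faces of its box exactly once -/

namespace ManhattanTower

namespace Call

variable {c d : Call} {cells : Finset (ℕ × ℕ)}

theorem Valid.backStart_eq (h : c.Valid cells) :
    (c.rightmost cells = 0 ∧ c.turn cells = c.width + 1 ∧
      c.backStart cells + 2 = c.girth + c.width) ∨
    (c.rightmost cells ≠ 0 ∧ c.backStart cells + 1 = c.girth + c.turn cells) := by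
  have hg := c.girth_eq
  have htc := h.turn_cases
  obtain ⟨w, hw⟩ := h.start_arith
  omega

/-- Without back children, row 4 of column `width - 1` is reached across the back face, and is
therefore listed apart from the rest of row 4. -/
theorem Valid.faces_secondCycle (h : c.Valid cells) : ∃ third fourth : List ℕ,
    (c.secondCycle cells).map Step.face = c.support (c.girth + c.t - 1) 2 ::
      (third.map (fun j => c.support j 3) ++ fourth.map (fun j => c.support j 4) ++
        if c.rightmost cells = 0 then [c.back (c.width + 1), c.support (c.width - 1) 4] else []) ∧
    third.Nodup ∧ (∀ j, j ∈ third ↔ j = c.girth + c.t - 1 ∨ c.t ≤ j ∧ j ≤ c.turn cells) ∧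
    fourth.Nodup ∧ (∀ j, j ∈ fourth ↔ (c.backStart cells < c.girth + j ∧ j ≤ c.turn cells ∧
      (c.rightmost cells = 0 → j ≠ c.width - 1))) := by
  have hb := h.bounds
  have hbs := h.backStart_eq
  refine ⟨(c.girth + c.t - 1) :: (List.range (c.turn cells + 1 - c.t)).map (fun q => c.t + q),
    if c.rightmost cells = 0 then [c.width, c.width + 1] else [c.turn cells], ?_, ?_, ?_, ?_, ?_⟩
  · unfold secondCycle
    have h1 : (((List.range (c.turn cells + 1 - c.t)).flatMap fun q =>
        chain (c.support (c.girth + c.t + q - 1) 3) [c.support (c.t + q) 3]).map Step.face) =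
        ((List.range (c.turn cells + 1 - c.t)).map (fun q => c.t + q)).map
          (fun j => c.support j 3) := by
      induction List.range (c.turn cells + 1 - c.t) with
      | nil => rfl
      | cons q l ih => simp only [List.flatMap_cons, List.map_append, map_face_chain, ih, List.map_cons,
          List.cons_append, List.nil_append]
    rw [List.map_append, List.map_append, h1, map_face_chain]
    by_cases h0 : c.rightmost cells = 0
    · rw [if_pos h0, if_pos h0, if_pos h0, List.map_append, map_face_chain, map_face_chain]
      simp
    · rw [if_neg h0, if_neg h0, if_neg h0, map_face_chain]
      simp
  · refine List.nodup_cons.2 ⟨?_, List.nodup_range.map fun a b => by simp⟩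
    simp only [List.mem_map, List.mem_range, not_exists, not_and]
    intro q hq
    omega
  · intro j
    simp only [List.mem_cons, List.mem_map, List.mem_range]
    refine or_congr Iff.rfl ⟨?_, fun h1 => ⟨j - c.t, by omega, by omega⟩⟩
    rintro ⟨q, hq, rfl⟩
    omega
  · split_ifs <;> simp
  · intro j
    split_ifs with h0 <;> simp only [List.mem_cons, List.not_mem_nil, or_false, h0, true_imp_iff,
      false_imp_iff, and_true] <;> omega

theorem Valid.mem_secondCycle (h : c.Valid cells) {f : GridFace} :
    f ∈ (c.secondCycle cells).map Step.face ↔ c.SecondSlot cells f := by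
  have hb := h.bounds
  have hbs := h.backStart_eq
  obtain ⟨third, fourth, h1, -, h2, -, h3⟩ := h.faces_secondCycle
  rw [h1]
  unfold SecondSlot
  simp only [List.mem_cons, List.mem_append, List.mem_map, h2, h3, or_assoc]
  refine or_congr Iff.rfl (or_congr (exists_congr fun j => by rw [eq_comm (a := f)]) ?_)
  constructor
  · rintro (⟨j, h4, rfl⟩ | h4)
    · exact Or.inl ⟨j, h4.1, h4.2.1, rfl⟩
    · split_ifs at h4 with h0
      · simp only [List.mem_cons, List.not_mem_nil, or_false] at h4
        rcases h4 with rfl | rfl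
        · exact Or.inr ⟨h0, rfl⟩
        · exact Or.inl ⟨c.width - 1, by omega, by omega, rfl⟩
      · simp at h4
  · rintro (⟨j, h4, h5, rfl⟩ | ⟨h0, rfl⟩)
    · by_cases h6 : c.rightmost cells = 0 → j ≠ c.width - 1
      · exact Or.inl ⟨j, ⟨h4, h5, h6⟩, rfl⟩
      · rw [Classical.not_imp, not_not] at h6
        rw [if_pos h6.1, h6.2]
        simp
    · simp [h0]

theorem Valid.nodup_secondCycle (h : c.Valid cells) :
    ((c.secondCycle cells).map Step.face).Nodup := by
  have hb := h.bounds
  have hbs := h.backStart_eq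
  obtain ⟨third, fourth, h1, h2, h3, h4, h5⟩ := h.faces_secondCycle
  have b3 : ∀ j ∈ third, j < 2 * c.girth := fun j hj => by have := (h3 j).1 hj; omega
  have b4 : ∀ j ∈ fourth, j < 2 * c.girth := fun j hj => by have := (h5 j).1 hj; omega
  rw [h1]
  refine List.nodup_cons.2 ⟨?_, List.nodup_append.2 ⟨List.nodup_append.2 ⟨?_, ?_, ?_⟩, ?_, ?_⟩⟩
  · simp only [List.mem_append, List.mem_map, not_or, not_exists, not_and]
    refine ⟨⟨fun j hj => ?_, fun j hj => ?_⟩, ?_⟩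
    · have := b3 j hj
      exact support_ne (by omega) (by omega) (by omega) (by omega) (by omega)
    · have := b4 j hj
      exact support_ne (by omega) (by omega) (by omega) (by omega) (by omega)
    · split_ifs
      · simp only [List.mem_cons, List.not_mem_nil, or_false, not_or]
        exact ⟨(back_ne_support _ _ _).symm,
          support_ne (by omega) (by omega) (by omega) (by omega) (by omega)⟩
      · simp
  · refine h2.map_on fun i hi j hj e => ?_
    have := support_inj (b3 i hi) (b3 j hj) (by omega) (by omega) e
    have := (h3 i).1 hi
    have := (h3 j).1 hj
    omega
  · refine h4.map_on fun i hi j hj e => ?_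
    have := support_inj (b4 i hi) (b4 j hj) (by omega) (by omega) e
    have := (h5 i).1 hi
    have := (h5 j).1 hj
    omega
  · intro a ha b hb'
    obtain ⟨i, hi, rfl⟩ := List.mem_map.1 ha
    obtain ⟨j, hj, rfl⟩ := List.mem_map.1 hb'
    exact support_ne (b3 i hi) (b4 j hj) (by omega) (by omega) (by omega)
  · split_ifs
    · simp [back_ne_support]
    · exact List.nodup_nil
  · intro a ha b hb' e
    subst e
    split_ifs at hb' with h0
    · simp only [List.mem_append, List.mem_map] at ha
      simp only [List.mem_cons, List.not_mem_nil, or_false] at hb'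
      rcases ha with ⟨j, hj, rfl⟩ | ⟨j, hj, rfl⟩ <;> rcases hb' with h6 | h6
      · exact back_ne_support _ _ _ h6.symm
      · have := support_inj (b3 j hj) (by omega) (by omega) (by omega) h6
        omega
      · exact back_ne_support _ _ _ h6.symm
      · have := support_inj (b4 j hj) (by omega) (by omega) (by omega) h6
        have := (h5 j).1 hj
        have := this.2.2 h0
        omega
    · simp at hb'

theorem Valid.mem_frontSpiral_nil (h : c.Valid cells) {f : GridFace} :
    f ∈ (c.frontSpiral cells (fun _ _ => []) none).map Step.face ↔
      ∃ i, c.start ≤ i ∧ i < c.girth + c.t ∧ c.FrontSlot cells i f := by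
  rw [frontSpiral_eq, List.map_flatMap, List.mem_flatMap]
  constructor
  · rintro ⟨q, hq, hf⟩
    rw [List.mem_range] at hq
    exact ⟨_, by omega, by omega, (h.mem_frontStep (by omega)).1 hf⟩
  · rintro ⟨i, hi, hi', hf⟩
    refine ⟨i - c.start, List.mem_range.2 (by omega), (h.mem_frontStep (by omega)).2 ?_⟩
    rwa [show c.start + (i - c.start) = i by omega]

theorem Valid.mem_backwardSpiral_nil (h : c.Valid cells) {f : GridFace} :
    f ∈ (c.backwardSpiral cells fun _ _ => []).map Step.face ↔
      ∃ i, c.t ≤ i ∧ i ≤ c.backStart cells ∧ c.BackSlot cells i f := by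
  rw [backwardSpiral_eq, List.map_flatMap, List.mem_flatMap]
  constructor
  · rintro ⟨q, hq, hf⟩
    rw [List.mem_range] at hq
    refine ⟨c.backStart cells - q, by omega, by omega,
      (h.mem_backwardStep (by omega) (by omega)).1 ?_⟩
    rwa [show c.backStart cells - (c.backStart cells - q) = q by omega]
  · rintro ⟨i, hi, hi', hf⟩
    exact ⟨c.backStart cells - i, List.mem_range.2 (by omega), (h.mem_backwardStep hi hi').2 hf⟩

theorem Valid.mem_ownFaces (h : c.Valid cells) {f : GridFace} : f ∈ c.ownFaces cells ↔
    (∃ i, c.start ≤ i ∧ i < c.girth + c.t ∧ c.FrontSlot cells i f) ∨ c.SecondSlot cells f ∨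
      ∃ i, c.t ≤ i ∧ i ≤ c.backStart cells ∧ c.BackSlot cells i f := by
  unfold ownFaces
  rw [List.map_append, List.map_append, List.mem_append, List.mem_append, h.mem_frontSpiral_nil,
    h.mem_secondCycle, h.mem_backwardSpiral_nil, or_assoc]

theorem Valid.nodup_frontSpiral_nil (h : c.Valid cells) :
    ((c.frontSpiral cells (fun _ _ => []) none).map Step.face).Nodup := by
  rw [frontSpiral_eq, List.map_flatMap, List.nodup_flatMap]
  refine ⟨fun q hq => h.nodup_frontStep ?_, ?_⟩
  · rw [List.mem_range] at hq
    omega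
  · refine List.nodup_range.pairwise_of_forall_ne fun q hq q' hq' hne f hf hf' => ?_
    rw [List.mem_range] at hq hq'
    exact h.frontSlot_disjoint (by omega) (by omega) (by omega) (by omega)
      (show c.start + q ≠ c.start + q' by omega)
      ((h.mem_frontStep (by omega)).1 hf) ((h.mem_frontStep (by omega)).1 hf')

theorem Valid.nodup_backwardSpiral_nil (h : c.Valid cells) :
    ((c.backwardSpiral cells fun _ _ => []).map Step.face).Nodup := by
  rw [backwardSpiral_eq, List.map_flatMap, List.nodup_flatMap]
  have hq' : ∀ q ∈ List.range (c.backStart cells + 1 - c.t), ∃ i, c.t ≤ i ∧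
      i ≤ c.backStart cells ∧ q = c.backStart cells - i := fun q hq => by
    rw [List.mem_range] at hq
    exact ⟨c.backStart cells - q, by omega⟩
  refine ⟨fun q hq => ?_, ?_⟩
  · obtain ⟨i, h1, h2, rfl⟩ := hq' q hq
    exact h.nodup_backwardStep h1 h2
  · refine List.nodup_range.pairwise_of_forall_ne fun q hq q' hq2 hne f hf hf' => ?_
    obtain ⟨i, h1, h2, rfl⟩ := hq' q hq
    obtain ⟨i', h1', h2', rfl⟩ := hq' q' hq2
    exact h.backSlot_disjoint h1 h2 h1' h2' (by omega)
      ((h.mem_backwardStep h1 h2).1 hf) ((h.mem_backwardStep h1' h2').1 hf')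

/-- Bites only change the order within the swept region. So for comparison with the other parts the
front spiral amounts to rows 0 and 1 of its columns; `backSlot_cases` does the same for the backward
spiral. -/
theorem Valid.frontSlot_cases (h : c.Valid cells) {i : ℕ} (hi : c.start ≤ i)
    (hi' : i < c.girth + c.t) {f : GridFace} (hf : c.FrontSlot cells i f) :
    (∃ j q, c.start ≤ j ∧ j < c.girth + c.t ∧ q ≤ 1 ∧ f = c.support j q) ∨
      (∃ d, c.frontSuture cells i = some d) ∧ f = c.front (i - 1) := by
  have hb := h.bounds
  rcases hf with hf | ⟨hf, -⟩ | ⟨h3, hf | hf⟩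
  · exact Or.inl ⟨i, 1, hi, hi', le_rfl, hf⟩
  · exact Or.inl ⟨i, 0, hi, hi', by omega, hf⟩
  · exact Or.inr ⟨Option.isSome_iff_exists.1 h3, hf⟩
  · left
    obtain ⟨d, hd⟩ := Option.isSome_iff_exists.1 h3
    obtain ⟨x, hx, hx'⟩ := h.frontSuture_column hi hi' hd
    rw [hx] at hf
    simp only [List.mem_cons, List.not_mem_nil, or_false] at hf
    have hxb : c.start + 2 ≤ x ∧ x < c.girth + c.t := by
      rcases hx' with ⟨ρ, hx'⟩ | ⟨l, hx'⟩ <;> omega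
    rcases hf with hf | hf | hf
    · exact ⟨_, 0, by omega, by omega, by omega, hf⟩
    · exact ⟨_, 0, by omega, by omega, by omega, hf⟩
    · exact ⟨_, 0, by omega, by omega, by omega, hf⟩

theorem Valid.backSlot_cases (h : c.Valid cells) {i : ℕ} (hi : c.t ≤ i)
    (hi' : i ≤ c.backStart cells) {f : GridFace} (hf : c.BackSlot cells i f) :
    (∃ j q, q ≤ 4 ∧ f = c.support j q ∧ c.t ≤ j ∧ j ≤ c.backStart cells ∧
      ((q = 4 ∧ c.turn cells < j) ∨ (q = 3 ∧ c.turn cells < j ∧ j + 1 < c.girth + c.t) ∨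
        (q = 2 ∧ j + 1 < c.girth + c.t) ∨ (q ≤ 1 ∧ j < c.start))) ∨
      (∃ d, c.backSuture cells i = some d) ∧ f = c.back (i + 1) := by
  have hb := h.bounds
  rcases hf with ⟨q, hq, hf⟩ | ⟨h3, hf | hf⟩
  · left
    refine ⟨i, q, ?_, hf, hi, hi', ?_⟩
    · rcases hq with hq | hq | hq | hq <;> omega
    · rcases hq with hq | hq | hq | hq
      · exact Or.inl ⟨hq.1, hq.2.1⟩
      · exact Or.inr (Or.inl hq)
      · exact Or.inr (Or.inr (Or.inl hq))
      · exact Or.inr (Or.inr (Or.inr hq))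
  · exact Or.inr ⟨Option.isSome_iff_exists.1 h3, hf⟩
  · left
    obtain ⟨y, ρ, h9, h10⟩ := h.exists_backBite hi hi' h3 hf
    have htc := h.turn_cases
    exact ⟨y, 4, le_rfl, h9, by omega, by omega, Or.inl ⟨rfl, by omega⟩⟩

theorem Valid.nodup_ownFaces (h : c.Valid cells) : (c.ownFaces cells).Nodup := by
  have hb := h.bounds
  have hbs := h.backStart_eq
  unfold ownFaces
  rw [List.map_append, List.map_append]
  refine List.nodup_append.2 ⟨List.nodup_append.2 ⟨h.nodup_frontSpiral_nil, h.nodup_secondCycle, ?_⟩,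
    h.nodup_backwardSpiral_nil, ?_⟩
  · rintro f hf g hg rfl
    obtain ⟨i, h1, h2, h3⟩ := h.mem_frontSpiral_nil.1 hf
    rcases h.frontSlot_cases h1 h2 h3 with ⟨j, q, h4, h5, h6, rfl⟩ | ⟨-, rfl⟩
    · rcases h.mem_secondCycle.1 hg with h7 | ⟨k, hk, h7⟩ | ⟨k, hk, hk', h7⟩ | ⟨-, h7⟩
      · have := (support_inj_mod (by omega) (by omega) h7).1
        omega
      · have := (support_inj_mod (by omega) (by omega) h7).1
        omega
      · have := (support_inj_mod (by omega) (by omega) h7).1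
        omega
      · exact back_ne_support _ _ _ h7.symm
    · rcases h.mem_secondCycle.1 hg with h7 | ⟨k, hk, h7⟩ | ⟨k, hk, hk', h7⟩ | ⟨-, h7⟩
      · exact front_ne_support _ _ _ h7
      · exact front_ne_support _ _ _ h7
      · exact front_ne_support _ _ _ h7
      · exact front_ne_back _ _ h7
  · rintro f hf g hg rfl
    obtain ⟨i, h1, h2, h3⟩ := h.mem_backwardSpiral_nil.1 hg
    rcases List.mem_append.1 hf with hf | hf
    · obtain ⟨i', h1', h2', h3'⟩ := h.mem_frontSpiral_nil.1 hf
      rcases h.frontSlot_cases h1' h2' h3' with ⟨j, q, h4, h5, h6, rfl⟩ | ⟨-, rfl⟩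
      · rcases h.backSlot_cases h1 h2 h3 with ⟨j', q', k1, k2, k3, k4, k5⟩ | ⟨-, k⟩
        · have := support_inj (by omega) (by omega) (by omega) (by omega) k2
          omega
        · exact back_ne_support _ _ _ k.symm
      · rcases h.backSlot_cases h1 h2 h3 with ⟨j', q', k1, k2, k3, k4, k5⟩ | ⟨-, k⟩
        · exact front_ne_support _ _ _ k2
        · exact front_ne_back _ _ k
    · rcases h.backSlot_cases h1 h2 h3 with ⟨j', q', k1, rfl, k3, k4, k5⟩ | ⟨⟨d, hd⟩, rfl⟩
      · rcases h.mem_secondCycle.1 hf with h7 | ⟨k, hk, h7⟩ | ⟨k, hk, hk', h7⟩ | ⟨-, h7⟩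
        · have := support_inj (by omega) (by omega) (by omega) (by omega) h7
          omega
        · have := support_inj (by omega) (by omega) (by omega) (by omega) h7
          omega
        · have := support_inj (by omega) (by omega) (by omega) (by omega) h7
          omega
        · exact back_ne_support _ _ _ h7.symm
      · rcases h.mem_secondCycle.1 hf with h7 | ⟨k, hk, h7⟩ | ⟨k, hk, hk', h7⟩ | ⟨h0, -⟩
        · exact back_ne_support _ _ _ h7
        · exact back_ne_support _ _ _ h7
        · exact back_ne_support _ _ _ h7
        · obtain ⟨ρ, h8⟩ := h.backSuture_arith h1 h2 (by rw [hd]; rfl)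
          omega

/-- Every column has a number in any given turn around the box. -/
theorem exists_column (i lo : ℕ) : ∃ j, lo ≤ j ∧ j < lo + c.girth ∧
    ∀ q, c.support i q = c.support j q := by
  have hg : 0 < c.girth := Nat.succ_pos _
  have h1 := Nat.mod_lt lo hg
  have h2 := Nat.mod_lt i hg
  have h3 := Nat.mod_lt (i % c.girth + c.girth - lo % c.girth) hg
  refine ⟨lo + (i % c.girth + c.girth - lo % c.girth) % c.girth, by omega, by omega, fun q => ?_⟩
  have h4 : (lo + (i % c.girth + c.girth - lo % c.girth) % c.girth) % c.girth = i % c.girth := by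
    rw [Nat.add_mod_mod, Nat.add_mod, ← Nat.add_mod, ← Nat.mod_add_mod,
      show lo % c.girth + (i % c.girth + c.girth - lo % c.girth) = i % c.girth + c.girth by omega,
      Nat.add_mod_right, Nat.mod_mod]
  unfold support
  rw [h4]

/-- A call unfolds all support faces of its box. -/
theorem Valid.support_mem_ownFaces (h : c.Valid cells) (i : ℕ) {q : ℕ} (hq : q ≤ 4) :
    c.support i q ∈ c.ownFaces cells := by
  have hb := h.bounds
  rw [h.mem_ownFaces]
  have hq' : q = 4 ∨ q = 3 ∨ q = 2 ∨ q = 1 ∨ q = 0 := by omega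
  rcases hq' with rfl | hq'
  · obtain ⟨j, h1, h2, h3⟩ := c.exists_column i (c.backStart cells + 1 - c.girth)
    rw [h3]
    by_cases h4 : j ≤ c.turn cells
    · exact Or.inr (Or.inl (Or.inr (Or.inr (Or.inl ⟨j, by omega, h4, rfl⟩))))
    · right
      right
      -- A gridface skipped because of a bite is taken by that bite.
      by_cases h5 : c.BackBitten cells j
      · obtain ⟨a, ha, h6, h7⟩ := h5
        rw [Finset.mem_Icc] at ha
        exact ⟨a, ha.1, ha.2, Or.inr ⟨h6, Or.inr h7⟩⟩
      · exact ⟨j, by omega, by omega, Or.inl ⟨4, Or.inl ⟨rfl, by omega, h5⟩, rfl⟩⟩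
  · obtain ⟨j, h1, h2, h3⟩ := c.exists_column i c.t
    rw [h3]
    rcases hq' with rfl | rfl | hq'
    · by_cases h4 : j = c.girth + c.t - 1 ∨ j ≤ c.turn cells
      · exact Or.inr (Or.inl (Or.inr (Or.inl ⟨j, by omega, rfl⟩)))
      · exact Or.inr (Or.inr ⟨j, by omega, by omega,
          Or.inl ⟨3, Or.inr (Or.inl ⟨rfl, by omega, by omega⟩), rfl⟩⟩)
    · by_cases h4 : j = c.girth + c.t - 1
      · exact Or.inr (Or.inl (Or.inl (by rw [h4])))
      · exact Or.inr (Or.inr ⟨j, by omega, by omega,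
          Or.inl ⟨2, Or.inr (Or.inr (Or.inl ⟨rfl, by omega⟩)), rfl⟩⟩)
    · by_cases h4 : j < c.start
      · exact Or.inr (Or.inr ⟨j, by omega, by omega,
          Or.inl ⟨q, Or.inr (Or.inr (Or.inr ⟨by omega, h4⟩)), rfl⟩⟩)
      · left
        rcases hq' with rfl | rfl
        · exact ⟨j, by omega, by omega, Or.inl rfl⟩
        · by_cases h5 : c.FrontBitten cells j
          · obtain ⟨a, ha, h6, h7⟩ := h5
            rw [Finset.mem_Ico] at ha
            exact ⟨a, ha.1, ha.2, Or.inr (Or.inr ⟨h6, Or.inr h7⟩)⟩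
          · exact ⟨j, by omega, by omega, Or.inr (Or.inl ⟨rfl, h5⟩)⟩

end Call
end ManhattanTower

/-! ### Gridfaces on the surface; children of a call -/

namespace ManhattanTower

open Set

/-- The gridface belongs to the box and lies on the surface. -/
def BoundaryFace (cells : Finset (ℕ × ℕ)) (b : Box) : GridFace → Prop
  | .horizontal _ k l => b.slab = l / 5 ∧ b.lo ≤ k / 4 ∧ k / 4 < b.hi
  | .lateral right k l => b.slab = l / 5 ∧ k = 4 * if right then b.hi else b.lo
  | .vertical back k l => l = 5 * b.slab + (if back then 5 else 0) ∧
      (b.lo ≤ k / 4 ∧ k / 4 < b.hi) ∧ if back then (k / 4, b.slab + 1) ∉ cells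
        else ∀ j, j + 1 = b.slab → (k / 4, j) ∉ cells

variable {cells : Finset (ℕ × ℕ)}

/-- The indices and the normal determine the slab, and boxes of a slab are separated by a missing
cell, so the right end of one is not the left end of another. -/
theorem BoundaryFace.box_eq {a b : Box} {f : GridFace} (ha : IsBox cells a) (hb : IsBox cells b)
    (hfa : BoundaryFace cells a f) (hfb : BoundaryFace cells b f) : a = b := by
  have hla := ha.1
  have hlb := hb.1
  rcases f with ⟨_, k, l⟩ | ⟨u, k, l⟩ | ⟨u, k, l⟩
  · rcases ha.separated hb (hfa.1.trans hfb.1.symm) with h | h | h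
    · exact h
    all_goals
      have := hfa.2
      have := hfb.2
      omega
  · rcases ha.separated hb (hfa.1.trans hfb.1.symm) with h | h | h
    · exact h
    all_goals
      have h1 := hfa.2
      have h2 := hfb.2
      split_ifs at h1 h2 <;> omega
  · rcases ha.separated hb (by have := hfa.1; have := hfb.1; omega) with h | h | h
    · exact h
    all_goals
      have := hfa.2.1
      have := hfb.2.1
      omega

namespace SingleLayerMT

variable (P : SingleLayerMT)

theorem X_mono {k k' : ℕ} (h : k ≤ k') : P.X k ≤ P.X k' :=
  (strictMono_nat_of_lt_succ P.X_lt).monotone h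

theorem Y_mono {k k' : ℕ} (h : k ≤ k') : P.Y k ≤ P.Y k' :=
  (strictMono_nat_of_lt_succ P.Y_lt).monotone h

/-- The slices of the interior by the horizontal plane and the vertical line through `p` are open
and contained in those of the solid. -/
theorem mem_interior_solid {p : Fin 3 → ℝ} (hp : p ∈ interior P.solid) :
    (p 0, p 1) ∈ interior (region P.xs P.ys P.cells) ∧ 0 < p 2 ∧ p 2 < P.height := by
  constructor
  · have hc : Continuous fun q : ℝ × ℝ => (![q.1, q.2, p 2] : Fin 3 → ℝ) := by fun_prop
    refine interior_maximal ?_ ((isOpen_interior (s := P.solid)).preimage hc) ?_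
    · intro q hq
      exact (interior_subset (s := P.solid) hq).1
    · have : (![p 0, p 1, p 2] : Fin 3 → ℝ) = p := by
        ext i
        fin_cases i <;> rfl
      simpa [this] using hp
  · have hc : Continuous fun z : ℝ => (![p 0, p 1, z] : Fin 3 → ℝ) := by fun_prop
    have h1 : p 2 ∈ interior (Icc 0 P.height) := by
      refine interior_maximal ?_ ((isOpen_interior (s := P.solid)).preimage hc) ?_
      · intro q hq
        exact (interior_subset (s := P.solid) hq).2
      · have : (![p 0, p 1, p 2] : Fin 3 → ℝ) = p := by
          ext i
          fin_cases i <;> rfl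
        simpa [this] using hp
    rwa [interior_Icc] at h1

theorem boxSolid_subset_solid {b : Box} (hb : IsBox P.cells b) : P.boxSolid b ⊆ P.solid := by
  intro p hp
  simp only [boxSolid, mem_Icc, Pi.le_def, Fin.forall_fin_succ] at hp
  simp at hp
  exact ⟨P.boxRect_subset_region hb ⟨⟨hp.1.1, hp.2.1⟩, hp.1.2.1, hp.2.2.1⟩, hp.1.2.2, hp.2.2.2⟩

end SingleLayerMT

namespace BoundaryFace

variable {P : SingleLayerMT} {b : Box} {f : GridFace}

theorem carrier_subset_boxSolid (hb : b.lo < b.hi) (hf : BoundaryFace P.cells b f) :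
    P.carrier f ⊆ P.boxSolid b := by
  have hH := P.height_pos.le
  unfold SingleLayerMT.boxSolid
  rw [← P.X_mul, ← P.X_mul, ← P.Y_mul, ← P.Y_mul]
  rcases f with ⟨u, k, l⟩ | ⟨u, k, l⟩ | ⟨u, k, l⟩ <;> simp only [BoundaryFace] at hf <;>
    refine Icc_subset_Icc ?_ ?_ <;> rw [Pi.le_def] <;> intro i <;> fin_cases i <;>
    cases u <;> simp at hf ⊢ <;>
    first | exact hH | (apply P.X_mono; omega) | (apply P.Y_mono; omega)

/-- A point of such a gridface is at the top or bottom height, or over a closed missing cell, or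
over the rim of the grid; none of these is interior. -/
theorem carrier_subset_frontier (hb : IsBox P.cells b) (hf : BoundaryFace P.cells b f) :
    P.carrier f ⊆ frontier P.solid := by
  intro p hp
  have hpb := hf.carrier_subset_boxSolid hb.1 hp
  refine ⟨subset_closure (P.boxSolid_subset_solid hb hpb), fun hi => ?_⟩
  obtain ⟨h1, h2, h3⟩ := P.mem_interior_solid hi
  simp only [SingleLayerMT.boxSolid, mem_Icc, Pi.le_def, Fin.forall_fin_succ] at hpb
  simp at hpb
  have missing : ∀ {i j : ℕ}, (i, j) ∉ P.cells → P.xs i ≤ p 0 → p 0 ≤ P.xs (i + 1) →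
      P.ys j ≤ p 1 → p 1 ≤ P.ys (j + 1) → False := fun h h4 h5 h6 h7 =>
    P.notMem_interior_of_missing h ⟨⟨h4, h5⟩, h6, h7⟩ h1
  have hxs : ∀ i, P.xs i ≤ P.xs (i + 1) := fun i => P.xs_strictMono.monotone (Nat.le_succ i)
  have hys : ∀ i, P.ys i ≤ P.ys (i + 1) := fun i => P.ys_strictMono.monotone (Nat.le_succ i)
  rcases f with ⟨u, k, l⟩ | ⟨u, k, l⟩ | ⟨u, k, l⟩ <;> simp only [BoundaryFace] at hf <;>
    simp only [SingleLayerMT.carrier, mem_Icc, Pi.le_def, Fin.forall_fin_succ] at hp <;>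
    simp at hp
  · cases u <;> simp at hp <;> linarith
  · cases u
    · simp only [Bool.false_eq_true, if_false] at hf
      obtain ⟨h4, rfl⟩ := hf
      rw [P.X_mul] at hp
      rcases Nat.eq_zero_or_pos b.lo with h5 | h5
      · rw [h5] at hp
        exact P.notMem_interior_of_fst_le hp.2.1 h1
      · have h6 := hb.2.2.2 (b.lo - 1) (by omega)
        refine missing h6 ((P.xs_strictMono.monotone (Nat.sub_le _ _)).trans hp.1.1) ?_ hpb.1.2.1
          hpb.2.2.1
        rw [Nat.sub_add_cancel h5]
        exact hp.2.1
    · simp only [if_true] at hf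
      obtain ⟨h4, rfl⟩ := hf
      rw [P.X_mul] at hp
      exact missing hb.2.2.1 hp.1.1 (hp.2.1.trans (hxs _)) hpb.1.2.1 hpb.2.2.1
  · have hx1 : P.xs (k / 4) ≤ p 0 := by
      rw [← P.X_mul]
      exact (P.X_mono (by omega)).trans hp.1.1
    have hx2 : p 0 ≤ P.xs (k / 4 + 1) := by
      rw [← P.X_mul]
      exact hp.2.1.trans (P.X_mono (by omega))
    cases u
    · simp only [Bool.false_eq_true, if_false, add_zero] at hf
      obtain ⟨rfl, -, h4⟩ := hf
      rw [P.Y_mul] at hp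
      rcases Nat.eq_zero_or_pos b.slab with h5 | h5
      · rw [h5] at hp
        exact P.notMem_interior_of_snd_le hp.2.2.1 h1
      · refine missing (h4 (b.slab - 1) (by omega)) hx1 hx2
          ((P.ys_strictMono.monotone (Nat.sub_le _ _)).trans hp.1.2.1) ?_
        rw [Nat.sub_add_cancel h5]
        exact hp.2.2.1
    · simp only [if_true] at hf
      obtain ⟨rfl, -, h4⟩ := hf
      rw [← Nat.mul_succ, P.Y_mul] at hp
      exact missing h4 hx1 hx2 hp.1.2.1 (hp.2.2.1.trans (hys _))

end BoundaryFace

namespace Call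

variable {c d : Call}

theorem boundaryFace_support (hw : c.box.lo < c.box.hi) (i : ℕ) {q : ℕ} (hq : q ≤ 4) :
    BoundaryFace cells c.box (c.support i q) := by
  have hrow : c.box.slab = c.row q / 5 := by
    unfold row
    split_ifs <;> omega
  have hint : ∀ {j}, j < c.width →
      c.box.lo ≤ c.interval j / 4 ∧ c.interval j / 4 < c.box.hi := by
    intro j hj
    have := c.width_eq
    unfold interval
    split_ifs <;> omega
  have hwe := c.width_eq
  unfold support
  split_ifs
  · exact ⟨hrow, hint (by assumption)⟩
  · refine ⟨hrow, ?_⟩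
    unfold plane
    cases c.mirrored <;> simp <;> omega
  · exact ⟨hrow, hint (by omega)⟩
  · refine ⟨hrow, ?_⟩
    unfold plane
    cases c.mirrored <;> simp

theorem boundaryFace_vertical {up : Bool} {j : ℕ} (hj : j < c.width)
    (h : c.adjacentBox cells up (j / 4) = none) : BoundaryFace cells c.box
      (.vertical up (c.interval j) (5 * c.box.slab + if up then 5 else 0)) := by
  have hw := c.width_eq
  refine ⟨rfl, ?_, ?_⟩
  · unfold interval
    split_ifs <;> omega
  · rw [interval_div hj]
    have none_of : ∀ {y}, boxAt cells (c.cell (j / 4)) y = none → (c.cell (j / 4), y) ∉ cells := by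
      intro y h1 h2
      obtain ⟨b, hb⟩ := exists_box_of_mem h2
      rw [h1] at hb
      simp at hb
    unfold adjacentBox at h
    cases up
    · simp only [Bool.false_eq_true, if_false] at h ⊢
      intro y hy
      rw [if_neg (by omega)] at h
      exact none_of (by rwa [show y = c.box.slab - 1 by omega])
    · exact none_of h

theorem boundaryFace_front {i j : ℕ} (hj : j < c.width) (hp : c.place i = some j)
    (h : c.adjacentBox cells c.reversed (j / 4) = none) :
    BoundaryFace cells c.box (c.front i) := by
  unfold front
  rw [hp]
  exact boundaryFace_vertical hj h

theorem boundaryFace_back {i j : ℕ} (hj : j < c.width) (hp : c.place i = some j)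
    (h : c.adjacentBox cells (!c.reversed) (j / 4) = none) :
    BoundaryFace cells c.box (c.back i) := by
  unfold back
  rw [hp]
  have := boundaryFace_vertical hj h
  cases hr : c.reversed <;> simpa [hr] using this

/-- Only the strips across the front and back faces need an argument: they lie at the free interval
beside a child, or on a back face without children. -/
theorem Valid.boundaryFace_of_mem_ownFaces (h : c.Valid cells) {f : GridFace}
    (hf : f ∈ c.ownFaces cells) : BoundaryFace cells c.box f := by
  have hw := h.isBox.1
  have hg := c.girth_eq
  have hb := h.bounds
  obtain ⟨w, hw4⟩ := h.start_arith
  rcases h.mem_ownFaces.1 hf with ⟨i, hi, hi', hf⟩ | hf | ⟨i, hi, hi', hf⟩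
  · rcases h.frontSlot_cases hi hi' hf with ⟨j, q, hjq⟩ | ⟨⟨d, hd⟩, rfl⟩
    · have : q ≤ 1 ∧ f = c.support j q := by tauto
      rw [this.2]
      exact boundaryFace_support hw _ (by omega)
    · obtain ⟨b, -, -, ⟨ρ, h1, h2, h3, -, -, h4⟩ | ⟨l, h1, h2, h3, -, -, -, h4⟩⟩ :=
        h.frontSuture_cases hi hi' hd
      · refine boundaryFace_front (j := 4 * ρ) (by omega)
          ((place_eq_some (by omega)).2 (by omega)) ?_
        rwa [Nat.mul_div_cancel_left _ (by norm_num)]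
      · refine boundaryFace_front (j := 4 * l - 1) (by omega)
          ((place_eq_some (by omega)).2 (by omega)) ?_
        rwa [show (4 * l - 1) / 4 = l - 1 by omega]
  · rcases hf with rfl | ⟨j, -, rfl⟩ | ⟨j, -, -, rfl⟩ | ⟨h0, rfl⟩
    · exact boundaryFace_support hw _ (by omega)
    · exact boundaryFace_support hw _ (by omega)
    · exact boundaryFace_support hw _ (by omega)
    · rcases h.rightmost_cases with ⟨-, h1⟩ | ⟨υ, b, hu, hυ, -⟩
      · exact boundaryFace_back (j := c.width - 1) (by omega)
          ((place_eq_some (by omega)).2 (by omega)) (h1 _ (by omega))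
      · omega
  · rcases h.backSlot_cases hi hi' hf with ⟨j, q, hjq⟩ | ⟨⟨d, hd⟩, rfl⟩
    · have : q ≤ 4 ∧ f = c.support j q := by tauto
      rw [this.2]
      exact boundaryFace_support hw _ (by omega)
    · obtain ⟨b, ρ, -, h1, h2, h3, -, -, h4⟩ := h.backSuture_cases hi hi' hd
      have := h.turn_cases
      refine boundaryFace_back (j := 4 * ρ) (by omega)
          ((place_eq_some (by omega)).2 (by omega)) ?_
      rwa [Nat.mul_div_cancel_left _ (by norm_num)]

theorem exists_row {l : ℕ} (h : 5 * c.box.slab ≤ l) (h' : l < 5 * c.box.slab + 5) :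
    ∃ q ≤ 4, c.row q = l := by
  refine ⟨if c.reversed then 5 * c.box.slab + 4 - l else l - 5 * c.box.slab, ?_, ?_⟩
  · split_ifs <;> omega
  · unfold row
    split_ifs <;> omega

theorem exists_support_of_mem_supportFaces (hw : c.box.lo < c.box.hi) {f : GridFace}
    (hf : f ∈ supportFaces c.box) : ∃ i, ∃ q ≤ 4, f = c.support i q := by
  have hwe := c.width_eq
  have hg := c.girth_eq
  rcases hf with ⟨top, k, l, rfl, h1, h2, h3, h4⟩ | ⟨l, hf, h3, h4⟩
  · obtain ⟨q, hq, rfl⟩ := exists_row h3 h4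
    obtain ⟨j, hj, hjk⟩ : ∃ j < c.width, c.interval j = k := by
      refine ⟨if c.mirrored then 4 * c.box.hi - 1 - k else k - 4 * c.box.lo, ?_, ?_⟩
      · split_ifs <;> omega
      · unfold interval
        split_ifs <;> omega
    by_cases ht : top = !c.inverted
    · refine ⟨j, q, hq, ?_⟩
      unfold support
      rw [mod_of_lt (by omega), if_pos hj, hjk, ht]
    · refine ⟨2 * c.width - j, q, hq, ?_⟩
      unfold support
      rw [mod_of_lt (by omega), if_neg (by omega), if_neg (by omega), if_pos (by omega),
        show 2 * c.width - (2 * c.width - j) = j by omega, hjk]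
      congr 1
      cases top <;> cases hi : c.inverted <;> simp_all
  · obtain ⟨q, hq, rfl⟩ := exists_row h3 h4
    have h5 : c.support c.width q = .lateral (!c.mirrored) (c.plane c.width) (c.row q) := by
      unfold support
      rw [mod_of_lt (by omega), if_neg (by omega), if_pos rfl]
    have h6 : c.support (2 * c.width + 1) q = .lateral c.mirrored (c.plane 0) (c.row q) := by
      unfold support
      rw [mod_of_lt (by omega), if_neg (by omega), if_neg (by omega), if_neg (by omega)]
    unfold plane at h5 h6
    cases hm : c.mirrored <;> rw [hm] at h5 h6 <;> rcases hf with rfl | rfl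
    · exact ⟨_, q, hq, by rw [h5]; simp; omega⟩
    · exact ⟨_, q, hq, by rw [h6]; simp⟩
    · exact ⟨_, q, hq, by rw [h6]; simp⟩
    · exact ⟨_, q, hq, by rw [h5]; simp; omega⟩

/-! ### Direct recursive calls -/

/-- A direct recursive call is for a child of the box. -/
structure ChildCall (cells : Finset (ℕ × ℕ)) (c d : Call) : Prop where
  valid : d.Valid cells
  adj : (dualGraph cells).Adj c.box d.box
  parent : d.parent = some c.box
  ne_parent : some d.box ≠ c.parent

theorem Joined.childCall {i j q : ℕ} {u : Bool} (h : Joined cells c d i j q u) :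
    ChildCall cells c d := ⟨h.valid, h.adj, h.parent, h.ne_parent⟩

theorem Valid.childCall (h : c.Valid cells) (hd : IsSubcall cells c d) : ChildCall cells c d := by
  rcases hd with ⟨i, hi, hd⟩ | hd | ⟨i, hi, hd⟩
  · rw [Finset.mem_Ico] at hi
    exact (h.joined_front hi.1 hi.2 hd).childCall
  · exact (h.joined_reverse hd).childCall
  · rw [Finset.mem_Icc] at hi
    exact (h.joined_back hi.1 hi.2 hd).childCall

theorem exists_adjacentBox {z : Box} (hz : (dualGraph cells).Adj c.box z) :
    ∃ up m, 4 * m < c.width ∧ c.adjacentBox cells up m = some z := by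
  obtain ⟨ha, hz, h1, h2⟩ := hz
  rw [max_lt_iff, lt_min_iff, lt_min_iff] at h2
  have hw := c.width_eq
  obtain ⟨m, hm, hm'⟩ : ∃ m, 4 * m < c.width ∧ c.cell m = max c.box.lo z.lo := by
    refine ⟨if c.mirrored then c.box.hi - 1 - max c.box.lo z.lo else max c.box.lo z.lo - c.box.lo,
      ?_, ?_⟩
    · split_ifs <;> omega
    · unfold cell
      split_ifs <;> omega
  refine ⟨decide (c.box.slab + 1 = z.slab), m, hm, adjacentBox_eq_some_iff.2 ⟨hz, ?_, ?_, ?_⟩⟩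
  · by_cases h3 : c.box.slab + 1 = z.slab <;> simp [h3]
    omega
  · omega
  · omega

/-- All children are unfolded. -/
theorem Valid.exists_subcall (h : c.Valid cells) {z : Box} (hz : (dualGraph cells).Adj c.box z)
    (hzp : some z ≠ c.parent) : ∃ d, IsSubcall cells c d ∧ d.box = z := by
  obtain ⟨up, m, hm, hb⟩ := exists_adjacentBox hz
  by_cases hu : up = c.reversed
  · rw [hu] at hb
    obtain ⟨i, d, h1, h2, h3, h4⟩ := h.exists_frontSuture hm hb hzp
    exact ⟨d, Or.inl ⟨i, Finset.mem_Ico.2 ⟨h1, h2⟩, h3⟩, h4⟩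
  · rw [show up = !c.reversed by cases up <;> cases hr : c.reversed <;> simp_all] at hb
    rcases h.exists_backSuture hm hb with ⟨d, h1, h2⟩ | ⟨i, d, h1, h2, h3, h4⟩
    · exact ⟨d, Or.inr (Or.inl h1), h2⟩
    · exact ⟨d, Or.inr (Or.inr ⟨i, Finset.mem_Icc.2 ⟨h1, h2⟩, h3⟩), h4⟩

theorem pairwise_filterMap_range {n : ℕ} {F : ℕ → Option Call}
    (h : ∀ q < n, ∀ q' < n, ∀ d d', F q = some d → F q' = some d' → d.box = d'.box → q = q') :
    ((List.range n).filterMap F).Pairwise fun d d' => d.box ≠ d'.box := by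
  rw [List.pairwise_filterMap]
  refine List.nodup_range.pairwise_of_forall_ne fun q hq q' hq' hne d hd d' hd' hb => ?_
  rw [List.mem_range] at hq hq'
  exact hne (h q hq q' hq' d d' hd hd' hb)

/-- No child is unfolded twice. -/
theorem Valid.pairwise_subcalls (h : c.Valid cells) :
    (c.subcalls cells).Pairwise fun d d' => d.box ≠ d'.box := by
  -- Front and back children lie in different slabs, so only calls on the same face have to be
  -- compared.
  have front_slab : ∀ {i d}, c.start ≤ i → i < c.girth + c.t → c.frontSuture cells i = some d →
      if c.reversed then d.box.slab = c.box.slab + 1 else d.box.slab + 1 = c.box.slab := by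
    intro i d h1 h2 h3
    obtain ⟨b, -, rfl, ⟨ρ, -, -, -, -, h4, -⟩ | ⟨l, -, -, -, -, -, h4, -⟩⟩ :=
      h.frontSuture_cases h1 h2 h3 <;> exact (adjacentBox_eq_some_iff.1 h4).2.1
  have back_slab : ∀ {m b d}, c.adjacentBox cells (!c.reversed) m = some b →
      (if c.reversed then d = c.box.slab + 1 else d + 1 = c.box.slab) → b.slab ≠ d := by
    intro m b d h1 h2 h3
    have h4 := (adjacentBox_eq_some_iff.1 h1).2.1
    cases hr : c.reversed <;> simp [hr] at h2 h4 <;> omega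
  unfold subcalls
  refine List.pairwise_append.2 ⟨List.pairwise_append.2 ⟨?_, ?_, ?_⟩, ?_, ?_⟩
  · refine pairwise_filterMap_range fun q _ q' _ d d' hd hd' hb => ?_
    have := frontSuture_injective (by omega) (by omega) hd hd' hb
    omega
  · cases c.reverseSuture cells <;> simp
  · intro d hd d' hd' hb
    rw [List.mem_filterMap] at hd
    obtain ⟨q, hq, hd⟩ := hd
    rw [List.mem_range] at hq
    rw [Option.mem_toList] at hd'
    obtain ⟨υ, b, h1, h2, h3, h4, h5, -⟩ := (reverseSuture_eq_some h).1 hd'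
    exact back_slab h4 (front_slab (by omega) (by omega) hd) (by rw [hb, h5])
  · refine pairwise_filterMap_range fun q hq q' hq' d d' hd hd' hb => ?_
    have := backSuture_injective (by omega) (by omega) hd hd' hb
    omega
  · intro d hd d' hd' hb
    rw [List.mem_filterMap] at hd'
    obtain ⟨q', hq', hd'⟩ := hd'
    rw [List.mem_range] at hq'
    rcases List.mem_append.1 hd with hd | hd
    · rw [List.mem_filterMap] at hd
      obtain ⟨q, hq, hd⟩ := hd
      rw [List.mem_range] at hq
      obtain ⟨b, ρ, rfl, h1, h2, h3, -, h4, -⟩ := h.backSuture_cases (by omega) (by omega) hd'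
      exact back_slab h4 (front_slab (by omega) (by omega) hd) (by rw [hb]; rfl)
    · rw [Option.mem_toList] at hd
      exact h.reverseSuture_ne_backSuture hd hd' hb

end Call
end ManhattanTower

/-! ### Induction over the recursion tree -/

namespace ManhattanTower

open Set

namespace SingleLayerMT

variable (P : SingleLayerMT)

/-- A call with the given recursion depth unfolds exactly the surface of its subtree. -/
structure Unfolds (r : Box) (depth : ℕ) (c : Call) : Prop where
  unrolls : UnrollsCall (unfoldDepth P.cells depth) c
  nodup : ((unfoldDepth P.cells depth c none).map Step.face).Nodup
  boundary : ∀ f ∈ (unfoldDepth P.cells depth c none).map Step.face,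
    ∃ b ∈ subtree P.cells r c.box, BoundaryFace P.cells b f
  support : ∀ b ∈ subtree P.cells r c.box, ∀ f ∈ supportFaces b,
    f ∈ (unfoldDepth P.cells depth c none).map Step.face

variable {P} {r : Box}

/-- The gridfaces of the call are its own and those of its subcalls. They belong to boxes of
disjoint sets, the box itself and the subtrees of its children, so they are distinct; and every
child has a subcall. -/
theorem IsParent.unfolds {depth : ℕ} {c : Call} (hp : P.IsParent r c.box c.parent)
    (hc : c.Valid P.cells) (hd : (subtree P.cells r c.box).ncard ≤ depth) :
    P.Unfolds r depth c := by
  have hself : c.box ∈ subtree P.cells r c.box := (hp.mem_subtree hc.isBox).2 (Or.inl rfl)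
  induction depth generalizing c with
  | zero => exact absurd ((ncard_pos finite_subtree).2 ⟨_, hself⟩) (by omega)
  | succ depth ih =>
    have sub : ∀ d, IsSubcall P.cells c d → P.Unfolds r depth d := by
      intro d h
      have hk := hc.childCall h
      have hpd : P.IsParent r d.box d.parent := by
        rw [hk.parent]
        exact hp.child hk.adj hk.ne_parent
      have := hp.ncard_child_lt hk.adj hk.ne_parent
      exact ih hpd hk.valid (by omega) ((hpd.mem_subtree hk.valid.isBox).2 (Or.inl rfl))
    have ht : c.t ≤ c.backStart P.cells + 1 := by
      have := hc.bounds
      omega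
    have hperm := Call.faces_unfoldDepth ht (fun d h => (sub d h).unrolls) none
    have hmem : ∀ {d}, d ∈ c.subcalls P.cells → IsSubcall P.cells c d := (Call.mem_subcalls ht).1
    refine ⟨hc.unrollsCall fun d h => (sub d h).unrolls, hperm.nodup_iff.2 ?_, fun f hf => ?_,
      fun b hb f hf => ?_⟩
    · refine List.nodup_append.2 ⟨hc.nodup_ownFaces, List.nodup_flatMap.2
        ⟨fun d h => (sub d (hmem h)).nodup, ?_⟩, ?_⟩
      · refine hc.pairwise_subcalls.imp_of_mem fun {d d'} h h' hne f hf hf' => ?_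
        have hk := hc.childCall (hmem h)
        have hk' := hc.childCall (hmem h')
        obtain ⟨b, hb, hbf⟩ := (sub d (hmem h)).boundary f hf
        obtain ⟨b', hb', hbf'⟩ := (sub d' (hmem h')).boundary f hf'
        obtain rfl := hbf.box_eq hb.1 hb'.1 hbf'
        exact disjoint_left.1
          (hp.disjoint_children hk.adj hk.ne_parent hk'.adj hk'.ne_parent hne) hb hb'
      · rintro f hf g hg rfl
        obtain ⟨d, h, hg⟩ := List.mem_flatMap.1 hg
        have hk := hc.childCall (hmem h)
        obtain ⟨b, hb, hbf⟩ := (sub d (hmem h)).boundary f hg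
        obtain rfl := (hc.boundaryFace_of_mem_ownFaces hf).box_eq hc.isBox hb.1 hbf
        exact hp.self_notMem_child hk.adj hk.ne_parent hb
    · rcases List.mem_append.1 (hperm.mem_iff.1 hf) with hf | hf
      · exact ⟨_, hself, hc.boundaryFace_of_mem_ownFaces hf⟩
      · obtain ⟨d, h, hf⟩ := List.mem_flatMap.1 hf
        have hk := hc.childCall (hmem h)
        obtain ⟨b, hb, hbf⟩ := (sub d (hmem h)).boundary f hf
        exact ⟨b, (hp.mem_subtree hc.isBox).2 (Or.inr ⟨_, hk.adj, hk.ne_parent, hb⟩), hbf⟩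
    · refine hperm.mem_iff.2 (List.mem_append.2 ?_)
      rcases (hp.mem_subtree hc.isBox).1 hb with rfl | ⟨z, hz, hzp, hb⟩
      · obtain ⟨i, q, hq, rfl⟩ := Call.exists_support_of_mem_supportFaces hc.isBox.1 hf
        exact Or.inl (hc.support_mem_ownFaces i hq)
      · obtain ⟨d, h, rfl⟩ := hc.exists_subcall hz hzp
        exact Or.inr (List.mem_flatMap.2
          ⟨d, (Call.mem_subcalls ht).2 h, (sub d h).support b hb f hf⟩)

/-- All calls of the algorithm are valid and follow the recursion tree. -/
theorem IsRootBox.valid_of_isCallFrom (hr : P.IsRootBox r) {s t : ℕ} (hs : s ≤ 4 * (r.hi - r.lo))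
    (ht : t ≤ 4 * (r.hi - r.lo)) (hst : s = t + 1 ∨ t = s + 1) {c : Call}
    (hc : IsCallFrom P.cells (rootCall r s t) c) :
    c.Valid P.cells ∧ P.IsParent r c.box c.parent := by
  induction hc with
  | refl => exact ⟨Call.valid_rootCall hr hs ht hst, rfl⟩
  | tail _ h ih =>
    have hk := ih.1.childCall h
    refine ⟨hk.valid, ?_⟩
    rw [hk.parent]
    exact ih.2.child hk.adj hk.ne_parent

theorem Icc_subset_segment {x y y' z : ℝ} (h : y < y') :
    Icc (![x, y, z] : Fin 3 → ℝ) ![x, y', z] ⊆ segment ℝ ![x, y, z] ![x, y', z] := by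
  intro p hp
  simp only [mem_Icc, Pi.le_def, Fin.forall_fin_succ] at hp
  simp at hp
  have h' := sub_pos.2 h
  refine ⟨(y' - p 1) / (y' - y), (p 1 - y) / (y' - y), div_nonneg (by linarith) h'.le,
    div_nonneg (by linarith) h'.le, by field_simp; ring, ?_⟩
  ext i
  fin_cases i
  · simp
    field_simp
    nlinarith
  · simp
    field_simp
    ring
  · simp
    field_simp
    nlinarith

/-- In a reversed frame the row runs towards smaller `y`, so the ends of the segment are exchanged.
-/
theorem gridedge_subset_segment (c : Call) (p : ℕ) (top : Bool) : P.gridedge c p top ⊆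
    segment ℝ (P.point (c.plane p, c.rowPlane 0, xor top c.inverted))
      (P.point (c.plane p, c.rowPlane 1, xor top c.inverted)) := by
  have h := Icc_subset_segment (x := P.X (c.plane p))
    (z := if xor top c.inverted then P.height else 0) (P.Y_lt (c.row 0))
  unfold gridedge
  cases hr : c.reversed
  · have h0 : c.rowPlane 0 = c.row 0 := by simp [Call.rowPlane, Call.row, hr]
    have h1 : c.rowPlane 1 = c.row 0 + 1 := by simp [Call.rowPlane, Call.row, hr]
    rw [h0, h1]
    exact h
  · have h0 : c.rowPlane 0 = c.row 0 + 1 := by simp [Call.rowPlane, Call.row, hr]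
    have h1 : c.rowPlane 1 = c.row 0 := by simp [Call.rowPlane, Call.row, hr]
    rw [h0, h1, segment_symm]
    exact h

end SingleLayerMT

namespace Call

variable {c : Call} {cells : Finset (ℕ × ℕ)}

theorem Valid.vertex_start (h : c.Valid cells) (q : ℕ) :
    c.vertex c.start q = (c.plane c.s, c.rowPlane q, xor c.sTop c.inverted) := by
  have hs : c.s ≤ c.width := by
    rcases h.kind with h | ⟨p, -, -, h | h⟩ <;> omega
  unfold start
  cases c.sTop
  · rw [if_neg (by simp), vertex_bottom (p := c.s) q (by omega) (by omega)]
    simp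
  · rw [if_pos rfl]
    split_ifs
    · rw [vertex_top q hs]
      simp
    · rw [vertex_of_eq_add_girth (p := c.s) q rfl, vertex_top q hs]
      simp

theorem Valid.vertex_t (h : c.Valid cells) (q : ℕ) :
    c.vertex c.t q = (c.plane c.t, c.rowPlane q, xor true c.inverted) := by
  rw [vertex_top q h.t_le]
  simp

end Call

namespace SingleLayerMT

variable {P : SingleLayerMT} {c : Call}

theorem startEdge_subset_segment (h : c.Valid P.cells) : P.startEdge c ⊆
    segment ℝ (P.point ((c.panel c.start 0 true).corner false false))
      (P.point ((c.panel c.start 0 true).corner false true)) := by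
  rw [Call.corner_panel h.isBox.1 _ (Nat.zero_le _), Call.corner_panel h.isBox.1 _ (Nat.zero_le _)]
  simp only [Bool.toNat_false, Bool.toNat_true, add_zero, zero_add, h.vertex_start]
  exact gridedge_subset_segment c _ _

/-- Boundary `t` is the left side of column `t` in clockwise direction, hence the right edge of the
turned panel. -/
theorem endEdge_subset_segment (h : c.Valid P.cells) : P.endEdge c ⊆
    segment ℝ (P.point ((c.panel c.t 0 false).corner true false))
      (P.point ((c.panel c.t 0 false).corner true true)) := by
  rw [Call.corner_panel_backward h.isBox.1 _ (Nat.zero_le _),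
    Call.corner_panel_backward h.isBox.1 _ (Nat.zero_le _), segment_symm]
  simp only [Bool.not_true, Bool.not_false, Bool.toNat_false, Bool.toNat_true, add_zero, zero_add,
    h.vertex_t]
  exact gridedge_subset_segment c _ _

end SingleLayerMT
end ManhattanTower

theorem theorem1 (P : ManhattanTower.SingleLayerMT) (r : ManhattanTower.Box)
    (hr : P.IsRootBox r) (s t : ℕ) (hs : s ≤ 4 * (r.hi - r.lo)) (ht : t ≤ 4 * (r.hi - r.lo))
    (hst : s = t + 1 ∨ t = s + 1) (c : ManhattanTower.Call)
    (hc : ManhattanTower.IsCallFrom P.cells (ManhattanTower.rootCall r s t) c) :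
    -- the algorithm yields one piece of the surface of the boxes in the subtree of the call,
    P.IsPiece (ManhattanTower.UNFOLD P.cells c) ∧
    (∀ f ∈ (ManhattanTower.UNFOLD P.cells c).map ManhattanTower.Step.face,
      P.carrier f ⊆ frontier P.solid ∧
      ∃ b ∈ ManhattanTower.subtree P.cells r c.box, P.carrier f ⊆ P.boxSolid b) ∧
    -- which contains all support faces of all of these boxes,
    (∀ b ∈ ManhattanTower.subtree P.cells r c.box, ∀ f ∈ ManhattanTower.supportFaces b,
      f ∈ (ManhattanTower.UNFOLD P.cells c).map ManhattanTower.Step.face) ∧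
    -- and this piece unfolds into the plane
    ∃ Φ : ManhattanTower.GridFace → ManhattanTower.Placement,
      P.IsDevelopment (ManhattanTower.UNFOLD P.cells c) Φ ∧
      -- without overlap,
      (∀ f ∈ (ManhattanTower.UNFOLD P.cells c).map ManhattanTower.Step.face,
        ∀ g ∈ (ManhattanTower.UNFOLD P.cells c).map ManhattanTower.Step.face, f ≠ g →
          Disjoint (interior (P.planarFace Φ f)) (interior (P.planarFace Φ g))) ∧
      -- horizontally monotone,
      (∀ x : ℝ, IsPreconnected {p ∈ P.planarStrip (ManhattanTower.UNFOLD P.cells c) Φ | p.1 = x}) ∧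
      -- with the start edge on the left and the end edge on the right of all of it
      ∃ x₁ x₂ : ℝ, x₁ < x₂ ∧
        (∃ f, ((ManhattanTower.UNFOLD P.cells c).map ManhattanTower.Step.face).head? = some f ∧
          P.startEdge c ⊆ P.carrier f ∧ ∀ p ∈ P.startEdge c, ((Φ f).apply p).1 = x₁) ∧
        (∃ f ∈ (ManhattanTower.UNFOLD P.cells c).map ManhattanTower.Step.face,
          P.endEdge c ⊆ P.carrier f ∧ ∀ p ∈ P.endEdge c, ((Φ f).apply p).1 = x₂) ∧
        ∀ p ∈ P.planarStrip (ManhattanTower.UNFOLD P.cells c) Φ, x₁ ≤ p.1 ∧ p.1 ≤ x₂ := by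
  obtain ⟨hv, hp⟩ := hr.valid_of_isCallFrom hs ht hst hc
  -- A subtree has at most as many boxes as there are cells, so the depth in `UNFOLD` suffices.
  have hu : P.Unfolds r P.cells.card c := hp.unfolds hv
    ((Set.ncard_le_ncard (fun _ hb => hb.1) P.finite_boxes).trans P.ncard_boxes_le)
  obtain ⟨rest, hrest, hclimb⟩ := hu.unrolls
  -- The planar strip starts with a column that consists of the first panel alone.
  obtain ⟨τ, hτ⟩ := hclimb []
  have hξ : ManhattanTower.UNFOLD P.cells c =
    ⟨none, (c.panel c.start 0 true).1⟩ :: rest := hrest none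
  have hnodup := hu.nodup
  rw [hrest none] at hnodup
  obtain ⟨hpiece, Φ, h1, h2, h3, x₁, x₂, h4, h5, h6, h7, h8⟩ := P.exists_development hτ hnodup
  rw [← hξ] at hpiece h1 h2 h3 h6 h8
  refine ⟨hpiece, fun f hf => ?_, hu.support, Φ, h1, h2, h3, x₁, x₂, h4, ⟨_, by rw [hξ]; rfl, ?_, ?_⟩,
    ⟨_, h6, ?_, ?_⟩, h8⟩
  · obtain ⟨b, hb, hf⟩ := hu.boundary f hf
    exact ⟨hf.carrier_subset_frontier hb.1, b, hb, hf.carrier_subset_boxSolid hb.1.1⟩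
  · exact (ManhattanTower.SingleLayerMT.startEdge_subset_segment hv).trans
      (P.segment_subset_carrier _ _ _ _ _)
  · exact fun p hp => h5 p (ManhattanTower.SingleLayerMT.startEdge_subset_segment hv hp)
  · exact (ManhattanTower.SingleLayerMT.endEdge_subset_segment hv).trans
      (P.segment_subset_carrier _ _ _ _ _)
  · exact fun p hp => h7 p (ManhattanTower.SingleLayerMT.endEdge_subset_segment hv hp)
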